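/- Let $\mathbb T=\mathbb R/2\pi\mathbb Z$, let $L^2(\mathbb T)=L^2(\mathbb T;\mathbb C)$ be taken with respect to $\frac{dx}{2\pi}$, let $\alpha\in\mathbb R$, $q\in\mathbb N^*$, and let $Q=(Q_0,\dots,Q_{q-1})\in C^\infty(\mathbb T;\mathbb R^q)$ satisfy $$\{1,\sin x,\cos x,\sin 2x,\cos 2x\}\subset\mathrm{span}_{\mathbb R}\{Q_0,\dots,Q_{q-1}\}.$$ For $T\ge 0$, a piecewise constant control $u:(0,T)\to\mathbb R^q$ and $\psi_0\in L^2(\mathbb T)$, let $\psi=\psi(\cdot\,,\psi_0,u)\in C([0,T];L^2(\mathbb T))$ be the mild solution of $$\partial_t\psi+\partial_x^3\psi-i\alpha\,\partial_x^2\psi=i\,(u(t)\cdot Q(x))\,\psi,\qquad \psi(0)=\psi_0,$$ that is, with $L=-\partial_x^3+i\alpha\partial_x^2$, $$\psi(t)=e^{tL}\psi_0+\int_0^t e^{(t-s)L}\,i(u(s)\cdot Q)\psi(s)\,ds,\qquad t\in[0,T].$$ A unitary operator $S$ on $L^2(\mathbb T)$ is called $L^2$-STAR if for every $\psi_0\in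 L^2(\mathbb T)$ with $\|\psi_0\|_{L^2}=1$ and every $\varepsilon>0$ there exist $T\in[0,\varepsilon]$, $\beta\in[0,2\pi)$ and a piecewise constant control $u:(0,T)\to\mathbb R^q$ such that $$\|\psi(T,\psi_0,u)-e^{i\beta}S\psi_0\|_{L^2}<\varepsilon .$$ For $f\in C^\infty(\mathbb T;\mathbb R)$ let $T_f=f\partial_x+\tfrac12 f'$ with domain $D(T_f)=\{\psi\in L^2(\mathbb T): f\partial_x\psi\in L^2(\mathbb T)\}$, where $f\partial_x\psi$ is taken in the sense of distributions, and let $(e^{tT_f})_{t\in\mathbb R}$ denote the strongly continuous unitary group on $L^2(\mathbb T)$ with generator $T_f$. Let $$G=\{(\varphi')^2:\varphi\in C^\infty(\mathbb T;\mathbb R)\},\qquad \mathrm{cone}(G)=\Big\{\sum_{j=1}^m a_jg_j:\ m\in\mathbb N^*,\ g_j\in G,\ a_j\ge0\Big\},$$ and let $\mathrm{span}(G)$ be the real linear span of $G$. Then: 1. for every $f\in\mathrm{span}(G)$, the operator $T_f$ generates one and only one strongly continuous unitary group $(e^{tT_f})_{t\in\mathbb R}$, so that the operators below are well defined; 2.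 for every $f\in\mathrm{cone}(G)$, $e^{-T_f}=e^{T_{-f}}$, and this operator is $L^2$-STAR; 3. for every $f\in\mathrm{span}(G)$, the operator $e^{T_f}$ is $L^2$-STAR. -/

import Mathlib

open MeasureTheory Set
open scoped ENNReal ContDiff

namespace KdVSch

noncomputable section

instance instFactTwoPiPos : Fact ((0 : ℝ) < 2 * Real.pi) := ⟨Real.two_pi_pos⟩

/-- The torus `ℝ / 2πℤ`. -/
abbrev Torus : Type := AddCircle (2 * Real.pi)

/-- The Haar measure of total mass one on the torus, that is `dx / 2π`. -/
abbrev torusMeasure : Measure Torus := AddCircle.haarAddCircle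

/-- The complex Hilbert space `L²(𝕋)`. -/
abbrev L2 : Type := Lp ℂ 2 torusMeasure

/-! ### Smooth functions on the torus -/

/-- `f` is of class `C^∞` on the torus: its `2π`-periodic lift to the line is `C^∞`. -/
def SmoothOnTorus {F : Type*} [NormedAddCommGroup F] [NormedSpace ℝ F] (f : Torus → F) : Prop :=
  ContDiff ℝ ∞ (fun x : ℝ => f (x : Torus))

/-- The derivative `f'` of a function on the torus, as a function on the torus. -/
def torusDeriv {F : Type*} [NormedAddCommGroup F] [NormedSpace ℝ F] (f : Torus → F) : Torus → F :=
  fun θ => deriv (fun s : ℝ => f (θ + (s : Torus))) 0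

/-! ### The free evolution `e^{tL}`, `L = -∂ₓ³ + iα∂ₓ²` -/

/-- The Fourier symbol of `L = -∂ₓ³ + iα∂ₓ²`, i.e. `L e^{ikx} = symbolL α k • e^{ikx}`. -/
def symbolL (α : ℝ) (k : ℤ) : ℂ :=
  -(Complex.I * (k : ℂ)) ^ 3 + Complex.I * (α : ℂ) * (Complex.I * (k : ℂ)) ^ 2

theorem symbolL_eq (α : ℝ) (k : ℤ) :
    symbolL α k = (((k : ℝ) ^ 3 - α * (k : ℝ) ^ 2 : ℝ) : ℂ) * Complex.I := by
  have h3 : Complex.I ^ 3 = -Complex.I := Complex.I_pow_three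
  have h2 : Complex.I ^ 2 = -1 := Complex.I_sq
  unfold symbolL
  rw [mul_pow, mul_pow, h3, h2]
  push_cast
  ring

theorem norm_exp_symbolL (α t : ℝ) (k : ℤ) : ‖Complex.exp ((t : ℂ) * symbolL α k)‖ = 1 := by
  rw [symbolL_eq, ← mul_assoc, ← Complex.ofReal_mul, Complex.norm_exp_ofReal_mul_I]

theorem memℓp_freeFlow (α t : ℝ) (a : lp (fun _ : ℤ => ℂ) 2) :
    Memℓp (fun k : ℤ => Complex.exp ((t : ℂ) * symbolL α k) * a k) 2 := by
  refine memℓp_norm_iff.1 ?_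
  simp only [norm_mul, norm_exp_symbolL, one_mul]
  exact memℓp_norm_iff.2 (lp.memℓp a)

/-- The operator `e^{tL}` on `L²(𝕋)`: multiplication of the `k`-th Fourier coefficient by
`exp (t * symbolL α k)`. -/
def freeFlow (α t : ℝ) (ψ : L2) : L2 :=
  (fourierBasis (T := 2 * Real.pi)).repr.symm
    ⟨fun k : ℤ => Complex.exp ((t : ℂ) * symbolL α k) *
      (fourierBasis (T := 2 * Real.pi)).repr ψ k, memℓp_freeFlow α t _⟩

/-! ### The controlled equation -/

/-- The purely imaginary potential `i (v · Q)` for a control value `v ∈ ℝ^q`. -/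
def potential {q : ℕ} (Q : Fin q → C(Torus, ℝ)) (v : Fin q → ℝ) : C(Torus, ℂ) where
  toFun θ := Complex.I * ((∑ j, v j * Q j θ : ℝ) : ℂ)
  continuous_toFun := by fun_prop

/-- Multiplication of an element of `L²(𝕋)` by a continuous function. -/
def mulL2 (a : C(Torus, ℂ)) (ψ : L2) : L2 :=
  (ContinuousMap.toLp (E := ℂ) ∞ torusMeasure ℂ a : Lp ℂ ∞ torusMeasure) • ψ

/-- `u` is piecewise constant on `(0, T)`: there is a finite subdivision
`0 = τ 0 ≤ τ 1 ≤ ⋯ ≤ τ N = T` such that `u` is constant on each `(τ i, τ (i+1))`. -/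
def PiecewiseConst {q : ℕ} (T : ℝ) (u : ℝ → Fin q → ℝ) : Prop :=
  ∃ (N : ℕ) (τ : ℕ → ℝ), Monotone τ ∧ τ 0 = 0 ∧ τ N = T ∧
    ∀ i < N, ∃ c : Fin q → ℝ, ∀ s ∈ Ioo (τ i) (τ (i + 1)), u s = c

/-- `ψ ∈ C([0,T]; L²(𝕋))` is the (mild) solution on `[0,T]` of
`∂ₜψ + ∂ₓ³ψ - iα∂ₓ²ψ = i (u·Q) ψ`, `ψ(0) = ψ₀`, that is, it satisfies the Duhamel formula
`ψ(t) = e^{tL}ψ₀ + ∫₀ᵗ e^{(t-s)L} i (u(s)·Q) ψ(s) ds`. -/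
def IsSolution {q : ℕ} (α : ℝ) (Q : Fin q → C(Torus, ℝ)) (T : ℝ) (u : ℝ → Fin q → ℝ)
    (ψ₀ : L2) (ψ : ℝ → L2) : Prop :=
  ContinuousOn ψ (Icc 0 T) ∧
  ∀ t ∈ Icc 0 T,
    ψ t = freeFlow α t ψ₀ + ∫ s in (0 : ℝ)..t, freeFlow α (t - s) (mulL2 (potential Q (u s)) (ψ s))

/-- The condition `{1, sin x, cos x, sin 2x, cos 2x} ⊂ span {Q₀, …, Q_{q-1}}`. -/
def ControlsSpan {q : ℕ} (Q : Fin q → C(Torus, ℝ)) : Prop :=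
  ({fun _ => 1, fun x => Real.sin x, fun x => Real.cos x,
      fun x => Real.sin (2 * x), fun x => Real.cos (2 * x)} : Set (ℝ → ℝ)) ⊆
    (Submodule.span ℝ (range fun (j : Fin q) (x : ℝ) => Q j (x : Torus)) : Set (ℝ → ℝ))

/-- The unitary operator `S` is `L²`-STAR (small-time approximately reachable): for every unit
vector `ψ₀` and `ε > 0` the controlled evolution can be driven in a time `T ≤ ε` from `ψ₀` to
within `ε` of `S ψ₀`, up to a global phase `e^{iβ}`. -/
def L2STAR {q : ℕ} (α : ℝ) (Q : Fin q → C(Torus, ℝ)) (S : L2 ≃ₗᵢ[ℂ] L2) : Prop :=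
  ∀ ψ₀ : L2, ‖ψ₀‖ = 1 → ∀ ε : ℝ, 0 < ε →
    ∃ T ∈ Icc (0 : ℝ) ε, ∃ β ∈ Ico (0 : ℝ) (2 * Real.pi), ∃ u : ℝ → Fin q → ℝ,
      PiecewiseConst T u ∧ ∃ ψ : ℝ → L2, IsSolution α Q T u ψ₀ ψ ∧
        ‖ψ T - Complex.exp (Complex.I * (β : ℂ)) • S ψ₀‖ < ε

/-! ### The transport operators and the groups they generate -/

/-- `η ∈ L²` is `f ∂ₓψ` in the sense of distributions (for a smooth real `f`):
`∫ η χ = -∫ ψ (f χ)'` for every test function `χ ∈ C^∞(𝕋; ℂ)`. -/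
def IsWeakDirDeriv (f : Torus → ℝ) (ψ η : L2) : Prop :=
  ∀ χ : Torus → ℂ, SmoothOnTorus χ →
    ∫ θ, η θ * χ θ ∂torusMeasure =
      -∫ θ, ψ θ * torusDeriv (fun θ' => (f θ' : ℂ) * χ θ') θ ∂torusMeasure

/-- The graph of `T_f = f ∂ₓ + f'/2` with domain `{ψ ∈ L² : f ∂ₓψ ∈ L²}`: `ψ` is in the domain
and `T_f ψ = ζ`. -/
def TransportGraph (f : Torus → ℝ) (ψ ζ : L2) : Prop :=
  ∃ η : L2, IsWeakDirDeriv f ψ η ∧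
    ∀ᵐ θ ∂torusMeasure, ζ θ = η θ + (1 / 2 : ℂ) * ((torusDeriv f θ : ℝ) : ℂ) * ψ θ

/-- `E` is the unitary group `(e^{t T_f})_{t ∈ ℝ}`: a strongly continuous one-parameter group of
unitary operators whose infinitesimal generator (with its exact domain) is `T_f`. -/
structure IsTransportGroup (f : Torus → ℝ) (E : ℝ → (L2 ≃ₗᵢ[ℂ] L2)) : Prop where
  map_zero : E 0 = 1
  map_add : ∀ s t : ℝ, E (s + t) = E s * E t
  strongly_continuous : ∀ ψ : L2, Continuous fun t => E t ψ
  generator : ∀ ψ ζ : L2, HasDerivAt (fun t => E t ψ) ζ 0 ↔ TransportGraph f ψ ζ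

/-! ### The profiles -/

/-- `G = {(φ')² : φ ∈ C^∞(𝕋; ℝ)}`. -/
def profiles : Set (Torus → ℝ) :=
  {f | ∃ φ : Torus → ℝ, SmoothOnTorus φ ∧ f = fun θ => torusDeriv φ θ ^ 2}

/-- The convex cone generated by `G`: the sums `∑_{j=1}^m a_j g_j` with `m ≥ 1`, `g_j ∈ G` and
`a_j ≥ 0`. -/
def coneProfiles : Set (Torus → ℝ) :=
  {f | ∃ (m : ℕ) (_ : 1 ≤ m) (a : Fin m → ℝ) (g : Fin m → Torus → ℝ),
    (∀ j, 0 ≤ a j) ∧ (∀ j, g j ∈ profiles) ∧ f = ∑ j, a j • g j}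

end

end KdVSch

open KdVSch

noncomputable section

namespace KdVSch

open Filter Topology
open scoped NNReal

/-! Conjugation by a phase turns `∂ₓ` into `∂ₓ + iΘ'`, so `e^{-iΘ} L e^{iΘ}` is a polynomial in `Θ`:
its cubic part is multiplication by `iΘ'³`, its quadratic part is `3Θ'²∂ₓ + 3Θ'Θ'' - iαΘ'²`, and the
rest has degree at most one. A large `Θ` run for a short time isolates the cubic part and, once that
is corrected, the quadratic one. The first yields every phase as a reachable operator, the second
yields the transports.

Phases. A control `v / T` on `[0, T]` acts, as `T → 0`, like multiplication by `e^{i v·Q}`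
(`approxReachable_phase_small`). If all multiples of `p` are reachable phases, then `e^{-ip/d}
e^{d³L} e^{ip/d}` tends to `e^{i p'³}` as `d → 0` (`approxReachable_phase_cube`). Polarising cubes
gives the products `a'b'c'`, and with frequencies `n, 1, 1` these produce frequency `n + 2`. Hence
all trigonometric polynomials are reachable, and by uniform density all continuous phases
(`isReachablePhase_of_contPer`).

Transport. For `Θ = φ / √h` and duration `h²`, the cubic part contributes `i√h φ'³`, which a
reachable phase removes, and the quadratic part contributes `h (3φ'²∂ₓ + 3φ'φ'' - iαφ'²)`; the error
is `O(h^{3/2})` (`consistent_transportStep`). Composing two such steps and cancelling the `α` term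
by another phase gives `1 + h T_f + O(h^{3/2})` with `f = 3(φ₁'² + φ₂'²)`. Taking `n` steps of size
`h = 1/n` gives `e^{T_f}` with error `O(n^{-1/2})` in a time `O(1/n)`
(`IsTransport.approxReachable_of_consistent`).

Arbitrary sign. Every positive smooth periodic function is a sum of two squares `φ₁'² + φ₂'²`
(`exists_sum_sq_deriv`). A general smooth `f` is made positive by adding a constant `C`, which is
compensated at each step by a rotation through `-Ch`. Backward rotations are reachable because they
are also forward rotations (`IsTransport.approxReachable_rotation`). So `e^{T_f}` is reachable for
every smooth real `f`, with no global phase, and both STAR claims are instances of this.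

All the asymptotics come from one stability estimate, `IsUnitaryGroup.norm_sub_le`: an explicit
smooth curve that solves the evolution equation up to a small defect stays close to the true
trajectory. The groups are built from the flow of `f` on smooth functions; invariance of the smooth
functions under the flow gives both uniqueness and the identification of the generator with its
exact domain (`IsTransport.hasDerivAt_iff`). -/

/-! ### Periodic functions on the line as elements of `L²(𝕋)` -/

/-- Continuous `2π`-periodic functions on the line. -/
def ContPer {F : Type*} [TopologicalSpace F] (g : ℝ → F) : Prop :=
  Continuous g ∧ Function.Periodic g (2 * Real.pi)

/-- Smooth `2π`-periodic functions on the line. -/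
def SmoothPer {F : Type*} [NormedAddCommGroup F] [NormedSpace ℝ F] (g : ℝ → F) : Prop :=
  ContDiff ℝ ∞ g ∧ Function.Periodic g (2 * Real.pi)

/-- The continuous function on the torus with a given continuous periodic lift. -/
def toTorus {F : Type*} [TopologicalSpace F] {g : ℝ → F} (h : ContPer g) : C(Torus, F) where
  toFun := h.2.lift
  continuous_toFun := by
    refine continuous_coinduced_dom.2 ?_
    exact h.1

@[simp] theorem toTorus_coe {F : Type*} [TopologicalSpace F] {g : ℝ → F} (h : ContPer g) (x : ℝ) :
    toTorus h (x : Torus) = g x := rfl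

open Classical in
/-- The element of `L²(𝕋)` defined by a continuous periodic function on the line (and `0` for
other functions). -/
def toL2 (g : ℝ → ℂ) : L2 :=
  if h : ContPer g then ContinuousMap.toLp (E := ℂ) 2 torusMeasure ℂ (toTorus h) else 0

theorem toL2_eq {g : ℝ → ℂ} (h : ContPer g) :
    toL2 g = ContinuousMap.toLp (E := ℂ) 2 torusMeasure ℂ (toTorus h) := dif_pos h

theorem contPer_lift {F : Type*} [TopologicalSpace F] (a : C(Torus, F)) :
    ContPer fun x : ℝ => a (x : Torus) := by
  refine ⟨by fun_prop, fun x => ?_⟩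
  simp

theorem toTorus_lift {F : Type*} [TopologicalSpace F] (a : C(Torus, F)) :
    toTorus (contPer_lift a) = a := by
  ext θ
  induction θ using QuotientAddGroup.induction_on with
  | H x => rfl

theorem toL2_lift (a : C(Torus, ℂ)) :
    toL2 (fun x : ℝ => a (x : Torus)) = ContinuousMap.toLp (E := ℂ) 2 torusMeasure ℂ a := by
  rw [toL2_eq (contPer_lift a), toTorus_lift]

theorem ContPer.add {F : Type*} [NormedAddCommGroup F] {f g : ℝ → F}
    (hf : ContPer f) (hg : ContPer g) :
    ContPer fun x => f x + g x := ⟨hf.1.add hg.1, hf.2.add hg.2⟩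

theorem ContPer.sub {F : Type*} [NormedAddCommGroup F] {f g : ℝ → F}
    (hf : ContPer f) (hg : ContPer g) :
    ContPer fun x => f x - g x := ⟨hf.1.sub hg.1, hf.2.sub hg.2⟩

/-- A continuous periodic function is bounded. -/
theorem ContPer.exists_bound {F : Type*} [NormedAddCommGroup F] {g : ℝ → F}
    (h : ContPer g) : ∃ K, 0 ≤ K ∧ ∀ x, ‖g x‖ ≤ K := by
  obtain ⟨K, hK⟩ := (isCompact_Icc (a := (0 : ℝ)) (b := 2 * Real.pi)).exists_bound_of_continuousOn
    h.1.continuousOn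
  refine ⟨max K 0, le_max_right _ _, fun x => ?_⟩
  obtain ⟨y, hy, hxy⟩ := h.2.exists_mem_Ico₀ Real.two_pi_pos x
  rw [hxy]
  exact (hK y ⟨hy.1, hy.2.le⟩).trans (le_max_left _ _)

section Per
variable {F : Type*} [NormedAddCommGroup F] [NormedSpace ℝ F]

theorem SmoothPer.contPer {g : ℝ → F} (h : SmoothPer g) : ContPer g :=
  ⟨h.1.continuous, h.2⟩

theorem SmoothPer.deriv {g : ℝ → F} (h : SmoothPer g) : SmoothPer (deriv g) := by
  refine ⟨(contDiff_infty_iff_deriv.1 h.1).2, fun x => ?_⟩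
  rw [← deriv_comp_add_const]
  congr 1
  exact funext fun y => h.2 y

theorem SmoothPer.differentiable {g : ℝ → F} (h : SmoothPer g) : Differentiable ℝ g :=
  h.1.differentiable (by simp)

theorem SmoothPer.hasDerivAt {g : ℝ → F} (h : SmoothPer g) (x : ℝ) :
    HasDerivAt g (_root_.deriv g x) x := (h.differentiable x).hasDerivAt

theorem SmoothPer.add {f g : ℝ → F} (hf : SmoothPer f) (hg : SmoothPer g) :
    SmoothPer fun x => f x + g x := ⟨hf.1.add hg.1, hf.2.add hg.2⟩

theorem SmoothPer.sub {f g : ℝ → F} (hf : SmoothPer f) (hg : SmoothPer g) :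
    SmoothPer fun x => f x - g x := ⟨hf.1.sub hg.1, hf.2.sub hg.2⟩

theorem SmoothPer.neg {f : ℝ → F} (hf : SmoothPer f) :
    SmoothPer fun x => -f x := ⟨hf.1.neg, fun x => by simp only [hf.2 x]⟩

theorem ContPer.mul {R : Type*} [NormedRing R] {f g : ℝ → R} (hf : ContPer f) (hg : ContPer g) :
    ContPer fun x => f x * g x := ⟨hf.1.mul hg.1, hf.2.mul hg.2⟩

theorem SmoothPer.mul {R : Type*} [NormedRing R] [NormedAlgebra ℝ R] {f g : ℝ → R}
    (hf : SmoothPer f) (hg : SmoothPer g) :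
    SmoothPer fun x => f x * g x := ⟨hf.1.mul hg.1, hf.2.mul hg.2⟩

theorem contPer_const {F : Type*} [TopologicalSpace F] (c : F) : ContPer fun _ : ℝ => c :=
  ⟨continuous_const, fun _ => rfl⟩

theorem smoothPer_const (c : F) : SmoothPer fun _ : ℝ => c :=
  ⟨contDiff_const, fun _ => rfl⟩

theorem SmoothPer.comp {E : Type*} [NormedAddCommGroup E] [NormedSpace ℝ E] {f : ℝ → E}
    {G : E → F} (hG : ContDiff ℝ ∞ G) (hf : SmoothPer f) : SmoothPer fun x => G (f x) :=
  ⟨hG.comp hf.1, fun x => by simp only [hf.2 x]⟩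

theorem ContPer.comp {E F : Type*} [TopologicalSpace E] [TopologicalSpace F] {f : ℝ → E}
    {G : E → F} (hG : Continuous G) (hf : ContPer f) : ContPer fun x => G (f x) :=
  ⟨hG.comp hf.1, fun x => by simp only [hf.2 x]⟩

theorem SmoothPer.ofReal {f : ℝ → ℝ} (hf : SmoothPer f) : SmoothPer fun x => (f x : ℂ) :=
  SmoothPer.comp Complex.ofRealCLM.contDiff hf

theorem ContPer.ofReal {f : ℝ → ℝ} (hf : ContPer f) : ContPer fun x => (f x : ℂ) :=
  hf.comp Complex.continuous_ofReal

end Per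

theorem toL2_add {f g : ℝ → ℂ} (hf : ContPer f) (hg : ContPer g) :
    toL2 (fun x => f x + g x) = toL2 f + toL2 g := by
  rw [toL2_eq hf, toL2_eq hg, toL2_eq (hf.add hg), ← map_add]
  congr 1
  ext θ
  induction θ using QuotientAddGroup.induction_on with
  | H x => rfl

theorem toL2_sub {f g : ℝ → ℂ} (hf : ContPer f) (hg : ContPer g) :
    toL2 (fun x => f x - g x) = toL2 f - toL2 g := by
  rw [toL2_eq hf, toL2_eq hg, toL2_eq (hf.sub hg), ← map_sub]
  congr 1
  ext θ
  induction θ using QuotientAddGroup.induction_on with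
  | H x => rfl

theorem toL2_const_mul {g : ℝ → ℂ} (c : ℂ) (hg : ContPer g) :
    toL2 (fun x => c * g x) = c • toL2 g := by
  rw [toL2_eq hg, toL2_eq ((contPer_const c).mul hg), ← map_smul]
  congr 1
  ext θ
  induction θ using QuotientAddGroup.induction_on with
  | H x => rfl

theorem toL2_neg {g : ℝ → ℂ} (hg : ContPer g) : toL2 (fun x => -g x) = -toL2 g := by
  have := toL2_const_mul (-1) hg
  simpa using this

theorem toL2_zero : toL2 (fun _ => 0) = 0 := by
  have := toL2_const_mul 0 (contPer_const (1 : ℂ))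
  simpa using this

/-- The measure has total mass one, so the uniform norm dominates the `L²` norm. Continuity need not
be assumed, because `toL2` takes the value `0` on other functions. -/
theorem norm_toL2_le {g : ℝ → ℂ} {K : ℝ} (hK : 0 ≤ K) (h : ∀ x, ‖g x‖ ≤ K) : ‖toL2 g‖ ≤ K := by
  by_cases hg : ContPer g
  · rw [toL2_eq hg]
    have h1 : ‖toTorus hg‖ ≤ K := by
      refine (ContinuousMap.norm_le _ hK).2 fun θ => ?_
      induction θ using QuotientAddGroup.induction_on with
      | H x => exact h x
    refine (ContinuousLinearMap.le_of_opNorm_le _ (ContinuousMap.toLp_norm_le torusMeasure)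
      _).trans ?_
    simpa [measureUnivNNReal] using h1
  · rw [toL2, dif_neg hg]
    simpa using hK

theorem integral_torus {g : ℝ → ℂ} (h : ContPer g) :
    ∫ θ, toTorus h θ ∂torusMeasure = (2 * Real.pi : ℂ)⁻¹ * ∫ x in (0 : ℝ)..2 * Real.pi, g x := by
  rw [AddCircle.integral_haarAddCircle, ← AddCircle.intervalIntegral_preimage _ 0]
  simp [Complex.real_smul]

theorem inner_toL2 {f g : ℝ → ℂ} (hf : ContPer f) (hg : ContPer g) :
    inner ℂ (toL2 f) (toL2 g) =
      (2 * Real.pi : ℂ)⁻¹ * ∫ x in (0 : ℝ)..2 * Real.pi, (starRingEnd ℂ) (f x) * g x := by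
  have h : ContPer fun x => (starRingEnd ℂ) (f x) * g x := (hf.comp Complex.continuous_conj).mul hg
  rw [toL2_eq hf, toL2_eq hg, ContinuousMap.inner_toLp, ← integral_torus h]
  congr 1
  ext θ
  induction θ using QuotientAddGroup.induction_on with
  | H x => exact mul_comm _ _

theorem integral_deriv_periodic {f f' : ℝ → ℂ} (hf : ∀ x, HasDerivAt f (f' x) x)
    (hc : Continuous f') (hp : Function.Periodic f (2 * Real.pi)) :
    ∫ x in (0 : ℝ)..2 * Real.pi, f' x = 0 := by
  rw [intervalIntegral.integral_eq_sub_of_hasDerivAt (fun x _ => hf x) (hc.intervalIntegrable _ _)]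
  have := hp 0
  rw [zero_add] at this
  rw [this, sub_self]

theorem hasDerivAt_conj {f : ℝ → ℂ} {f' : ℂ} {x : ℝ} (hf : HasDerivAt f f' x) :
    HasDerivAt (fun y => (starRingEnd ℂ) (f y)) ((starRingEnd ℂ) f') x :=
  (Complex.conjCLE.toContinuousLinearMap.hasFDerivAt).comp_hasDerivAt x hf

/-- Integration by parts on the torus. -/
theorem inner_deriv_left {f g : ℝ → ℂ} (hf : SmoothPer f) (hg : SmoothPer g) :
    inner ℂ (toL2 (deriv f)) (toL2 g) = -inner ℂ (toL2 f) (toL2 (deriv g)) := by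
  rw [inner_toL2 hf.deriv.contPer hg.contPer, inner_toL2 hf.contPer hg.deriv.contPer, ← mul_neg,
    ← sub_eq_zero, ← mul_sub, sub_neg_eq_add, ← intervalIntegral.integral_add]
  · rw [integral_deriv_periodic (f := fun x => (starRingEnd ℂ) (f x) * g x), mul_zero]
    · exact fun x => (hasDerivAt_conj (hf.hasDerivAt x)).mul (hg.hasDerivAt x)
    · have := hf.contPer.1; have := hg.contPer.1
      have := hf.deriv.contPer.1; have := hg.deriv.contPer.1
      fun_prop
    · exact ((hf.contPer.comp Complex.continuous_conj).mul hg.contPer).2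
  · have := hf.deriv.contPer.1; have := hg.contPer.1
    exact Continuous.intervalIntegrable (by fun_prop) _ _
  · have := hg.deriv.contPer.1; have := hf.contPer.1
    exact Continuous.intervalIntegrable (by fun_prop) _ _

/-! ### Fourier modes and density of smooth functions -/

/-- The exponentials `e^{ikx}`. -/
def expo (k : ℤ) (x : ℝ) : ℂ := Complex.exp (Complex.I * k * x)

theorem expo_eq_fourier (k : ℤ) :
    expo k = fun x : ℝ => fourier (T := 2 * Real.pi) k (x : Torus) := by
  funext x
  rw [fourier_coe_apply, expo]
  congr 1
  have : (Real.pi : ℂ) ≠ 0 := by exact_mod_cast Real.pi_ne_zero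
  push_cast
  field_simp

theorem smoothPer_expo (k : ℤ) : SmoothPer (expo k) := by
  refine ⟨?_, ?_⟩
  · unfold expo
    have : ContDiff ℝ ∞ fun x : ℝ => Complex.I * k * (x : ℂ) :=
      contDiff_const.mul Complex.ofRealCLM.contDiff
    exact this.cexp
  · rw [expo_eq_fourier]
    exact (contPer_lift _).2

theorem hasDerivAt_expo (k : ℤ) (x : ℝ) : HasDerivAt (expo k) (Complex.I * k * expo k x) x := by
  have h1 : HasDerivAt (fun x : ℝ => Complex.I * k * (x : ℂ)) (Complex.I * k) x := by
    simpa using (Complex.ofRealCLM.hasDerivAt (x := x)).const_mul (Complex.I * (k : ℂ))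
  have h2 := h1.cexp
  rw [mul_comm (Complex.exp _)] at h2
  exact h2

theorem toL2_expo (k : ℤ) : toL2 (expo k) = fourierBasis (T := 2 * Real.pi) k := by
  rw [expo_eq_fourier, toL2_lift, coe_fourierBasis]

theorem repr_eq_inner (ψ : L2) (k : ℤ) :
    (fourierBasis (T := 2 * Real.pi)).repr ψ k = inner ℂ (toL2 (expo k)) ψ := by
  rw [toL2_expo]
  exact HilbertBasis.repr_apply_apply _ _ _

theorem repr_deriv {g : ℝ → ℂ} (hg : SmoothPer g) (k : ℤ) :
    (fourierBasis (T := 2 * Real.pi)).repr (toL2 (deriv g)) k =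
      Complex.I * k * (fourierBasis (T := 2 * Real.pi)).repr (toL2 g) k := by
  rw [repr_eq_inner, repr_eq_inner, ← neg_eq_iff_eq_neg.2 (inner_deriv_left (smoothPer_expo k) hg)]
  have : deriv (expo k) = fun x => Complex.I * k * expo k x :=
    funext fun x => (hasDerivAt_expo k x).deriv
  rw [this, toL2_const_mul _ (smoothPer_expo k).contPer, inner_smul_left]
  simp

/-- Smooth periodic functions are dense in `L²`. -/
theorem dense_toL2 : Dense {ψ : L2 | ∃ g, SmoothPer g ∧ toL2 g = ψ} := by
  have h := span_fourierLp_closure_eq_top (T := 2 * Real.pi) (p := 2) (by simp)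
  have h2 : Dense ((Submodule.span ℂ (range (fourierLp (T := 2 * Real.pi) 2)) : Submodule ℂ L2) :
      Set L2) := by
    rw [dense_iff_closure_eq, ← Submodule.topologicalClosure_coe, h]
    rfl
  refine h2.mono fun ψ hψ => ?_
  induction hψ using Submodule.span_induction with
  | mem x hx =>
    obtain ⟨k, rfl⟩ := hx
    exact ⟨expo k, smoothPer_expo k, by rw [toL2_expo, coe_fourierBasis]⟩
  | zero => exact ⟨fun _ => 0, smoothPer_const 0, toL2_zero⟩
  | add x y _ _ hx hy =>
    obtain ⟨f, hf, rfl⟩ := hx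
    obtain ⟨g, hg, rfl⟩ := hy
    exact ⟨_, hf.add hg, toL2_add hf.contPer hg.contPer⟩
  | smul a x _ hx =>
    obtain ⟨f, hf, rfl⟩ := hx
    exact ⟨_, (smoothPer_const a).mul hf, toL2_const_mul a hf.contPer⟩

theorem exists_toL2_near (ψ : L2) {ε : ℝ} (hε : 0 < ε) : ∃ g, SmoothPer g ∧ ‖ψ - toL2 g‖ < ε := by
  obtain ⟨_, ⟨g, hg, rfl⟩, h⟩ := dense_toL2.exists_dist_lt ψ hε
  exact ⟨g, hg, by rwa [dist_eq_norm] at h⟩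

theorem eq_of_inner_toL2 {ψ χ : L2}
    (h : ∀ g, SmoothPer g → inner ℂ (toL2 g) ψ = inner ℂ (toL2 g) χ) : ψ = χ := by
  refine dense_toL2.eq_of_inner_right ℂ ?_
  rintro _ ⟨g, hg, rfl⟩
  exact h g hg

/-! ### Multiplication operators -/

theorem mulL2_toL2 (a : C(Torus, ℂ)) {g : ℝ → ℂ} (hg : ContPer g) :
    mulL2 a (toL2 g) = toL2 (fun x => a (x : Torus) * g x) := by
  rw [toL2_eq hg, toL2_eq ((contPer_lift a).mul hg), mulL2]
  refine Lp.ext ?_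
  filter_upwards [Lp.coeFn_lpSMul (r := 2) (ContinuousMap.toLp (E := ℂ) ∞ torusMeasure ℂ a)
    (ContinuousMap.toLp (E := ℂ) 2 torusMeasure ℂ (toTorus hg)),
    ContinuousMap.coeFn_toLp (p := ∞) (𝕜 := ℂ) torusMeasure a,
    ContinuousMap.coeFn_toLp (p := 2) (𝕜 := ℂ) torusMeasure (toTorus hg),
    ContinuousMap.coeFn_toLp (p := 2) (𝕜 := ℂ) torusMeasure
      (toTorus ((contPer_lift a).mul hg))] with θ h1 h2 h3 h4
  rw [h1, h4, Pi.smul_apply', h2, h3]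
  induction θ using QuotientAddGroup.induction_on with
  | H x => rfl

theorem mulL2_add (a : C(Torus, ℂ)) (ψ χ : L2) : mulL2 a (ψ + χ) = mulL2 a ψ + mulL2 a χ :=
  Lp.add_smul _ _ _

theorem mulL2_smul (a : C(Torus, ℂ)) (c : ℂ) (ψ : L2) : mulL2 a (c • ψ) = c • mulL2 a ψ :=
  (Lp.smul_comm _ _ _).symm

theorem norm_mulL2_le (a : C(Torus, ℂ)) {K : ℝ} (hK : 0 ≤ K) (h : ∀ θ, ‖a θ‖ ≤ K) (ψ : L2) :
    ‖mulL2 a ψ‖ ≤ K * ‖ψ‖ := by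
  refine (Lp.norm_smul_le _ _).trans ?_
  gcongr
  refine (ContinuousLinearMap.le_of_opNorm_le _ (ContinuousMap.toLp_norm_le torusMeasure)
      _).trans ?_
  simpa using (ContinuousMap.norm_le _ hK).2 h

/-- Multiplication by a continuous function as a bounded operator. -/
def mulCLM (a : C(Torus, ℂ)) : L2 →L[ℂ] L2 :=
  LinearMap.mkContinuous ⟨⟨mulL2 a, mulL2_add a⟩, mulL2_smul a⟩ ‖a‖ fun ψ =>
    norm_mulL2_le a (norm_nonneg _) a.norm_coe_le_norm ψ

@[simp] theorem mulCLM_apply (a : C(Torus, ℂ)) (ψ : L2) : mulCLM a ψ = mulL2 a ψ := rfl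

/-- Both sides are bounded operators in `ψ`, so the identity may be tested on smooth functions,
where it is pointwise associativity. -/
theorem mulL2_mulL2 (a b : C(Torus, ℂ)) (ψ : L2) : mulL2 a (mulL2 b ψ) = mulL2 (a * b) ψ := by
  have : (mulCLM a).comp (mulCLM b) = mulCLM (a * b) := by
    refine ContinuousLinearMap.ext_on (dense_toL2.mono Submodule.subset_span) ?_
    rintro _ ⟨g, hg, rfl⟩
    simp only [ContinuousLinearMap.comp_apply, mulCLM_apply]
    rw [mulL2_toL2 _ hg.contPer, mulL2_toL2 _ ((contPer_lift b).mul hg.contPer),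
      mulL2_toL2 _ hg.contPer]
    simp [mul_assoc]
  exact congrArg (fun A : L2 →L[ℂ] L2 => A ψ) this

theorem mulL2_one (ψ : L2) : mulL2 1 ψ = ψ := by
  have : mulCLM 1 = ContinuousLinearMap.id ℂ L2 := by
    refine ContinuousLinearMap.ext_on (dense_toL2.mono Submodule.subset_span) ?_
    rintro _ ⟨g, hg, rfl⟩
    simp only [mulCLM_apply]
    rw [mulL2_toL2 _ hg.contPer]
    simp
  exact congrArg (fun A : L2 →L[ℂ] L2 => A ψ) this

/-- The unimodular function `e^{iφ}`. -/
def expI (φ : C(Torus, ℝ)) : C(Torus, ℂ) where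
  toFun θ := Complex.exp (Complex.I * (φ θ : ℂ))
  continuous_toFun := by fun_prop

theorem norm_expI (φ : C(Torus, ℝ)) (θ : Torus) : ‖expI φ θ‖ = 1 := by
  change ‖Complex.exp (Complex.I * (φ θ : ℂ))‖ = 1
  rw [mul_comm, Complex.norm_exp_ofReal_mul_I]

theorem expI_mul (φ χ : C(Torus, ℝ)) : expI φ * expI χ = expI (φ + χ) := by
  ext θ
  simp [expI, ← Complex.exp_add, mul_add]

theorem expI_zero : expI 0 = 1 := by
  ext θ
  simp [expI]

/-- Multiplication by `e^{iφ}`, for a continuous real function `φ` on the torus. -/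
def phaseC (φ : C(Torus, ℝ)) : L2 ≃ₗᵢ[ℂ] L2 :=
  LinearIsometryEquiv.mk
    (LinearEquiv.ofLinearMap (mulCLM (expI φ)).toLinearMap (mulCLM (expI (-φ))).toLinearMap
      (by ext ψ : 1; simp [mulL2_mulL2, expI_mul, expI_zero, mulL2_one])
      (by ext ψ : 1; simp [mulL2_mulL2, expI_mul, expI_zero, mulL2_one]))
    (by
      intro ψ
      have h (χ : C(Torus, ℝ)) (ψ : L2) : ‖mulL2 (expI χ) ψ‖ ≤ ‖ψ‖ := by
        simpa using norm_mulL2_le (expI χ) zero_le_one (fun θ => (norm_expI χ θ).le) ψ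
      refine le_antisymm (h φ ψ) ?_
      have := h (-φ) (mulL2 (expI φ) ψ)
      rwa [mulL2_mulL2, expI_mul, neg_add_cancel, expI_zero, mulL2_one] at this)

theorem phaseC_apply (φ : C(Torus, ℝ)) (ψ : L2) : phaseC φ ψ = mulL2 (expI φ) ψ := rfl

open Classical in
/-- Multiplication by `e^{ip}`, for a continuous real periodic function `p` on the line. -/
def phase (p : ℝ → ℝ) : L2 ≃ₗᵢ[ℂ] L2 :=
  if h : ContPer p then phaseC (toTorus h) else 1

theorem phase_toL2 {p : ℝ → ℝ} (hp : ContPer p) {g : ℝ → ℂ} (hg : ContPer g) :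
    phase p (toL2 g) = toL2 fun x => Complex.exp (Complex.I * (p x : ℂ)) * g x := by
  rw [phase, dif_pos hp, phaseC_apply, mulL2_toL2 _ hg]
  rfl

theorem phase_phase {p r : ℝ → ℝ} (hp : ContPer p) (hr : ContPer r) (ψ : L2) :
    phase p (phase r ψ) = phase (fun x => p x + r x) ψ := by
  rw [phase, dif_pos hp, phase, dif_pos hr, phase, dif_pos (hp.add hr), phaseC_apply, phaseC_apply,
    phaseC_apply, mulL2_mulL2, expI_mul]
  congr 2
  ext θ
  induction θ using QuotientAddGroup.induction_on with
  | H x => rfl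

theorem ContPer.cexpI {p : ℝ → ℝ} (hp : ContPer p) :
    ContPer fun x => Complex.exp (Complex.I * (p x : ℂ)) :=
  hp.comp (G := fun y : ℝ => Complex.exp (Complex.I * (y : ℂ))) (by fun_prop)

theorem SmoothPer.cexpI {p : ℝ → ℝ} (hp : SmoothPer p) :
    SmoothPer fun x => Complex.exp (Complex.I * (p x : ℂ)) :=
  SmoothPer.comp (G := fun y : ℝ => Complex.exp (Complex.I * (y : ℂ)))
    ((contDiff_const.mul Complex.ofRealCLM.contDiff).cexp) hp

/-! ### One-parameter unitary groups -/

theorem hasDerivAt_of_sq_bound {E : Type*} [NormedAddCommGroup E] [NormedSpace ℝ E] {F : ℝ → E}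
    {ζ : E} {a C : ℝ} (h : ∀ t : ℝ, |t| ≤ 1 → ‖F (a + t) - F a - t • ζ‖ ≤ C * t ^ 2) :
    HasDerivAt F ζ a := by
  rw [hasDerivAt_iff_isLittleO_nhds_zero]
  have h1 : (fun t : ℝ => F (a + t) - F a - t • ζ) =O[𝓝 0] fun t : ℝ => t ^ 2 := by
    refine Asymptotics.IsBigO.of_bound C ?_
    have : Metric.closedBall (0 : ℝ) 1 ∈ 𝓝 (0 : ℝ) := Metric.closedBall_mem_nhds _ one_pos
    filter_upwards [this] with t ht
    rw [Real.norm_of_nonneg (sq_nonneg t)]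
    exact h t (by simpa using ht)
  refine h1.trans_isLittleO ?_
  simpa using Asymptotics.isLittleO_pow_pow (𝕜 := ℝ) (m := 1) (n := 2) one_lt_two

/-- Strongly continuous one-parameter groups of unitary operators. -/
structure IsUnitaryGroup (U : ℝ → (L2 ≃ₗᵢ[ℂ] L2)) : Prop where
  map_zero : U 0 = 1
  map_add : ∀ s t, U (s + t) = U s * U t
  continuous : ∀ ψ, Continuous fun t => U t ψ

theorem norm_map_sub (A : L2 ≃ₗᵢ[ℂ] L2) (ψ χ : L2) : ‖A ψ - A χ‖ = ‖ψ - χ‖ := by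
  rw [← map_sub, A.norm_map]

theorem real_smul_eq (t : ℝ) (ψ : L2) : t • ψ = (t : ℂ) • ψ :=
  (algebraMap_smul ℂ t ψ).symm

theorem real_smul_map (A : L2 ≃ₗᵢ[ℂ] L2) (t : ℝ) (ψ : L2) : A (t • ψ) = t • A ψ := by
  rw [real_smul_eq, real_smul_eq, map_smul]

namespace IsUnitaryGroup

variable {U : ℝ → (L2 ≃ₗᵢ[ℂ] L2)}

theorem apply_zero (h : IsUnitaryGroup U) (ψ : L2) : U 0 ψ = ψ := by
  rw [h.map_zero]; rfl

theorem apply_add (h : IsUnitaryGroup U) (s t : ℝ) (ψ : L2) : U (s + t) ψ = U s (U t ψ) := by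
  rw [h.map_add]; rfl

theorem apply_neg_apply (h : IsUnitaryGroup U) (t : ℝ) (ψ : L2) : U t (U (-t) ψ) = ψ := by
  rw [← h.apply_add, add_neg_cancel, h.apply_zero]

theorem apply_apply_neg (h : IsUnitaryGroup U) (t : ℝ) (ψ : L2) : U (-t) (U t ψ) = ψ := by
  rw [← h.apply_add, neg_add_cancel, h.apply_zero]

/-- A one-parameter group that is continuous at `0` on smooth functions is strongly continuous. -/
theorem of_smooth (h0 : U 0 = 1) (hadd : ∀ s t, U (s + t) = U s * U t)
    (hc : ∀ g, SmoothPer g → ContinuousAt (fun t => U t (toL2 g)) 0) : IsUnitaryGroup U := by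
  refine ⟨h0, hadd, fun ψ => ?_⟩
  have hc0 : ContinuousAt (fun t => U t ψ) 0 := by
    rw [Metric.continuousAt_iff]
    intro ε hε
    obtain ⟨g, hg, hgε⟩ := exists_toL2_near ψ (show 0 < ε / 3 by positivity)
    obtain ⟨δ, hδ, H⟩ := Metric.continuousAt_iff.1 (hc g hg) (ε / 3) (by positivity)
    refine ⟨δ, hδ, fun {t} ht => ?_⟩
    have h1 := H ht
    rw [dist_eq_norm] at h1 ⊢
    have h2 : U t ψ - U 0 ψ = (U t ψ - U t (toL2 g)) + (U t (toL2 g) - U 0 (toL2 g)) +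
        (U 0 (toL2 g) - U 0 ψ) := by abel
    rw [h2]
    refine (norm_add₃_le).trans_lt ?_
    rw [norm_map_sub, norm_map_sub, norm_sub_rev (toL2 g) ψ]
    linarith
  rw [continuous_iff_continuousAt]
  intro t
  have h1 : (fun s => U s ψ) = fun s => U t (U (s - t) ψ) := by
    funext s
    have := hadd t (s - t)
    rw [add_sub_cancel] at this
    rw [this]; rfl
  rw [h1]
  refine (U t).continuous.continuousAt.comp ?_
  have h2 : ContinuousAt (fun s : ℝ => s - t) t := by fun_prop
  have h3 : ContinuousAt (fun t => U t ψ) (t - t) := by rwa [sub_self]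
  exact ContinuousAt.comp (f := fun s : ℝ => s - t) (g := fun t => U t ψ) h3 h2

/-- The derivative of `t ↦ U (-t) (η t)`, when `η t` is in the domain of the generator of `U`. -/
theorem hasDerivAt_neg_apply (h : IsUnitaryGroup U) {η : ℝ → L2} {η' ζ : L2} {t : ℝ}
    (hη : HasDerivAt η η' t) (hζ : HasDerivAt (fun r => U r (η t)) ζ 0) :
    HasDerivAt (fun s => U (-s) (η s)) (U (-t) (η' - ζ)) t := by
  rw [hasDerivAt_iff_isLittleO_nhds_zero] at hη hζ ⊢
  -- The group is only strongly continuous, so the product rule is done by hand. The increment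
  -- splits into three parts: the Taylor remainder of `η`, on which `U (-r)` is isometric (`e4`),
  -- the remainder of the orbit of the fixed vector `η t` (`e2`), and `r (U (-r) η' - η')`, where
  -- strong continuity at the fixed vector `η'` suffices (`e3`).
  have e1 : (fun r : ℝ => η (t + r) - η t - r • η') =o[𝓝 0] fun r => r := hη
  have e2 : (fun r : ℝ => U (-r) (η t) - η t + r • ζ) =o[𝓝 0] fun r => r := by
    have hneg : Tendsto (fun r : ℝ => -r) (𝓝 0) (𝓝 0) := by
      simpa using (continuous_neg (G := ℝ)).tendsto 0
    have := hζ.comp_tendsto hneg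
    refine (this.congr_left fun r => ?_).trans_isBigO (Asymptotics.isBigO_refl _ _).neg_left
    simp [h.apply_zero]
  have e3 : (fun r : ℝ => r • (U (-r) η' - η')) =o[𝓝 0] fun r => r := by
    have h1 : Tendsto (fun r : ℝ => U (-r) η' - η') (𝓝 0) (𝓝 0) := by
      have := ((h.continuous η').comp (continuous_neg (G := ℝ))).tendsto 0
      simp only [Function.comp_def, neg_zero, h.apply_zero] at this
      simpa using this.sub_const η'
    have := (Asymptotics.isBigO_refl (fun r : ℝ => r) (𝓝 0)).smul_isLittleO
      ((Asymptotics.isLittleO_one_iff ℝ).2 h1)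
    simpa using this
  have e4 : (fun r : ℝ => U (-r) (η (t + r) - η t - r • η')) =o[𝓝 0] fun r => r :=
    Asymptotics.isLittleO_norm_left.1
      ((Asymptotics.isLittleO_norm_left.2 e1).congr_left fun r => ((U (-r)).norm_map _).symm)
  have e5 := (e4.add (e2.add e3))
  have e6 : (fun r : ℝ => U (-t) (U (-r) (η (t + r) - η t - r • η') +
      ((U (-r) (η t) - η t + r • ζ) + r • (U (-r) η' - η')))) =o[𝓝 0] fun r => r :=
    Asymptotics.isLittleO_norm_left.1
      ((Asymptotics.isLittleO_norm_left.2 e5).congr_left fun r => ((U (-t)).norm_map _).symm)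
  refine e6.congr_left fun r => ?_
  have : U (-(t + r)) (η (t + r)) = U (-t) (U (-r) (η (t + r))) := by
    rw [← h.apply_add, neg_add]
  rw [this, ← real_smul_map, ← map_sub, ← map_sub]
  congr 1
  rw [map_sub, map_sub, real_smul_map, smul_sub, smul_sub]
  abel

/-- If a curve `η` is an approximate trajectory of the group `s ↦ U (c s)`, then its end point is
close to the image of its origin. -/
theorem norm_sub_le (h : IsUnitaryGroup U) {c C T : ℝ} (hT : 0 ≤ T) {η η' ζ : ℝ → L2}
    (hη : ∀ s ∈ Icc 0 T, HasDerivAt η (η' s) s)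
    (hζ : ∀ s ∈ Icc 0 T, HasDerivAt (fun r => U r (η s)) (ζ s) 0)
    (hC : ∀ s ∈ Icc 0 T, ‖η' s - c • ζ s‖ ≤ C) : ‖U (c * T) (η 0) - η T‖ ≤ C * T := by
  have hV : IsUnitaryGroup fun s => U (c * s) :=
    ⟨by simp [h.map_zero], fun s t => by rw [mul_add, h.map_add],
      fun ψ => (h.continuous ψ).comp (by fun_prop)⟩
  -- Pulling `η` back by the rescaled group leaves a curve whose velocity has exactly the norm of
  -- the defect `η' - c ζ`; the mean value inequality then concludes.
  have hd : ∀ s ∈ Icc 0 T,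
      HasDerivAt (fun r => U (c * -r) (η r)) (U (c * -s) (η' s - c • ζ s)) s := by
    intro s hs
    refine hV.hasDerivAt_neg_apply (hη s hs) ?_
    have h1 : HasDerivAt (fun r : ℝ => c * r) c 0 := by simpa using (hasDerivAt_id (0 : ℝ)).const_mul c
    have h3 : HasDerivAt (fun r => U r (η s)) (ζ s) (c * 0) := by rw [mul_zero]; exact hζ s hs
    exact HasDerivAt.scomp (h := fun r : ℝ => c * r) 0 h3 h1
  have h4 := norm_image_sub_le_of_norm_deriv_le_segment' (a := 0) (b := T) (C := C)
    (fun s hs => (hd s hs).hasDerivWithinAt)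
    (fun s hs => by rw [(U _).norm_map]; exact hC s ⟨hs.1, hs.2.le⟩) T ⟨hT, le_rfl⟩
  rw [sub_zero, neg_zero, mul_zero, h.apply_zero] at h4
  have h5 : U (c * T) (U (c * -T) (η T)) = η T := by
    rw [mul_neg, h.apply_neg_apply]
  have h6 := norm_map_sub (U (c * T)) (U (c * -T) (η T)) (η 0)
  rw [h5] at h6
  rw [norm_sub_rev, h6]
  exact h4

end IsUnitaryGroup

/-! ### The free evolution -/

theorem repr_freeFlow (α t : ℝ) (ψ : L2) (k : ℤ) :
    (fourierBasis (T := 2 * Real.pi)).repr (freeFlow α t ψ) k =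
      Complex.exp ((t : ℂ) * symbolL α k) * (fourierBasis (T := 2 * Real.pi)).repr ψ k := by
  rw [freeFlow, LinearIsometryEquiv.apply_symm_apply]

theorem ext_repr {ψ χ : L2} (h : ∀ k, (fourierBasis (T := 2 * Real.pi)).repr ψ k =
    (fourierBasis (T := 2 * Real.pi)).repr χ k) : ψ = χ := by
  apply (fourierBasis (T := 2 * Real.pi)).repr.injective
  ext k
  exact h k

theorem norm_le_of_repr {ψ χ : L2} (h : ∀ k, ‖(fourierBasis (T := 2 * Real.pi)).repr ψ k‖ ≤
    ‖(fourierBasis (T := 2 * Real.pi)).repr χ k‖) : ‖ψ‖ ≤ ‖χ‖ := by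
  rw [← (fourierBasis (T := 2 * Real.pi)).repr.norm_map ψ,
    ← (fourierBasis (T := 2 * Real.pi)).repr.norm_map χ]
  exact lp.norm_mono (by simp) h

theorem freeFlow_zero (α : ℝ) (ψ : L2) : freeFlow α 0 ψ = ψ :=
  ext_repr fun k => by rw [repr_freeFlow]; simp

theorem freeFlow_add (α s t : ℝ) (ψ : L2) : freeFlow α (s + t) ψ = freeFlow α s (freeFlow α t ψ) :=
  ext_repr fun k => by
    rw [repr_freeFlow, repr_freeFlow, repr_freeFlow, ← mul_assoc, ← Complex.exp_add]
    push_cast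
    rw [add_mul]

/-- The free evolution as a family of unitary operators. -/
def freeU (α t : ℝ) : L2 ≃ₗᵢ[ℂ] L2 where
  toFun := freeFlow α t
  invFun := freeFlow α (-t)
  left_inv ψ := by rw [← freeFlow_add, neg_add_cancel, freeFlow_zero]
  right_inv ψ := by rw [← freeFlow_add, add_neg_cancel, freeFlow_zero]
  map_add' ψ χ := ext_repr fun k => by
    simp only [repr_freeFlow, map_add, lp.coeFn_add, Pi.add_apply, mul_add]
  map_smul' c ψ := ext_repr fun k => by
    simp only [repr_freeFlow, map_smul, lp.coeFn_smul, Pi.smul_apply, smul_eq_mul, RingHom.id_apply]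
    ring
  norm_map' ψ := by
    refine le_antisymm (norm_le_of_repr fun k => ?_) (norm_le_of_repr fun k => ?_)
    all_goals
      simp only [LinearEquiv.coe_mk, LinearMap.coe_mk, AddHom.coe_mk, repr_freeFlow, norm_mul,
        norm_exp_symbolL, one_mul, le_refl]

theorem freeU_apply (α t : ℝ) (ψ : L2) : freeU α t ψ = freeFlow α t ψ := rfl

/-- The operator `L = -∂ₓ³ + iα∂ₓ²` on functions on the line. -/
def opL (α : ℝ) (g : ℝ → ℂ) (x : ℝ) : ℂ :=
  -deriv (deriv (deriv g)) x + Complex.I * α * deriv (deriv g) x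

theorem smoothPer_opL (α : ℝ) {g : ℝ → ℂ} (hg : SmoothPer g) : SmoothPer (opL α g) :=
  hg.deriv.deriv.deriv.neg.add ((smoothPer_const (Complex.I * α)).mul hg.deriv.deriv)

theorem repr_opL (α : ℝ) {g : ℝ → ℂ} (hg : SmoothPer g) (k : ℤ) :
    (fourierBasis (T := 2 * Real.pi)).repr (toL2 (opL α g)) k =
      symbolL α k * (fourierBasis (T := 2 * Real.pi)).repr (toL2 g) k := by
  have h3 := hg.deriv.deriv.deriv
  have h2 := hg.deriv.deriv
  have : toL2 (opL α g) = -toL2 (deriv (deriv (deriv g))) +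
      (Complex.I * α) • toL2 (deriv (deriv g)) := by
    rw [← toL2_neg h3.contPer, ← toL2_const_mul _ h2.contPer,
      ← toL2_add h3.neg.contPer ((contPer_const _).mul h2.contPer)]
    rfl
  rw [this]
  simp only [map_add, map_neg, map_smul, lp.coeFn_add, Pi.add_apply, lp.coeFn_neg, Pi.neg_apply,
    lp.coeFn_smul, Pi.smul_apply, smul_eq_mul]
  rw [repr_deriv hg.deriv.deriv, repr_deriv hg.deriv, repr_deriv hg, symbolL]
  ring

/-- Taylor's bound settles `|y| ≤ 1`, and otherwise `2 + |y| ≤ 3y²`. Having it for all real `y`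
makes it uniform over the Fourier modes. -/
theorem norm_exp_sub_one_sub_le (y : ℝ) :
    ‖Complex.exp (y * Complex.I) - 1 - y * Complex.I‖ ≤ 3 * y ^ 2 := by
  have hn : ‖(y : ℂ) * Complex.I‖ = |y| := by simp
  by_cases hy : |y| ≤ 1
  · refine (Complex.norm_exp_sub_one_sub_id_le (by rwa [hn])).trans ?_
    rw [hn, sq_abs]
    nlinarith [sq_nonneg y]
  · refine (norm_sub_le _ _).trans ?_
    rw [hn]
    have h1 : ‖Complex.exp (y * Complex.I) - 1‖ ≤ 2 := by
      refine (norm_sub_le _ _).trans ?_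
      rw [Complex.norm_exp_ofReal_mul_I, norm_one]
      norm_num
    rw [← sq_abs]
    nlinarith [not_le.1 hy]

/-- Mode by mode, the symbol is `iw` with `w` real, the remainder is at most `3 (tw)²` times the
coefficient of `g`, and `-w²` times that coefficient is the one of `L²g`. -/
theorem norm_freeFlow_sub_le (α t : ℝ) {g : ℝ → ℂ} (hg : SmoothPer g) :
    ‖freeFlow α t (toL2 g) - toL2 g - t • toL2 (opL α g)‖ ≤
      3 * ‖toL2 (opL α (opL α g))‖ * t ^ 2 := by
  have h := norm_le_of_repr (ψ := freeFlow α t (toL2 g) - toL2 g - t • toL2 (opL α g))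
    (χ := ((3 * t ^ 2 : ℝ) : ℂ) • toL2 (opL α (opL α g))) fun k => ?_
  · refine h.trans_eq ?_
    rw [norm_smul, Complex.norm_real, Real.norm_of_nonneg (by positivity)]
    ring
  · rw [real_smul_eq]
    simp only [map_sub, map_smul, lp.coeFn_sub, Pi.sub_apply, lp.coeFn_smul, Pi.smul_apply,
      smul_eq_mul, repr_freeFlow, repr_opL α hg, repr_opL α (smoothPer_opL α hg)]
    set a := (fourierBasis (T := 2 * Real.pi)).repr (toL2 g) k
    rw [symbolL_eq]
    set w : ℝ := (k : ℝ) ^ 3 - α * (k : ℝ) ^ 2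
    have h1 : Complex.exp (t * (w * Complex.I)) * a - a - t * (w * Complex.I * a) =
        (Complex.exp ((t * w : ℝ) * Complex.I) - 1 - (t * w : ℝ) * Complex.I) * a := by
      push_cast
      rw [mul_assoc (t : ℂ) w Complex.I]
      ring
    have h2 : ((3 * t ^ 2 : ℝ) : ℂ) * (w * Complex.I * (w * Complex.I * a)) =
        -((3 * (t * w) ^ 2 : ℝ) : ℂ) * a := by
      push_cast
      linear_combination (3 * t ^ 2 * w ^ 2 * a : ℂ) * Complex.I_sq
    rw [h1, h2, norm_mul, norm_mul, norm_neg, Complex.norm_real,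
      Real.norm_of_nonneg (by positivity)]
    gcongr
    exact norm_exp_sub_one_sub_le _

/-- Smooth functions are in the domain of the generator of the free evolution. -/
theorem hasDerivAt_freeFlow (α : ℝ) {g : ℝ → ℂ} (hg : SmoothPer g) :
    HasDerivAt (fun t => freeU α t (toL2 g)) (toL2 (opL α g)) 0 := by
  refine hasDerivAt_of_sq_bound (C := 3 * ‖toL2 (opL α (opL α g))‖) fun t _ => ?_
  rw [zero_add, freeU_apply, freeU_apply, freeFlow_zero]
  exact norm_freeFlow_sub_le α t hg

theorem isUnitaryGroup_freeU (α : ℝ) : IsUnitaryGroup (freeU α) := by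
  refine IsUnitaryGroup.of_smooth ?_ ?_ fun g hg => (hasDerivAt_freeFlow α hg).continuousAt
  · ext1 ψ
    exact freeFlow_zero α ψ
  · intro s t
    ext1 ψ
    exact freeFlow_add α s t ψ

/-! ### Smooth families of periodic functions -/

/-- Families `F t` of periodic functions which are jointly smooth in `(t, x)`. -/
def SmoothFam {E : Type*} [NormedAddCommGroup E] [NormedSpace ℝ E] (F : ℝ → ℝ → E) : Prop :=
  ContDiff ℝ ∞ (fun p : ℝ × ℝ => F p.1 p.2) ∧ ∀ t, Function.Periodic (F t) (2 * Real.pi)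

namespace SmoothFam

variable {E : Type*} [NormedAddCommGroup E] [NormedSpace ℝ E] {F : ℝ → ℝ → E}

theorem smoothPer (hF : SmoothFam F) (t : ℝ) : SmoothPer (F t) :=
  ⟨hF.1.comp (contDiff_const.prodMk contDiff_id), hF.2 t⟩

theorem hasDerivAt_snd (hF : SmoothFam F) (t x : ℝ) :
    HasDerivAt (F t) (fderiv ℝ (fun p : ℝ × ℝ => F p.1 p.2) (t, x) (0, 1)) x := by
  have h1 : HasFDerivAt (fun p : ℝ × ℝ => F p.1 p.2)
      (fderiv ℝ (fun p : ℝ × ℝ => F p.1 p.2) (t, x)) (t, x) :=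
    (hF.1.differentiable (by simp) _).hasFDerivAt
  exact h1.comp_hasDerivAt x ((hasDerivAt_const x t).prodMk (hasDerivAt_id x))

theorem hasDerivAt_fst (hF : SmoothFam F) (t x : ℝ) :
    HasDerivAt (fun s => F s x) (fderiv ℝ (fun p : ℝ × ℝ => F p.1 p.2) (t, x) (1, 0)) t := by
  have h1 : HasFDerivAt (fun p : ℝ × ℝ => F p.1 p.2)
      (fderiv ℝ (fun p : ℝ × ℝ => F p.1 p.2) (t, x)) (t, x) :=
    (hF.1.differentiable (by simp) _).hasFDerivAt
  exact h1.comp_hasDerivAt t ((hasDerivAt_id t).prodMk (hasDerivAt_const t x))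

theorem deriv_snd (hF : SmoothFam F) : SmoothFam fun t => deriv (F t) := by
  refine ⟨?_, fun t => (hF.smoothPer t).deriv.2⟩
  have : (fun p : ℝ × ℝ => deriv (F p.1) p.2) =
      fun p => fderiv ℝ (fun p : ℝ × ℝ => F p.1 p.2) p (0, 1) :=
    funext fun p => (hF.hasDerivAt_snd p.1 p.2).deriv
  rw [this]
  exact (hF.1.fderiv_right (m := ∞) (by simp)).clm_apply contDiff_const

theorem deriv_fst (hF : SmoothFam F) : SmoothFam fun t x => deriv (fun s => F s x) t := by
  refine ⟨?_, fun t x => ?_⟩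
  · have : (fun p : ℝ × ℝ => deriv (fun s => F s p.2) p.1) =
        fun p => fderiv ℝ (fun p : ℝ × ℝ => F p.1 p.2) p (1, 0) :=
      funext fun p => (hF.hasDerivAt_fst p.1 p.2).deriv
    rw [this]
    exact (hF.1.fderiv_right (m := ∞) (by simp)).clm_apply contDiff_const
  · have : (fun s => F s (x + 2 * Real.pi)) = fun s => F s x := funext fun s => hF.2 s x
    simp only [this]

theorem hasDerivAt_deriv_fst (hF : SmoothFam F) (t x : ℝ) :
    HasDerivAt (fun s => F s x) (deriv (fun s => F s x) t) t := by
  rw [(hF.hasDerivAt_fst t x).deriv]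
  exact hF.hasDerivAt_fst t x

theorem exists_bound (hF : SmoothFam F) (a b : ℝ) :
    ∃ K, 0 ≤ K ∧ ∀ t ∈ Icc a b, ∀ x, ‖F t x‖ ≤ K := by
  obtain ⟨K, hK⟩ := ((isCompact_Icc (a := a) (b := b)).prod
    (isCompact_Icc (a := (0 : ℝ)) (b := 2 * Real.pi))).exists_bound_of_continuousOn
    hF.1.continuous.continuousOn
  refine ⟨max K 0, le_max_right _ _, fun t ht x => ?_⟩
  obtain ⟨y, hy, hxy⟩ := (hF.2 t).exists_mem_Ico₀ Real.two_pi_pos x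
  rw [hxy]
  exact (hK (t, y) ⟨ht, hy.1, hy.2.le⟩).trans (le_max_left _ _)

theorem add {G : ℝ → ℝ → E} (hF : SmoothFam F) (hG : SmoothFam G) :
    SmoothFam fun t x => F t x + G t x :=
  ⟨hF.1.add hG.1, fun t => (hF.2 t).add (hG.2 t)⟩

theorem mul {R : Type*} [NormedRing R] [NormedAlgebra ℝ R] {F G : ℝ → ℝ → R}
    (hF : SmoothFam F) (hG : SmoothFam G) : SmoothFam fun t x => F t x * G t x :=
  ⟨hF.1.mul hG.1, fun t => (hF.2 t).mul (hG.2 t)⟩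

theorem of_smoothPer {g : ℝ → E} (hg : SmoothPer g) : SmoothFam fun _ => g :=
  ⟨hg.1.comp contDiff_snd, fun _ => hg.2⟩

theorem fst : SmoothFam fun t _ => t := ⟨contDiff_fst, fun _ _ => rfl⟩

theorem comp {E' : Type*} [NormedAddCommGroup E'] [NormedSpace ℝ E'] {G : E → E'}
    (hG : ContDiff ℝ ∞ G) (hF : SmoothFam F) : SmoothFam fun t x => G (F t x) :=
  ⟨hG.comp hF.1, fun t x => by simp only [hF.2 t x]⟩

theorem ofReal {F : ℝ → ℝ → ℝ} (hF : SmoothFam F) : SmoothFam fun t x => (F t x : ℂ) :=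
  comp Complex.ofRealCLM.contDiff hF

theorem cexpI {F : ℝ → ℝ → ℝ} (hF : SmoothFam F) :
    SmoothFam fun t x => Complex.exp (Complex.I * (F t x : ℂ)) :=
  comp (G := fun y : ℝ => Complex.exp (Complex.I * (y : ℂ)))
    ((contDiff_const.mul Complex.ofRealCLM.contDiff).cexp) hF

/-- A smooth family is differentiable as a curve in `L²`. -/
theorem hasDerivAt_toL2 {F : ℝ → ℝ → ℂ} (hF : SmoothFam F) (t : ℝ) :
    HasDerivAt (fun s => toL2 (F s)) (toL2 fun x => deriv (fun s => F s x) t) t := by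
  -- `K` bounds the second time derivative near `t`. The mean value inequality is used twice, for
  -- `∂ₜF` and then for `F - s ∂ₜF(t)`, giving a quadratic remainder uniform in `x`.
  obtain ⟨K, hK0, hK⟩ := hF.deriv_fst.deriv_fst.exists_bound (t - 1) (t + 1)
  refine hasDerivAt_of_sq_bound (C := K) fun r hr => ?_
  have hcF := (hF.smoothPer t).contPer
  have hcG := (hF.smoothPer (t + r)).contPer
  have hcd := (hF.deriv_fst.smoothPer t).contPer
  rw [real_smul_eq, ← toL2_const_mul _ hcd, ← toL2_sub hcG hcF,
    ← toL2_sub (hcG.sub hcF) ((contPer_const _).mul hcd)]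
  refine norm_toL2_le (by positivity) fun x => ?_
  set f : ℝ → ℂ := fun s => F s x
  have hconv : Convex ℝ (uIcc t (t + r)) := convex_uIcc _ _
  have hsub : ∀ s ∈ uIcc t (t + r), |s - t| ≤ |r| := fun s hs => by
    simpa using abs_sub_left_of_mem_uIcc hs
  have h1 : ∀ s ∈ uIcc t (t + r), ‖deriv f s - deriv f t‖ ≤ K * |r| := by
    intro s hs
    have := (convex_uIcc t (t + r)).norm_image_sub_le_of_norm_hasDerivWithin_le
      (f := deriv f) (f' := fun s => deriv (fun s => deriv f s) s) (C := K)
      (fun y _ => (hF.deriv_fst.hasDerivAt_deriv_fst y x).hasDerivWithinAt)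
      (fun y hy => by
        have := hsub y hy
        refine hK y ⟨?_, ?_⟩ x
        · linarith [neg_abs_le (y - t)]
        · linarith [le_abs_self (y - t)])
      left_mem_uIcc hs
    refine this.trans ?_
    gcongr
    exact hsub s hs
  have h2 := (convex_uIcc t (t + r)).norm_image_sub_le_of_norm_hasDerivWithin_le
    (f := fun s => f s - (s : ℂ) * deriv f t) (f' := fun s => deriv f s - deriv f t) (C := K * |r|)
    (fun y _ => by
      have h3 := (Complex.ofRealCLM.hasDerivAt (x := y)).mul_const (deriv f t)
      simp only [Complex.ofRealCLM_apply, Complex.ofReal_one, one_mul] at h3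
      exact ((hF.hasDerivAt_deriv_fst y x).sub h3).hasDerivWithinAt)
    h1 left_mem_uIcc right_mem_uIcc
  calc ‖F (t + r) x - F t x - r * deriv f t‖
      = ‖f (t + r) - ((t + r : ℝ) : ℂ) * deriv f t - (f t - (t : ℂ) * deriv f t)‖ := by
        congr 1
        push_cast
        ring
    _ ≤ K * |r| * ‖t + r - t‖ := h2
    _ = K * r ^ 2 := by
        rw [add_sub_cancel_left, Real.norm_eq_abs, mul_assoc, ← sq, sq_abs]

end SmoothFam

theorem SmoothPer.const_mul {g : ℝ → ℂ} (hg : SmoothPer g) (c : ℂ) : SmoothPer fun x => c * g x :=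
  (smoothPer_const c).mul hg

theorem SmoothPer.rconst_mul {g : ℝ → ℝ} (hg : SmoothPer g) (c : ℝ) : SmoothPer fun x => c * g x :=
  (smoothPer_const c).mul hg

theorem SmoothPer.pow {g : ℝ → ℝ} (hg : SmoothPer g) (n : ℕ) : SmoothPer fun x => g x ^ n :=
  SmoothPer.comp (contDiff_id.pow n) hg

/-- The curve `s ↦ e^{i(a + s b)} (g + s k)` of smooth functions. -/
theorem hasDerivAt_phase_curve {a b : ℝ → ℝ} {g k : ℝ → ℂ} (ha : SmoothPer a) (hb : SmoothPer b)
    (hg : SmoothPer g) (hk : SmoothPer k) (s : ℝ) :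
    HasDerivAt
      (fun s : ℝ => toL2 fun x =>
        Complex.exp (Complex.I * ((a x + s * b x : ℝ) : ℂ)) * (g x + s * k x))
      (toL2 fun x => Complex.exp (Complex.I * ((a x + s * b x : ℝ) : ℂ)) *
        (Complex.I * b x * (g x + s * k x) + k x)) s := by
  have hF : SmoothFam fun (s x : ℝ) =>
      Complex.exp (Complex.I * ((a x + s * b x : ℝ) : ℂ)) * (g x + s * k x) :=
    ((SmoothFam.of_smoothPer ha).add (SmoothFam.fst.mul (SmoothFam.of_smoothPer hb))).cexpI.mul
      ((SmoothFam.of_smoothPer hg).add (SmoothFam.fst.ofReal.mul (SmoothFam.of_smoothPer hk)))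
  have := hF.hasDerivAt_toL2 s
  convert this using 2
  funext x
  have h1 : HasDerivAt (fun s : ℝ => (s : ℂ)) 1 s := Complex.ofRealCLM.hasDerivAt
  have h2 : HasDerivAt (fun s : ℝ => Complex.I * ((a x + s * b x : ℝ) : ℂ)) (Complex.I * b x) s := by
    have := ((h1.mul_const (b x : ℂ)).const_add (a x : ℂ)).const_mul Complex.I
    simpa using this
  have h3 := h2.cexp.mul ((h1.mul_const (k x)).const_add (g x))
  refine Eq.trans ?_ h3.deriv.symm
  ring

/-! ### Exactly reachable states -/

/-- Strong continuity handles the fixed vector `φ t`, and isometry makes the replacement of `φ r` by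
`φ t` harmless uniformly in the group parameter. -/
theorem IsUnitaryGroup.continuousOn_apply {U : ℝ → (L2 ≃ₗᵢ[ℂ] L2)} (h : IsUnitaryGroup U)
    {f : ℝ → ℝ} {φ : ℝ → L2} {s : Set ℝ} (hf : Continuous f) (hφ : ContinuousOn φ s) :
    ContinuousOn (fun t => U (f t) (φ t)) s := by
  intro t ht
  have h1 : Tendsto (fun r => ‖φ r - φ t‖) (𝓝[s] t) (𝓝 0) := by
    have := (hφ t ht).tendsto.sub_const (φ t)
    simpa using this.norm
  have h2 : Tendsto (fun r => U (f r) (φ t)) (𝓝[s] t) (𝓝 (U (f t) (φ t))) :=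
    (((h.continuous (φ t)).comp hf).tendsto t).mono_left nhdsWithin_le_nhds
  have h3 : Tendsto (fun r => U (f r) (φ r) - U (f r) (φ t)) (𝓝[s] t) (𝓝 0) := by
    rw [tendsto_zero_iff_norm_tendsto_zero]
    refine h1.congr fun r => (norm_map_sub _ _ _).symm
  have h4 := h3.add h2
  simp only [sub_add_cancel, zero_add] at h4
  exact h4

variable {q : ℕ} (α : ℝ) (Q : Fin q → C(Torus, ℝ))

/-- The integrand of the Duhamel formula in the interaction picture. -/
def interaction (u : ℝ → Fin q → ℝ) (ψ : ℝ → L2) (s : ℝ) : L2 :=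
  freeU α (-s) (mulL2 (potential Q (u s)) (ψ s))

/-- Applying `e^{-tL}` removes the endpoint `t` from the integrand. In this form the formula can be
concatenated and differentiated. -/
theorem duhamel_iff (u : ℝ → Fin q → ℝ) (ψ : ℝ → L2) (ψ₀ : L2) (t : ℝ) :
    ψ t = freeFlow α t ψ₀ +
        ∫ s in (0 : ℝ)..t, freeFlow α (t - s) (mulL2 (potential Q (u s)) (ψ s)) ↔
      freeU α (-t) (ψ t) = ψ₀ + ∫ s in (0 : ℝ)..t, interaction α Q u ψ s := by
  have hU := isUnitaryGroup_freeU α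
  have h1 : ∫ s in (0 : ℝ)..t, freeFlow α (t - s) (mulL2 (potential Q (u s)) (ψ s)) =
      freeU α t (∫ s in (0 : ℝ)..t, interaction α Q u ψ s) := by
    have h2 : ∀ s, freeFlow α (t - s) (mulL2 (potential Q (u s)) (ψ s)) =
        freeU α t (interaction α Q u ψ s) := fun s => by
      rw [interaction, ← hU.apply_add, ← sub_eq_add_neg]; rfl
    simp only [h2]
    rw [intervalIntegral.intervalIntegral_eq_integral_uIoc,
      intervalIntegral.intervalIntegral_eq_integral_uIoc, real_smul_map]
    congr 1
    exact (freeU α t).toContinuousLinearEquiv.integral_comp_comm _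
  rw [h1, ← freeU_apply, ← map_add]
  constructor
  · intro h
    rw [h, hU.apply_apply_neg]
  · intro h
    rw [← h, hU.apply_neg_apply]

/-- `ψ₁` is the state at time `T` of a controlled trajectory issued from `ψ₀`. -/
def Reachable (T : ℝ) (ψ₀ ψ₁ : L2) : Prop :=
  0 ≤ T ∧ ∃ (u : ℝ → Fin q → ℝ) (ψ : ℝ → L2), PiecewiseConst T u ∧ IsSolution α Q T u ψ₀ ψ ∧
    IntervalIntegrable (interaction α Q u ψ) volume 0 T ∧ ψ T = ψ₁

theorem PiecewiseConst.append {T₁ T₂ : ℝ} {u₁ u₂ : ℝ → Fin q → ℝ} (h₁ : PiecewiseConst T₁ u₁)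
    (h₂ : PiecewiseConst T₂ u₂) :
    PiecewiseConst (T₁ + T₂) fun s => if s ≤ T₁ then u₁ s else u₂ (s - T₁) := by
  obtain ⟨N₁, τ₁, hm₁, h0₁, hN₁, hc₁⟩ := h₁
  obtain ⟨N₂, τ₂, hm₂, h0₂, hN₂, hc₂⟩ := h₂
  refine ⟨N₁ + N₂, fun i => if i ≤ N₁ then τ₁ i else T₁ + τ₂ (i - N₁), ?_, ?_, ?_, ?_⟩
  · intro i j hij
    simp only
    split_ifs with hi hj hj
    · exact hm₁ hij
    · have h1 := hm₁ hi
      have h2 := hm₂ (Nat.zero_le (j - N₁))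
      linarith
    · omega
    · have h2 := hm₂ (Nat.sub_le_sub_right hij N₁)
      linarith
  · simp [h0₁]
  -- If `N₂ = 0` the last index falls in the first branch, and then `T₂ = τ₂ 0 = 0`.
  · by_cases h : N₁ + N₂ ≤ N₁
    · have : N₂ = 0 := by omega
      subst this
      simp [hN₁, ← hN₂, h0₂]
    · simp [h, hN₂]
  · intro i hi
    by_cases hi1 : i < N₁
    · obtain ⟨c, hc⟩ := hc₁ i hi1
      refine ⟨c, fun s hs => ?_⟩
      simp only [if_pos hi1.le, if_pos (Nat.succ_le_of_lt hi1)] at hs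
      have h1 := hm₁ (Nat.succ_le_of_lt hi1)
      simp only
      rw [if_pos (by linarith [hs.2])]
      exact hc s hs
    · obtain ⟨c, hc⟩ := hc₂ (i - N₁) (by omega)
      refine ⟨c, fun s hs => ?_⟩
      -- At `i = N₁` the first branch is selected, but both branches take the value `T₁` there.
      have h1 : (if i ≤ N₁ then τ₁ i else T₁ + τ₂ (i - N₁)) = T₁ + τ₂ (i - N₁) := by
        split_ifs with h
        · have : i = N₁ := by omega
          subst this
          simp [hN₁, h0₂]
        · rfl
      simp only [h1] at hs
      rw [if_neg (by omega), Nat.sub_add_comm (by omega)] at hs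
      have h2 := hm₂ (Nat.zero_le (i - N₁))
      simp only
      rw [if_neg (by linarith [hs.1])]
      exact hc _ ⟨by linarith [hs.1], by linarith [hs.2]⟩

variable {α Q} in
-- Concatenation of controls. In the interaction picture the second integrand is the shifted one
-- transported by `e^{-T₁L}`. The integrability recorded in `Reachable` is what allows the integral
-- to be split at `T₁`.
theorem Reachable.trans {T₁ T₂ : ℝ} {ψ₀ ψ₁ ψ₂ : L2} (h₁ : Reachable α Q T₁ ψ₀ ψ₁)
    (h₂ : Reachable α Q T₂ ψ₁ ψ₂) : Reachable α Q (T₁ + T₂) ψ₀ ψ₂ := by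
  have hU := isUnitaryGroup_freeU α
  obtain ⟨hT₁, u₁, φ₁, hu₁, ⟨hc₁, hs₁⟩, hi₁, he₁⟩ := h₁
  obtain ⟨hT₂, u₂, φ₂, hu₂, ⟨hc₂, hs₂⟩, hi₂, he₂⟩ := h₂
  set u : ℝ → Fin q → ℝ := fun s => if s ≤ T₁ then u₁ s else u₂ (s - T₁)
  set φ : ℝ → L2 := fun s => if s ≤ T₁ then φ₁ s else φ₂ (s - T₁)
  have h20 : φ₂ 0 = ψ₁ := by
    have := hs₂ 0 ⟨le_rfl, hT₂⟩
    rwa [intervalIntegral.integral_same, add_zero, freeFlow_zero] at this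
  have hφ2 : ∀ s, T₁ ≤ s → φ s = φ₂ (s - T₁) := by
    intro s hs
    by_cases h : s ≤ T₁
    · have : s = T₁ := le_antisymm h hs
      subst this
      simp [φ, he₁, h20]
    · simp [φ, h]
  have hφ1 : ∀ s, s ≤ T₁ → φ s = φ₁ s := fun s hs => if_pos hs
  have hI1 : ∀ s, s ≤ T₁ → interaction α Q u φ s = interaction α Q u₁ φ₁ s := fun s hs => by
    simp only [interaction, u, φ, if_pos hs]
  have hI2 : ∀ s, T₁ < s → interaction α Q u φ s =
      freeU α (-T₁) (interaction α Q u₂ φ₂ (s - T₁)) := fun s hs => by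
    simp only [interaction, u, φ, if_neg (not_le.2 hs)]
    rw [← hU.apply_add]
    congr 2
    ring
  have hII1 : IntervalIntegrable (interaction α Q u φ) volume 0 T₁ := by
    refine hi₁.congr fun s hs => ?_
    rw [uIoc_of_le hT₁] at hs
    exact (hI1 s hs.2).symm
  have hII2' : IntervalIntegrable (fun s => freeU α (-T₁) (interaction α Q u₂ φ₂ (s - T₁)))
      volume T₁ (T₁ + T₂) := by
    have h3 := hi₂.comp_sub_right T₁
    rw [zero_add, add_comm T₂] at h3
    constructor
    · exact ((freeU α (-T₁)).toContinuousLinearEquiv.toContinuousLinearMap).integrable_comp h3.1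
    · exact ((freeU α (-T₁)).toContinuousLinearEquiv.toContinuousLinearMap).integrable_comp h3.2
  have hII2 : IntervalIntegrable (interaction α Q u φ) volume T₁ (T₁ + T₂) := by
    refine hII2'.congr fun s hs => ?_
    rw [uIoc_of_le (by linarith)] at hs
    exact (hI2 s hs.1).symm
  refine ⟨by positivity, u, φ, hu₁.append hu₂, ⟨?_, ?_⟩, hII1.trans hII2, ?_⟩
  · have hsplit : Icc 0 (T₁ + T₂) = Icc 0 T₁ ∪ Icc T₁ (T₁ + T₂) :=
      (Icc_union_Icc_eq_Icc hT₁ (by linarith)).symm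
    rw [hsplit]
    refine ContinuousOn.union_of_isClosed ?_ ?_ isClosed_Icc isClosed_Icc
    · exact hc₁.congr fun s hs => hφ1 s hs.2
    · have : ContinuousOn (fun s => φ₂ (s - T₁)) (Icc T₁ (T₁ + T₂)) :=
        hc₂.comp (by fun_prop) fun s hs => ⟨by linarith [hs.1], by linarith [hs.2]⟩
      exact this.congr fun s hs => hφ2 s hs.1
  · intro t ht
    rw [duhamel_iff]
    rcases le_or_gt t T₁ with h | h
    · have h3 : ∫ s in (0 : ℝ)..t, interaction α Q u φ s =
          ∫ s in (0 : ℝ)..t, interaction α Q u₁ φ₁ s := by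
        refine intervalIntegral.integral_congr fun s hs => ?_
        rw [uIcc_of_le ht.1] at hs
        exact hI1 s (hs.2.trans h)
      rw [h3, hφ1 t h]
      exact (duhamel_iff α Q u₁ φ₁ ψ₀ t).1 (hs₁ t ⟨ht.1, h⟩)
    · have h3 := hII2.mono_set (c := T₁) (d := t) (by
        rw [uIcc_of_le (by linarith : T₁ ≤ T₁ + T₂), uIcc_of_le h.le]
        exact Icc_subset_Icc_right ht.2)
      rw [← intervalIntegral.integral_add_adjacent_intervals hII1 h3]
      have h4 : ∫ s in (0 : ℝ)..T₁, interaction α Q u φ s =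
          ∫ s in (0 : ℝ)..T₁, interaction α Q u₁ φ₁ s := by
        refine intervalIntegral.integral_congr fun s hs => ?_
        rw [uIcc_of_le hT₁] at hs
        exact hI1 s hs.2
      have h5 : ∫ s in T₁..t, interaction α Q u φ s =
          freeU α (-T₁) (∫ s in (0 : ℝ)..(t - T₁), interaction α Q u₂ φ₂ s) := by
        have h6 : ∫ s in T₁..t, interaction α Q u φ s =
            ∫ s in T₁..t, freeU α (-T₁) (interaction α Q u₂ φ₂ (s - T₁)) := by
          refine intervalIntegral.integral_congr_ae (Eventually.of_forall fun s hs => ?_)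
          rw [uIoc_of_le h.le] at hs
          exact hI2 s hs.1
        rw [h6, intervalIntegral.integral_comp_sub_right
          (fun s => freeU α (-T₁) (interaction α Q u₂ φ₂ s)), sub_self,
          intervalIntegral.intervalIntegral_eq_integral_uIoc,
          intervalIntegral.intervalIntegral_eq_integral_uIoc, real_smul_map]
        congr 1
        exact (freeU α (-T₁)).toContinuousLinearEquiv.integral_comp_comm _
      have h7 := (duhamel_iff α Q u₁ φ₁ ψ₀ T₁).1 (hs₁ T₁ ⟨hT₁, le_rfl⟩)
      have h8 := (duhamel_iff α Q u₂ φ₂ ψ₁ (t - T₁)).1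
        (hs₂ (t - T₁) ⟨by linarith, by linarith [ht.2]⟩)
      rw [he₁] at h7
      rw [h4, h5, ← add_assoc, ← h7, ← map_add, ← h8, hφ2 t h.le, ← hU.apply_add]
      congr 2
      ring
  · rw [hφ2 _ (by linarith), add_sub_cancel_left, he₂]

/-! ### Trajectories for constant controls -/

theorem piecewiseConst_const {T : ℝ} (hT : 0 ≤ T) (c : Fin q → ℝ) :
    PiecewiseConst T fun _ => c := by
  refine ⟨1, fun i => if i = 0 then 0 else T, ?_, by simp, by simp, fun i _ => ⟨c, fun _ _ => rfl⟩⟩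
  intro i j hij
  simp only
  split_ifs with h1 h2
  · exact le_rfl
  · exact hT
  · omega
  · exact le_rfl

theorem mulL2_potential_zero (ψ : L2) : mulL2 (potential Q 0) ψ = 0 := by
  have h := norm_mulL2_le (potential Q 0) le_rfl (fun θ => by simp [potential]) ψ
  rw [zero_mul] at h
  exact norm_le_zero_iff.1 h

/-- The uncontrolled evolution. -/
theorem reachable_free {T : ℝ} (hT : 0 ≤ T) (ψ : L2) : Reachable α Q T ψ (freeU α T ψ) := by
  have h0 : interaction α Q (fun _ => 0) (fun t => freeU α t ψ) = fun _ => 0 := by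
    funext s
    rw [interaction, mulL2_potential_zero, map_zero]
  refine ⟨hT, fun _ => 0, fun t => freeU α t ψ, piecewiseConst_const hT 0,
    ⟨((isUnitaryGroup_freeU α).continuous ψ).continuousOn, fun t _ => ?_⟩, ?_, rfl⟩
  · refine (duhamel_iff α Q (fun _ => 0) (fun t => freeU α t ψ) ψ t).2 ?_
    rw [h0, (isUnitaryGroup_freeU α).apply_apply_neg]
    simp
  · rw [h0]
    exact intervalIntegrable_const

/-- Existence of the trajectory for a constant control and a short time, in the interaction
picture. -/
theorem exists_interaction_curve {T K : ℝ} (hT : 0 ≤ T) (hK0 : 0 ≤ K) (hKT : K * T ≤ 1 / 2)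
    (c : Fin q → ℝ) (hK : ∀ θ, ‖potential Q c θ‖ ≤ K) (ψ₀ : L2) :
    ∃ φ : ℝ → L2, φ 0 = ψ₀ ∧ ∀ t ∈ Icc 0 T, HasDerivWithinAt φ
      (freeU α (-t) (mulL2 (potential Q c) (freeU α t (φ t)))) (Icc 0 T) t := by
  have hU := isUnitaryGroup_freeU α
  set A : ℝ → L2 → L2 := fun t ψ => freeU α (-t) (mulL2 (potential Q c) (freeU α t ψ))
  have hA : ∀ t ψ, ‖A t ψ‖ ≤ K * ‖ψ‖ := fun t ψ => by
    rw [(freeU α (-t)).norm_map]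
    refine (norm_mulL2_le _ hK0 hK _).trans ?_
    rw [(freeU α t).norm_map]
  have hAs : ∀ t ψ χ, A t ψ - A t χ = A t (ψ - χ) := fun t ψ χ => by
    simp only [A]
    rw [← map_sub, ← mulCLM_apply, ← mulCLM_apply, ← mulCLM_apply, ← map_sub, ← map_sub]
  -- On the ball of radius `‖ψ₀‖` around `ψ₀` the field is bounded by `2K‖ψ₀‖`, and `KT ≤ 1/2` keeps
  -- the solution inside it up to time `T`.
  have hP : IsPicardLindelof A (tmin := 0) (tmax := T) ⟨0, le_rfl, hT⟩ ψ₀ ‖ψ₀‖₊ 0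
      ⟨2 * K * ‖ψ₀‖, by positivity⟩ ⟨K, hK0⟩ := by
    refine ⟨fun t _ => ?_, fun ψ _ => ?_, fun t _ ψ hψ => ?_, ?_⟩
    · refine LipschitzOnWith.of_dist_le_mul fun ψ _ χ _ => ?_
      rw [dist_eq_norm, dist_eq_norm, hAs]
      exact hA t _
    · have h1 : ContinuousOn (fun t => mulCLM (potential Q c) (freeU α t ψ)) (Icc 0 T) :=
        ((mulCLM (potential Q c)).continuous.comp (hU.continuous ψ)).continuousOn
      exact hU.continuousOn_apply continuous_neg h1
    · refine (hA t ψ).trans ?_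
      have h1 : ‖ψ‖ ≤ 2 * ‖ψ₀‖ := by
        have h2 : ‖ψ - ψ₀‖ ≤ ‖ψ₀‖ := by simpa [dist_eq_norm] using hψ
        have := norm_add_le (ψ - ψ₀) ψ₀
        rw [sub_add_cancel] at this
        linarith
      change _ ≤ 2 * K * ‖ψ₀‖
      nlinarith
    · have : max (T - 0) ((0 : ℝ) - 0) = T := by simp [hT]
      change 2 * K * ‖ψ₀‖ * max (T - 0) ((0 : ℝ) - 0) ≤ ‖ψ₀‖ - 0
      rw [this]
      nlinarith [norm_nonneg ψ₀]
  exact hP.exists_eq_forall_mem_Icc_hasDerivWithinAt₀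

theorem reachable_of_interaction_curve {T : ℝ} (hT : 0 ≤ T) (c : Fin q → ℝ) {φ : ℝ → L2}
    (hφ : ∀ t ∈ Icc 0 T, HasDerivWithinAt φ
      (freeU α (-t) (mulL2 (potential Q c) (freeU α t (φ t)))) (Icc 0 T) t) :
    Reachable α Q T (φ 0) (freeU α T (φ T)) := by
  have hU := isUnitaryGroup_freeU α
  have hφc : ContinuousOn φ (Icc 0 T) := fun t ht => (hφ t ht).continuousWithinAt
  have hψc : ContinuousOn (fun t => freeU α t (φ t)) (Icc 0 T) :=
    hU.continuousOn_apply continuous_id hφc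
  have hIc : ContinuousOn (interaction α Q (fun _ => c) fun t => freeU α t (φ t)) (Icc 0 T) :=
    hU.continuousOn_apply continuous_neg ((mulCLM (potential Q c)).continuous.comp_continuousOn hψc)
  refine ⟨hT, fun _ => c, fun t => freeU α t (φ t), piecewiseConst_const hT c,
    ⟨hψc, fun t ht => ?_⟩, hIc.intervalIntegrable_of_Icc hT, rfl⟩
  have hsub : Icc 0 t ⊆ Icc 0 T := Icc_subset_Icc_right ht.2
  refine (duhamel_iff α Q (fun _ => c) (fun t => freeU α t (φ t)) (φ 0) t).2 ?_
  rw [hU.apply_apply_neg, intervalIntegral.integral_eq_sub_of_hasDerivAt_of_le ht.1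
    (hφc.mono hsub) (f' := interaction α Q (fun _ => c) fun t => freeU α t (φ t))]
  · abel
  · intro s hs
    exact (hφ s (hsub (Ioo_subset_Icc_self hs))).hasDerivAt
      (Icc_mem_nhds hs.1 (hs.2.trans_le ht.2))
  · exact (hIc.mono hsub).intervalIntegrable_of_Icc ht.1

/-! ### Approximately reachable operators -/

/-- The operator `S` can be approximated, state by state, by controlled trajectories of duration at
most `T + ε`. -/
def ApproxReachable (T : ℝ) (S : L2 ≃ₗᵢ[ℂ] L2) : Prop :=
  ∀ ψ₀ : L2, ∀ ε : ℝ, 0 < ε →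
    ∃ T' ≤ T + ε, ∃ ψ₁, Reachable α Q T' ψ₀ ψ₁ ∧ ‖ψ₁ - S ψ₀‖ < ε

variable {α Q}

theorem ApproxReachable.l2STAR {S : L2 ≃ₗᵢ[ℂ] L2} (h : ApproxReachable α Q 0 S) :
    L2STAR α Q S := by
  intro ψ₀ _ ε hε
  obtain ⟨T, hT, ψ₁, ⟨hT0, u, ψ, hu, hs, _, he⟩, hn⟩ := h ψ₀ ε hε
  -- The global phase is not needed: `β = 0`.
  refine ⟨T, ⟨hT0, by simpa using hT⟩, 0, ⟨le_rfl, Real.two_pi_pos⟩, u, hu, ψ, hs, ?_⟩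
  rw [he]
  simpa using hn

/-- The second stage starts from the state actually reached by the first. Since `S₁` is isometric,
the error of the first stage is carried along without growth. -/
theorem ApproxReachable.mul {T₁ T₂ : ℝ} {S₁ S₂ : L2 ≃ₗᵢ[ℂ] L2} (h₁ : ApproxReachable α Q T₁ S₁)
    (h₂ : ApproxReachable α Q T₂ S₂) : ApproxReachable α Q (T₁ + T₂) (S₁ * S₂) := by
  intro ψ₀ ε hε
  obtain ⟨t₂, ht₂, ψ₁, hr₂, hn₂⟩ := h₂ ψ₀ (ε / 2) (by positivity)
  obtain ⟨t₁, ht₁, ψ₂, hr₁, hn₁⟩ := h₁ ψ₁ (ε / 2) (by positivity)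
  refine ⟨t₂ + t₁, by linarith, ψ₂, hr₂.trans hr₁, ?_⟩
  have h3 : ψ₂ - (S₁ * S₂) ψ₀ = (ψ₂ - S₁ ψ₁) + (S₁ ψ₁ - S₁ (S₂ ψ₀)) := by
    change ψ₂ - S₁ (S₂ ψ₀) = _
    abel
  rw [h3]
  refine (norm_add_le _ _).trans_lt ?_
  rw [norm_map_sub]
  linarith

/-- Closure under strong limits. All operators are isometries, so it is enough to approximate on
smooth vectors, and the approximant `S'` may depend on the vector. -/
theorem ApproxReachable.of_approx {T : ℝ} {S : L2 ≃ₗᵢ[ℂ] L2}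
    (h : ∀ g, SmoothPer g → ∀ ε : ℝ, 0 < ε → ∃ T' ≤ T + ε, ∃ S', ApproxReachable α Q T' S' ∧
      ‖S' (toL2 g) - S (toL2 g)‖ ≤ ε) : ApproxReachable α Q T S := by
  intro ψ₀ ε hε
  obtain ⟨g, hg, hgε⟩ := exists_toL2_near ψ₀ (show 0 < ε / 4 by positivity)
  obtain ⟨T', hT', S', hS', hn⟩ := h g hg (ε / 4) (by positivity)
  obtain ⟨T'', hT'', ψ₁, hr, hn'⟩ := hS' ψ₀ (ε / 4) (by positivity)
  refine ⟨T'', by linarith, ψ₁, hr, ?_⟩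
  have h3 : ψ₁ - S ψ₀ = (ψ₁ - S' ψ₀) + (S' ψ₀ - S' (toL2 g)) + (S' (toL2 g) - S (toL2 g)) +
      (S (toL2 g) - S ψ₀) := by abel
  rw [h3]
  refine (norm_add₄_le).trans_lt ?_
  rw [norm_map_sub, norm_map_sub, norm_sub_rev (toL2 g)]
  linarith

theorem approxReachable_freeU {T : ℝ} (hT : 0 ≤ T) : ApproxReachable α Q T (freeU α T) := by
  intro ψ₀ ε hε
  exact ⟨T, by linarith, _, reachable_free α Q hT ψ₀, by simpa using hε⟩

theorem approxReachable_one : ApproxReachable α Q 0 1 := by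
  have h := approxReachable_freeU (α := α) (Q := Q) le_rfl
  rwa [(isUnitaryGroup_freeU α).map_zero] at h

theorem ApproxReachable.pow {T : ℝ} {S : L2 ≃ₗᵢ[ℂ] L2} (h : ApproxReachable α Q T S) (n : ℕ) :
    ApproxReachable α Q (n * T) (S ^ n) := by
  induction n with
  | zero => simpa using approxReachable_one
  | succ n ih =>
    rw [pow_succ]
    convert ih.mul h using 1
    push_cast
    ring

/-! ### Conjugation of `L` by a phase -/

/-- The expression of `e^{-iΘ} L (e^{iΘ} g)` in terms of the first three derivatives `a`, `a₁`, `a₂`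
of `Θ`, and of `g` and its first three derivatives. -/
def conjL (α a a₁ a₂ : ℝ) (g g₁ g₂ g₃ : ℂ) : ℂ :=
  -g₃ - 3 * Complex.I * a * g₂ - 3 * Complex.I * a₁ * g₁ - Complex.I * a₂ * g + 3 * a ^ 2 * g₁ +
    3 * a * a₁ * g + Complex.I * a ^ 3 * g +
    Complex.I * α * (g₂ + 2 * Complex.I * a * g₁ + Complex.I * a₁ * g - a ^ 2 * g)

theorem hasDerivAt_phase_mul {Θ : ℝ → ℝ} {Θ' x : ℝ} {h : ℝ → ℂ} {h' : ℂ} (hΘ : HasDerivAt Θ Θ' x)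
    (hh : HasDerivAt h h' x) :
    HasDerivAt (fun x => Complex.exp (Complex.I * (Θ x : ℂ)) * h x)
      (Complex.exp (Complex.I * (Θ x : ℂ)) * (h' + Complex.I * Θ' * h x)) x := by
  have h1 := ((hΘ.ofReal_comp.const_mul Complex.I).cexp).mul hh
  convert! h1 using 1
  ring

/-- Each derivative passes through the phase as `∂ₓ + iΘ'`; three such steps expand to `conjL`. -/
theorem opL_phase (α : ℝ) {Θ : ℝ → ℝ} {g : ℝ → ℂ} (hΘ : SmoothPer Θ) (hg : SmoothPer g) (x : ℝ) :
    opL α (fun x => Complex.exp (Complex.I * (Θ x : ℂ)) * g x) x =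
      Complex.exp (Complex.I * (Θ x : ℂ)) *
        conjL α (deriv Θ x) (deriv (deriv Θ) x) (deriv (deriv (deriv Θ)) x) (g x) (deriv g x)
          (deriv (deriv g) x) (deriv (deriv (deriv g)) x) := by
  set a := deriv Θ
  set a₁ := deriv a
  set a₂ := deriv a₁
  have da (x : ℝ) : HasDerivAt (fun x => (a x : ℂ)) (a₁ x : ℂ) x :=
    (hΘ.deriv.hasDerivAt x).ofReal_comp
  have da₁ (x : ℝ) : HasDerivAt (fun x => (a₁ x : ℂ)) (a₂ x : ℂ) x :=
    (hΘ.deriv.deriv.hasDerivAt x).ofReal_comp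
  have dg (x : ℝ) := hg.hasDerivAt x
  have dg₁ (x : ℝ) := hg.deriv.hasDerivAt x
  have dg₂ (x : ℝ) := hg.deriv.deriv.hasDerivAt x
  have d₁ : deriv (fun x => Complex.exp (Complex.I * (Θ x : ℂ)) * g x) =
      fun x => Complex.exp (Complex.I * (Θ x : ℂ)) * (deriv g x + Complex.I * a x * g x) :=
    funext fun x => (hasDerivAt_phase_mul (hΘ.hasDerivAt x) (dg x)).deriv
  have dh₁ (x : ℝ) := (dg₁ x).add (((da x).const_mul Complex.I).mul (dg x))
  have d₂ := funext fun x => (hasDerivAt_phase_mul (hΘ.hasDerivAt x) (dh₁ x)).deriv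
  have dh₂ (x : ℝ) := ((dg₂ x).add ((((da₁ x).const_mul Complex.I).mul (dg x)).add
    (((da x).const_mul Complex.I).mul (dg₁ x)))).add (((da x).const_mul Complex.I).mul
      ((dg₁ x).add (((da x).const_mul Complex.I).mul (dg x))))
  have d₃ := funext fun x => (hasDerivAt_phase_mul (hΘ.hasDerivAt x) (dh₂ x)).deriv
  simp only [Pi.add_apply, Pi.mul_apply] at d₂ d₃
  rw [opL, d₁]
  erw [d₂]
  erw [d₃]
  simp only [conjL]
  ring_nf
  simp only [show Complex.I ^ 3 = -Complex.I from Complex.I_pow_three, Complex.I_sq]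
  ring

theorem SmoothFam.opL (α : ℝ) {F : ℝ → ℝ → ℂ} (hF : SmoothFam F) :
    SmoothFam fun t => opL α (F t) := by
  have h2 := hF.deriv_snd.deriv_snd
  have := ((SmoothFam.of_smoothPer (smoothPer_const (-1 : ℂ))).mul h2.deriv_snd).add
    ((SmoothFam.of_smoothPer (smoothPer_const (Complex.I * α))).mul h2)
  simp only [neg_mul, one_mul] at this
  exact this

/-- Continuous functions of four variables that are periodic in the last one are bounded when the
other ones stay in `[0, 1]`. -/
theorem exists_bound_of_periodic {R : ℝ × ℝ × ℝ × ℝ → ℂ} (hR : Continuous R)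
    (hp : ∀ a b c, Function.Periodic (fun x => R (a, b, c, x)) (2 * Real.pi)) :
    ∃ K, 0 ≤ K ∧ ∀ a ∈ Icc (0 : ℝ) 1, ∀ b ∈ Icc (0 : ℝ) 1, ∀ c ∈ Icc (0 : ℝ) 1, ∀ x,
      ‖R (a, b, c, x)‖ ≤ K := by
  have hI : IsCompact (Icc (0 : ℝ) 1) := isCompact_Icc
  obtain ⟨K, hK⟩ := (hI.prod (hI.prod (hI.prod (isCompact_Icc (a := (0 : ℝ))
    (b := 2 * Real.pi))))).exists_bound_of_continuousOn hR.continuousOn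
  refine ⟨max K 0, le_max_right _ _, fun a ha b hb c hc x => ?_⟩
  obtain ⟨y, hy, hxy⟩ := (hp a b c).exists_mem_Ico₀ Real.two_pi_pos x
  refine (congrArg norm hxy).trans_le ?_
  exact (hK (a, b, c, y) ⟨ha, hb, hc, hy.1, hy.2.le⟩).trans (le_max_left _ _)

/-! ### Phases in the span of the controls -/

theorem phase_zero : phase (fun _ => 0) = 1 := by
  ext1 ψ
  rw [phase, dif_pos (contPer_const 0), phaseC_apply]
  change mulL2 (expI (toTorus (contPer_const (0 : ℝ)))) ψ = ψ
  have : toTorus (contPer_const (0 : ℝ)) = 0 := by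
    ext θ
    induction θ using QuotientAddGroup.induction_on with
    | H x => rfl
  rw [this, expI_zero, mulL2_one]

theorem phase_mul {p r : ℝ → ℝ} (hp : ContPer p) (hr : ContPer r) :
    phase p * phase r = phase fun x => p x + r x := by
  ext1 ψ
  exact phase_phase hp hr ψ

theorem phase_pow {p : ℝ → ℝ} (hp : ContPer p) (n : ℕ) :
    phase p ^ n = phase fun x => n * p x := by
  induction n with
  | zero => simp [phase_zero]
  | succ n ih =>
    rw [pow_succ, ih, phase_mul ((contPer_const (n : ℝ)).mul hp) hp]
    congr 1
    funext x
    push_cast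
    ring

/-- A control of size `1/T` on `[0, T]` realises in the limit `T → 0` the multiplication by a
(small) phase. -/
theorem approxReachable_phase_small (hQ : ∀ j, SmoothOnTorus (Q j)) (v : Fin q → ℝ)
    (hv : ∀ x : ℝ, |∑ j, v j * Q j (x : Torus)| ≤ 1 / 2) :
    ApproxReachable α Q 0 (phase fun x : ℝ => ∑ j, v j * Q j (x : Torus)) := by
  have hU := isUnitaryGroup_freeU α
  set p : ℝ → ℝ := fun x => ∑ j, v j * Q j (x : Torus)
  have hp : SmoothPer p := by
    refine ⟨ContDiff.sum fun j _ => contDiff_const.mul (hQ j), fun x => ?_⟩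
    simp only [p]
    exact Finset.sum_congr rfl fun j _ => congrArg (v j * ·) ((contPer_lift (Q j)).2 x)
  intro ψ₀ ε hε
  obtain ⟨g, hg, hgε⟩ := exists_toL2_near ψ₀ (show 0 < ε / 8 by positivity)
  set F : ℝ → ℝ → ℂ := fun s x => Complex.exp (Complex.I * ((s * p x : ℝ) : ℂ)) * g x
  have hF : SmoothFam F := (SmoothFam.fst.mul (SmoothFam.of_smoothPer hp)).cexpI.mul
    (SmoothFam.of_smoothPer hg)
  have hFd (s x : ℝ) : deriv (fun s => F s x) s = Complex.I * p x * F s x := by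
    have h1 : HasDerivAt (fun s : ℝ => ((s * p x : ℝ) : ℂ)) (p x) s := by
      have := ((hasDerivAt_id s).mul_const (p x)).ofReal_comp
      simpa using this
    have h2 := ((h1.const_mul Complex.I).cexp.mul_const (g x)).deriv
    refine h2.trans ?_
    simp only [F]
    ring
  obtain ⟨M, hM0, hM⟩ := (hF.opL α).exists_bound 0 1
  -- `T ≤ ε` bounds the duration. `MT ≤ ε/16` makes the free evolution negligible, `M` being a bound
  -- for `L` along the limit curve `s ↦ e^{isp} g`.
  set T : ℝ := min ε (ε / (16 * (M + 1)))
  have hT : 0 < T := by positivity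
  have hTM : M * T ≤ ε / 16 := by
    have h1 : T ≤ ε / (16 * (M + 1)) := min_le_right _ _
    calc M * T ≤ (M + 1) * (ε / (16 * (M + 1))) := by gcongr; linarith
      _ = ε / 16 := by field_simp
  set c : Fin q → ℝ := fun j => T⁻¹ * v j
  have hc (x : ℝ) : potential Q c (x : Torus) = (T : ℂ)⁻¹ * (Complex.I * p x) := by
    simp only [potential, ContinuousMap.coe_mk, c, p]
    rw [Finset.sum_congr rfl fun j _ => mul_assoc (T⁻¹) (v j) _, ← Finset.mul_sum]
    push_cast
    ring
  have hK : ∀ θ, ‖potential Q c θ‖ ≤ T⁻¹ * (1 / 2) := by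
    intro θ
    induction θ using QuotientAddGroup.induction_on with
    | H x =>
      refine (congrArg norm (hc x)).trans_le ?_
      rw [norm_mul, norm_mul, norm_inv, Complex.norm_real, Complex.norm_real, Complex.norm_I,
        one_mul, Real.norm_of_nonneg hT.le]
      gcongr
      exact hv x
  have hK0 : 0 ≤ T⁻¹ * (1 / 2) := by positivity
  have hKT : T⁻¹ * (1 / 2) * T ≤ 1 / 2 := by field_simp; rfl
  obtain ⟨φ, hφ0, hφ⟩ := exists_interaction_curve α Q hT.le hK0 hKT c hK ψ₀
  have hr := reachable_of_interaction_curve α Q hT.le c hφ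
  rw [hφ0] at hr
  refine ⟨T, by rw [zero_add]; exact min_le_left _ _, _, hr, ?_⟩
  -- `η` follows the potential alone, without dispersion, and ends at `e^{ip} g`. The error `δ` to
  -- the true trajectory is measured in the interaction picture, where dispersion enters only as the
  -- bounded source `Lη`.
  set η : ℝ → L2 := fun t => toL2 (F (t / T))
  have hη (t : ℝ) : HasDerivAt η (mulL2 (potential Q c) (η t)) t := by
    have h1 := hF.hasDerivAt_toL2 (t / T)
    have h2 : HasDerivAt (fun t : ℝ => t / T) T⁻¹ t := by
      simpa using (hasDerivAt_id t).div_const T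
    have h3 := HasDerivAt.scomp (h := fun t : ℝ => t / T) t h1 h2
    convert! h3 using 1
    simp only [hFd]
    rw [real_smul_eq, ← toL2_const_mul _ ((smoothPer_const Complex.I).mul hp.ofReal |>.mul
      (hF.smoothPer _)).contPer, mulL2_toL2 _ (hF.smoothPer _).contPer]
    congr 1
    funext x
    rw [hc]
    push_cast
    ring
  set δ : ℝ → L2 := fun t => φ t - freeU α (-t) (η t)
  set δ' : ℝ → L2 := fun t => freeU α (-t) (mulL2 (potential Q c) (freeU α t (φ t))) -
    freeU α (-t) (mulL2 (potential Q c) (η t) - toL2 (opL α (F (t / T))))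
  have hδ : ∀ t ∈ Icc 0 T, HasDerivWithinAt δ (δ' t) (Icc 0 T) t := fun t ht =>
    (hφ t ht).sub (hU.hasDerivAt_neg_apply (hη t)
      (hasDerivAt_freeFlow α (hF.smoothPer _))).hasDerivWithinAt
  have hδ'n : ∀ t ∈ Icc 0 T, ‖δ' t‖ ≤ T⁻¹ * (1 / 2) * ‖δ t‖ + M := by
    intro t ht
    have h1 : δ' t = freeU α (-t) (mulCLM (potential Q c) (freeU α t (δ t)) +
        toL2 (opL α (F (t / T)))) := by
      simp only [δ', δ]
      rw [← map_sub, map_sub (freeU α t), hU.apply_neg_apply, map_sub (mulCLM (potential Q c))]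
      congr 1
      simp only [mulCLM_apply]
      abel
    rw [h1, (freeU α (-t)).norm_map]
    refine (norm_add_le _ _).trans (add_le_add ?_ ?_)
    · refine (norm_mulL2_le _ hK0 hK _).trans ?_
      rw [(freeU α t).norm_map]
    · refine norm_toL2_le hM0 (hM _ ⟨by have := ht.1; positivity, ?_⟩)
      rw [div_le_one hT]
      exact ht.2
  -- In place of Gronwall, the mean value inequality is applied at a maximum of `‖δ‖`. The potential
  -- has norm at most `1/(2T)`, so half of the maximum is absorbed on the left.
  obtain ⟨t, ht, hmax⟩ := (isCompact_Icc (a := (0 : ℝ)) (b := T)).exists_isMaxOn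
    ⟨0, le_rfl, hT.le⟩ (fun t ht => (hδ t ht).continuousWithinAt.norm : ContinuousOn
      (fun t => ‖δ t‖) (Icc 0 T))
  have hδ0 : ‖δ 0‖ < ε / 8 := by
    have : δ 0 = ψ₀ - toL2 g := by
      simp only [δ, η, F, hφ0]
      rw [neg_zero, hU.apply_zero]
      simp
    rwa [this]
  have h1 : ‖δ t - δ 0‖ ≤ (T⁻¹ * (1 / 2) * ‖δ t‖ + M) * (t - 0) := by
    refine norm_image_sub_le_of_norm_deriv_le_segment' hδ (fun s hs => ?_) t ht
    refine (hδ'n s ⟨hs.1, hs.2.le⟩).trans ?_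
    gcongr
    exact hmax ⟨hs.1, hs.2.le⟩
  have h2 : ‖δ t‖ ≤ 2 * (‖δ 0‖ + M * T) := by
    have h3 := norm_add_le (δ t - δ 0) (δ 0)
    rw [sub_add_cancel] at h3
    have h4 : (T⁻¹ * (1 / 2) * ‖δ t‖ + M) * (t - 0) ≤ (T⁻¹ * (1 / 2) * ‖δ t‖ + M) * T := by
      gcongr
      linarith [ht.2]
    have h5 : (T⁻¹ * (1 / 2) * ‖δ t‖ + M) * T = 1 / 2 * ‖δ t‖ + M * T := by field_simp
    linarith
  have h6 : ‖δ T‖ ≤ ‖δ t‖ := hmax ⟨hT.le, le_rfl⟩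
  have h7 : freeU α T (φ T) - phase p ψ₀ = freeU α T (δ T) +
      (phase p (toL2 g) - phase p ψ₀) := by
    have : η T = phase p (toL2 g) := by
      rw [phase_toL2 hp.contPer hg.contPer]
      simp only [η, F, div_self hT.ne', one_mul]
    simp only [δ]
    rw [map_sub, hU.apply_neg_apply, this]
    abel
  rw [h7]
  refine (norm_add_le _ _).trans_lt ?_
  rw [norm_map_sub, (freeU α T).norm_map, norm_sub_rev (toL2 g) ψ₀]
  linarith

/-- A phase of any size is the `N`-th power of a phase bounded by `1/2`, and `N` durations tending
to zero still tend to zero. -/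
theorem approxReachable_phase_span (hQ : ∀ j, SmoothOnTorus (Q j)) (v : Fin q → ℝ) :
    ApproxReachable α Q 0 (phase fun x : ℝ => ∑ j, v j * Q j (x : Torus)) := by
  have hp : ContPer fun x : ℝ => ∑ j, v j * Q j (x : Torus) := by
    refine ⟨by fun_prop, fun x => ?_⟩
    exact Finset.sum_congr rfl fun j _ => congrArg (v j * ·) ((contPer_lift (Q j)).2 x)
  obtain ⟨K, hK0, hK⟩ := hp.exists_bound
  obtain ⟨N, hN⟩ := exists_nat_gt (2 * K)
  have hN0 : (0 : ℝ) < N := by linarith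
  have hsum (x : ℝ) : ∑ j, (N : ℝ)⁻¹ * v j * Q j (x : Torus) =
      (N : ℝ)⁻¹ * ∑ j, v j * Q j (x : Torus) := by
    rw [Finset.mul_sum]
    exact Finset.sum_congr rfl fun j _ => mul_assoc _ _ _
  have h1 := approxReachable_phase_small (α := α) hQ (fun j => (N : ℝ)⁻¹ * v j) fun x => by
    rw [hsum, abs_mul, abs_of_pos (inv_pos.2 hN0)]
    have := hK x
    rw [Real.norm_eq_abs] at this
    rw [inv_mul_le_iff₀ hN0]
    linarith
  have h2 := h1.pow N
  simp only [hsum] at h2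
  rw [phase_pow ((contPer_const _).mul hp), mul_zero] at h2
  convert h2 using 3 with x
  rw [← mul_assoc, mul_inv_cancel₀ hN0.ne', one_mul]

/-! ### Cubes of derivatives -/

/-- The phases all of whose real multiples are approximately reachable in small time. -/
def IsReachablePhase (α : ℝ) (Q : Fin q → C(Torus, ℝ)) (p : ℝ → ℝ) : Prop :=
  ∀ s : ℝ, ApproxReachable α Q 0 (phase fun x => s * p x)

/-- With `Θ = p/d` and duration `d³`, the cubic part of the conjugated generator contributes `d³ ·
i(p'/d)³ = i p'³`, and every other term is `O(d)`. The comparison curve is `e^{i(p/d + s p'³)} g`.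
-/
theorem approxReachable_phase_cube {p : ℝ → ℝ} (hp : SmoothPer p) (h : IsReachablePhase α Q p) :
    ApproxReachable α Q 0 (phase fun x => deriv p x ^ 3) := by
  have hU := isUnitaryGroup_freeU α
  set P := deriv p with hPdef
  set b : ℝ → ℝ := fun x => P x ^ 3
  have hP : SmoothPer P := hp.deriv
  have hb : SmoothPer b := hP.pow 3
  refine ApproxReachable.of_approx fun g hg ε hε => ?_
  -- `-d R` is the exact defect of the comparison curve with its phase factor removed. `R` is
  -- polynomial in `d` and `s`, hence bounded as `d → 0`; its third slot is a dummy.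
  set R : ℝ × ℝ × ℝ × ℝ → ℂ := fun z =>
    let d : ℝ := z.1
    let s : ℝ := z.2.1
    let x : ℝ := z.2.2.2
    let A : ℂ := P x + d * s * deriv b x
    let A₁ : ℂ := deriv P x + d * s * deriv (deriv b) x
    let A₂ : ℂ := deriv (deriv P) x + d * s * deriv (deriv (deriv b)) x
    let B : ℂ := s * deriv b x;
    -d ^ 2 * deriv (deriv (deriv g)) x - 3 * Complex.I * d * A * deriv (deriv g) x -
      3 * Complex.I * d * A₁ * deriv g x - Complex.I * d * A₂ * g x + 3 * A ^ 2 * deriv g x +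
      3 * A * A₁ * g x + Complex.I * (3 * P x ^ 2 * B + 3 * d * P x * B ^ 2 + d ^ 2 * B ^ 3) * g x +
      Complex.I * α * (d ^ 2 * deriv (deriv g) x + 2 * Complex.I * d * A * deriv g x +
        Complex.I * d * A₁ * g x - A ^ 2 * g x)
  have hg1 := hg.deriv; have hg2 := hg1.deriv; have hg3 := hg2.deriv
  have hP1 := hP.deriv; have hP2 := hP1.deriv
  have hb1 := hb.deriv; have hb2 := hb1.deriv; have hb3 := hb2.deriv
  obtain ⟨K, hK0, hK⟩ := exists_bound_of_periodic (R := R)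
    (by
      have := hg.contPer.1; have := hg1.contPer.1; have := hg2.contPer.1; have := hg3.contPer.1
      have := hP.contPer.1; have := hP1.contPer.1; have := hP2.contPer.1
      have := hb1.contPer.1; have := hb2.contPer.1; have := hb3.contPer.1
      fun_prop)
    (fun d s t x => by
      simp only [R, hg.2 x, hg1.2 x, hg2.2 x, hg3.2 x, hP.2 x, hP1.2 x, hP2.2 x, hb1.2 x, hb2.2 x,
        hb3.2 x])
  set d : ℝ := min 1 (min ε (ε / (K + 1)))
  have hd : 0 < d := by positivity
  have hd1 : d ≤ 1 := min_le_left _ _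
  have hdε : d ≤ ε := (min_le_right _ _).trans (min_le_left _ _)
  have hdK : K * d ≤ ε := by
    have h1 : d ≤ ε / (K + 1) := (min_le_right _ _).trans (min_le_right _ _)
    calc K * d ≤ (K + 1) * (ε / (K + 1)) := by gcongr; linarith
      _ = ε := by field_simp
  set a : ℝ → ℝ := fun x => d⁻¹ * p x
  have ha : SmoothPer a := hp.rconst_mul _
  have hna : SmoothPer fun x => -d⁻¹ * p x := hp.rconst_mul _
  refine ⟨0 + d ^ 3 + 0, ?_, phase (fun x => -d⁻¹ * p x) * freeU α (d ^ 3) * phase a,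
    ((h _).mul (approxReachable_freeU (by positivity))).mul (h _), ?_⟩
  · have : d ^ 3 ≤ d := by
      calc d ^ 3 = d * (d * d) := by ring
        _ ≤ d * (1 * 1) := by gcongr
        _ = d := by ring
    linarith
  set η : ℝ → L2 := fun s => toL2 fun x =>
    Complex.exp (Complex.I * ((a x + s * b x : ℝ) : ℂ)) * (g x + s * 0)
  have hη := fun s => hasDerivAt_phase_curve ha hb hg (smoothPer_const 0) s
  have hΘ : ∀ s : ℝ, SmoothPer fun x => a x + s * b x := fun s => ha.add (hb.rconst_mul s)
  have hη0 : ∀ s : ℝ, SmoothPer fun x =>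
    Complex.exp (Complex.I * ((a x + s * b x : ℝ) : ℂ)) * (g x + s * 0) := fun s =>
    (hΘ s).cexpI.mul (hg.add ((smoothPer_const _).mul (smoothPer_const _)))
  have key := hU.norm_sub_le (c := d ^ 3) (C := K * d) zero_le_one (η := η)
    (fun s _ => hη s) (fun s _ => hasDerivAt_freeFlow α (hη0 s)) (fun s hs => by
      have e1 : (fun x => Complex.exp (Complex.I * ((a x + s * b x : ℝ) : ℂ)) *
          (g x + (s : ℂ) * 0)) =
          fun x => Complex.exp (Complex.I * ((a x + s * b x : ℝ) : ℂ)) * g x := by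
        simp
      rw [e1] at *
      have e2 := fun x => opL_phase α (hΘ s) hg x
      have dΘ : deriv (fun x => a x + s * b x) = fun x => d⁻¹ * P x + s * deriv b x :=
        funext fun x => (((hp.hasDerivAt x).const_mul _).add ((hb.hasDerivAt x).const_mul _)).deriv
      have dΘ1 : deriv (fun x => d⁻¹ * P x + s * deriv b x) =
          fun x => d⁻¹ * deriv P x + s * deriv (deriv b) x :=
        funext fun x => (((hP.hasDerivAt x).const_mul _).add ((hb1.hasDerivAt x).const_mul _)).deriv
      have dΘ2 : deriv (fun x => d⁻¹ * deriv P x + s * deriv (deriv b) x) =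
          fun x => d⁻¹ * deriv (deriv P) x + s * deriv (deriv (deriv b)) x :=
        funext fun x =>
          (((hP1.hasDerivAt x).const_mul _).add ((hb2.hasDerivAt x).const_mul _)).deriv
      simp only [dΘ, dΘ1, dΘ2] at e2
      have hcp : SmoothPer fun x => Complex.exp (Complex.I * ((a x + s * b x : ℝ) : ℂ)) * g x :=
        (hΘ s).cexpI.mul hg
      rw [real_smul_eq, ← toL2_const_mul _ (smoothPer_opL α hcp).contPer, ← toL2_sub
        ((hΘ s).cexpI.mul ((((smoothPer_const Complex.I).mul hb.ofReal).mul
          (hg.add ((smoothPer_const (s : ℂ)).mul (smoothPer_const 0)))).add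
            (smoothPer_const 0))).contPer ((smoothPer_const _).mul (smoothPer_opL α hcp)).contPer]
      refine norm_toL2_le (by positivity) fun x => ?_
      rw [e2]
      have e3 : Complex.exp (Complex.I * ((a x + s * b x : ℝ) : ℂ)) *
          (Complex.I * b x * (g x + (s : ℂ) * 0) + 0) - ((d ^ 3 : ℝ) : ℂ) *
          (Complex.exp (Complex.I * ((a x + s * b x : ℝ) : ℂ)) *
          conjL α (d⁻¹ * P x + s * deriv b x) (d⁻¹ * deriv P x + s * deriv (deriv b) x)
            (d⁻¹ * deriv (deriv P) x + s * deriv (deriv (deriv b)) x) (g x) (deriv g x)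
            (deriv (deriv g) x) (deriv (deriv (deriv g)) x)) =
          -- The terms of order zero in `d` cancel because `b = P³`.
          Complex.exp (Complex.I * ((a x + s * b x : ℝ) : ℂ)) * (-(d : ℂ) * R (d, s, 0, x)) := by
        have hdc : (d : ℂ) ≠ 0 := by exact_mod_cast hd.ne'
        simp only [conjL, R, b]
        push_cast
        field_simp
        ring
      rw [e3, norm_mul, mul_comm Complex.I, Complex.norm_exp_ofReal_mul_I, one_mul, norm_mul,
        norm_neg, Complex.norm_real, Real.norm_of_nonneg hd.le, mul_comm]
      gcongr
      exact hK d ⟨hd.le, hd1⟩ s hs 0 ⟨le_rfl, zero_le_one⟩ x)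
  have f0 : η 0 = phase a (toL2 g) := by
    rw [phase_toL2 ha.contPer hg.contPer]
    simp [η]
  have f1 : η 1 = phase a (phase b (toL2 g)) := by
    rw [phase_phase ha.contPer hb.contPer, phase_toL2 (ha.add hb).contPer hg.contPer]
    simp [η]
  have f2 : phase b (toL2 g) = phase (fun x => -d⁻¹ * p x) (η 1) := by
    rw [f1, phase_phase hna.contPer ha.contPer]
    have : (fun x => -d⁻¹ * p x + a x) = fun _ => 0 := by
      funext x
      simp only [a]
      ring
    rw [this, phase_zero]
    rfl
  rw [mul_one, mul_one, f0] at key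
  rw [f2]
  change ‖phase (fun x => -d⁻¹ * p x) (freeU α (d ^ 3) (phase a (toL2 g))) - _‖ ≤ ε
  rw [norm_map_sub]
  exact key.trans hdK

/-! ### All continuous phases are reachable -/

theorem IsReachablePhase.add {p r : ℝ → ℝ} (hp : ContPer p) (hr : ContPer r)
    (h : IsReachablePhase α Q p) (h' : IsReachablePhase α Q r) :
    IsReachablePhase α Q fun x => p x + r x := by
  intro s
  have := (h s).mul (h' s)
  rw [phase_mul ((contPer_const s).mul hp) ((contPer_const s).mul hr), add_zero] at this
  simpa only [mul_add] using this

theorem IsReachablePhase.const_mul {p : ℝ → ℝ} (h : IsReachablePhase α Q p) (c : ℝ) :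
    IsReachablePhase α Q fun x => c * p x := by
  intro s
  simpa only [mul_assoc] using h (s * c)

theorem exists_cube_eq (s : ℝ) : ∃ c : ℝ, c ^ 3 = s := by
  rcases le_total 0 s with h | h
  · exact ⟨s ^ (1 / 3 : ℝ), by rw [← Real.rpow_natCast, ← Real.rpow_mul h]; norm_num⟩
  · refine ⟨-(-s) ^ (1 / 3 : ℝ), ?_⟩
    have : ((-s) ^ (1 / 3 : ℝ)) ^ 3 = -s := by
      rw [← Real.rpow_natCast, ← Real.rpow_mul (by linarith)]; norm_num
    rw [Odd.neg_pow (by decide), this, neg_neg]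

/-- Scaling `p` by `c` scales the cube by `c³`, and every real number, negative ones included, is a
cube. No sign restriction arises. -/
theorem IsReachablePhase.deriv_cube {p : ℝ → ℝ} (hp : SmoothPer p) (h : IsReachablePhase α Q p) :
    IsReachablePhase α Q fun x => deriv p x ^ 3 := by
  intro s
  obtain ⟨c, rfl⟩ := exists_cube_eq s
  have := approxReachable_phase_cube (hp.rconst_mul c) (h.const_mul c)
  have hd : deriv (fun x => c * p x) = fun x => c * deriv p x :=
    funext fun x => ((hp.hasDerivAt x).const_mul c).deriv
  simpa only [hd, mul_pow] using this

/-- Polarisation: `24abc = (a+b+c)³ - (a+b-c)³ - (a-b+c)³ + (a-b-c)³`, applied to the derivatives.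
-/
theorem IsReachablePhase.deriv_mul_mul {a b c : ℝ → ℝ} (ha : SmoothPer a) (hb : SmoothPer b)
    (hc : SmoothPer c) (ra : IsReachablePhase α Q a) (rb : IsReachablePhase α Q b)
    (rc : IsReachablePhase α Q c) :
    IsReachablePhase α Q fun x => deriv a x * deriv b x * deriv c x := by
  have H : ∀ u v w : ℝ, ContPer (fun x => (deriv (fun x => u * a x + v * b x + w * c x) x) ^ 3) ∧
      IsReachablePhase α Q fun x => (deriv (fun x => u * a x + v * b x + w * c x) x) ^ 3 := by
    intro u v w
    have h1 : SmoothPer fun x => u * a x + v * b x + w * c x :=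
      ((ha.rconst_mul u).add (hb.rconst_mul v)).add (hc.rconst_mul w)
    exact ⟨(h1.deriv.pow 3).contPer, IsReachablePhase.deriv_cube h1
      (((ra.const_mul u).add (ha.rconst_mul u).contPer (hb.rconst_mul v).contPer
        (rb.const_mul v)).add ((ha.rconst_mul u).add (hb.rconst_mul v)).contPer
        (hc.rconst_mul w).contPer (rc.const_mul w))⟩
  have hd : ∀ u v w : ℝ, deriv (fun x => u * a x + v * b x + w * c x) =
      fun x => u * deriv a x + v * deriv b x + w * deriv c x := fun u v w =>
    funext fun x => ((((ha.hasDerivAt x).const_mul u).add ((hb.hasDerivAt x).const_mul v)).add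
      ((hc.hasDerivAt x).const_mul w)).deriv
  simp only [hd] at H
  obtain ⟨c1, r1⟩ := H 1 1 1
  obtain ⟨c2, r2⟩ := H 1 1 (-1)
  obtain ⟨c3, r3⟩ := H 1 (-1) 1
  obtain ⟨c4, r4⟩ := H 1 (-1) (-1)
  have e := (((r1.add c1 ((contPer_const (-1 : ℝ)).mul c2) (r2.const_mul (-1))).add
    (c1.add ((contPer_const (-1 : ℝ)).mul c2)) ((contPer_const (-1 : ℝ)).mul c3)
    (r3.const_mul (-1))).add ((c1.add ((contPer_const (-1 : ℝ)).mul c2)).add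
    ((contPer_const (-1 : ℝ)).mul c3)) c4 r4).const_mul (1 / 24)
  convert e using 2 with x
  ring

/-! ### Generation of trigonometric polynomials -/

theorem smoothPer_cos (n : ℕ) : SmoothPer fun x => Real.cos (n * x) := by
  refine ⟨Real.contDiff_cos.comp (contDiff_const.mul contDiff_id), fun x => ?_⟩
  simp only
  rw [mul_add, Real.cos_add_nat_mul_two_pi]

theorem smoothPer_sin (n : ℕ) : SmoothPer fun x => Real.sin (n * x) := by
  refine ⟨Real.contDiff_sin.comp (contDiff_const.mul contDiff_id), fun x => ?_⟩
  simp only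
  rw [mul_add, Real.sin_add_nat_mul_two_pi]

theorem deriv_cos_mul (n : ℕ) :
    deriv (fun x => Real.cos (n * x)) = fun x => -(n * Real.sin (n * x)) := by
  funext x
  have h := ((hasDerivAt_id x).const_mul (n : ℝ)).cos
  simp only [id, mul_one] at h
  rw [h.deriv]
  ring

theorem deriv_sin_mul (n : ℕ) :
    deriv (fun x => Real.sin (n * x)) = fun x => n * Real.cos (n * x) := by
  funext x
  have h := ((hasDerivAt_id x).const_mul (n : ℝ)).sin
  simp only [id, mul_one] at h
  rw [h.deriv]
  ring

theorem isReachablePhase_span (hQ : ∀ j, SmoothOnTorus (Q j)) {p : ℝ → ℝ}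
    (hp : p ∈ Submodule.span ℝ (range fun (j : Fin q) (x : ℝ) => Q j (x : Torus))) :
    IsReachablePhase α Q p := by
  intro s
  obtain ⟨v, rfl⟩ := (Submodule.mem_span_range_iff_exists_fun ℝ).1 hp
  have := approxReachable_phase_span (α := α) hQ fun j => s * v j
  convert this using 3 with x
  rw [Finset.sum_apply, Finset.mul_sum]
  exact Finset.sum_congr rfl fun j _ => by simp [mul_assoc]

/-- Frequencies `0, 1, 2` come from the controls. Frequency `n + 3` is obtained from `n + 1` by the
addition formula with `2x`, where `cos 2x` and `sin 2x` are quadratic in `cos x`, `sin x`; every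
term is then a product of three derivatives of frequencies `n + 1, 1, 1`. Steps of two are the
reason for needing frequency `2` at the start. -/
theorem isReachablePhase_trig (hQ : ∀ j, SmoothOnTorus (Q j)) (hspan : ControlsSpan Q) (n : ℕ) :
    (IsReachablePhase α Q fun x => Real.cos (n * x)) ∧
      IsReachablePhase α Q fun x => Real.sin (n * x) := by
  have h1 : ∀ p ∈ ({fun _ => 1, fun x => Real.sin x, fun x => Real.cos x,
      fun x => Real.sin (2 * x), fun x => Real.cos (2 * x)} : Set (ℝ → ℝ)),
      IsReachablePhase α Q p := fun p hp => isReachablePhase_span hQ (hspan hp)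
  have one := h1 (fun _ => 1) (by simp)
  have s1 := h1 (fun x => Real.sin x) (by simp)
  have c1 := h1 (fun x => Real.cos x) (by simp)
  have s2 := h1 (fun x => Real.sin (2 * x)) (by simp)
  have c2 := h1 (fun x => Real.cos (2 * x)) (by simp)
  induction n using Nat.strong_induction_on with
  | _ n ih =>
    match n, ih with
    | 0, _ =>
      have := one.const_mul 0
      exact ⟨by simpa using one, by simpa using this⟩
    | 1, _ => exact ⟨by simpa using c1, by simpa using s1⟩
    | 2, _ => exact ⟨by simpa using c2, by simpa using s2⟩
    | n + 3, ih =>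
      obtain ⟨cn, sn⟩ := ih (n + 1) (by omega)
      have hS := smoothPer_sin 1
      have hC := smoothPer_cos 1
      have dS := deriv_sin_mul 1
      have dC := deriv_cos_mul 1
      simp only [Nat.cast_one, one_mul] at hS hC dS dC
      have hSn := smoothPer_sin (n + 1)
      have hCn := smoothPer_cos (n + 1)
      have dSn := deriv_sin_mul (n + 1)
      have dCn := deriv_cos_mul (n + 1)
      have hn : ((n : ℝ) + 1) ≠ 0 := by positivity
      have e2 : ∀ x : ℝ, ((n + 3 : ℕ) : ℝ) * x = ((n + 1 : ℕ) : ℝ) * x + 2 * x := fun x => by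
        push_cast; ring
      have P := fun {a b c : ℝ → ℝ} (ha : SmoothPer a) (hb : SmoothPer b) (hc : SmoothPer c) =>
        ((ha.deriv.mul hb.deriv).mul hc.deriv).contPer
      have k := fun (c : ℝ) {p : ℝ → ℝ} (hp : ContPer p) => (contPer_const c).mul hp
      constructor
      · have A := (sn.deriv_mul_mul hSn hS hS s1 s1).const_mul (((n : ℝ) + 1)⁻¹)
        have B := (sn.deriv_mul_mul hSn hC hC c1 c1).const_mul (-((n : ℝ) + 1)⁻¹)
        have D := (cn.deriv_mul_mul hCn hC hS c1 s1).const_mul (-2 * ((n : ℝ) + 1)⁻¹)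
        have E := (A.add (k _ (P hSn hS hS)) (k _ (P hSn hC hC)) B).add
          ((k _ (P hSn hS hS)).add (k _ (P hSn hC hC))) (k _ (P hCn hC hS)) D
        simp only [dS, dC, dSn, dCn] at E
        convert E using 2 with x
        rw [e2, Real.cos_add, Real.cos_two_mul', Real.sin_two_mul]
        push_cast
        field_simp
        ring
      · have A := (cn.deriv_mul_mul hCn hS hS s1 s1).const_mul (-((n : ℝ) + 1)⁻¹)
        have B := (cn.deriv_mul_mul hCn hC hC c1 c1).const_mul (((n : ℝ) + 1)⁻¹)
        have D := (sn.deriv_mul_mul hSn hC hS c1 s1).const_mul (-2 * ((n : ℝ) + 1)⁻¹)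
        have E := (A.add (k _ (P hCn hS hS)) (k _ (P hCn hC hC)) B).add
          ((k _ (P hCn hS hS)).add (k _ (P hCn hC hC))) (k _ (P hSn hC hS)) D
        simp only [dS, dC, dSn, dCn] at E
        convert E using 2 with x
        rw [e2, Real.sin_add, Real.cos_two_mul', Real.sin_two_mul]
        push_cast
        field_simp
        ring

theorem norm_cexpI_sub_le (a b : ℝ) :
    ‖Complex.exp (Complex.I * a) - Complex.exp (Complex.I * b)‖ ≤ |a - b| := by
  have h1 : Complex.exp (Complex.I * a) - Complex.exp (Complex.I * b) =
      Complex.exp (Complex.I * b) * (Complex.exp (Complex.I * ((a - b : ℝ) : ℂ)) - 1) := by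
    rw [mul_sub, ← Complex.exp_add, mul_one]
    congr 2
    push_cast
    ring
  rw [h1, norm_mul, mul_comm Complex.I (b : ℂ), Complex.norm_exp_ofReal_mul_I, one_mul]
  exact Real.norm_exp_I_mul_ofReal_sub_one_le

/-- Uniform convergence of phases implies strong convergence of the multiplications, by `|e^{ia} -
e^{ib}| ≤ |a - b|`. -/
theorem IsReachablePhase.of_approx {p : ℝ → ℝ} (hp : ContPer p)
    (h : ∀ ε : ℝ, 0 < ε → ∃ r, ContPer r ∧ IsReachablePhase α Q r ∧ ∀ x, |r x - p x| ≤ ε) :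
    IsReachablePhase α Q p := by
  intro s
  refine ApproxReachable.of_approx fun g hg ε hε => ?_
  obtain ⟨K, hK0, hK⟩ := hg.contPer.exists_bound
  obtain ⟨r, hr, hrr, hrp⟩ := h (ε / ((|s| + 1) * (K + 1))) (by positivity)
  refine ⟨0, by linarith, _, hrr s, ?_⟩
  have hsr := (contPer_const s).mul hr
  have hsp := (contPer_const s).mul hp
  rw [phase_toL2 hsr hg.contPer, phase_toL2 hsp hg.contPer,
    ← toL2_sub (hsr.cexpI.mul hg.contPer) (hsp.cexpI.mul hg.contPer)]
  refine norm_toL2_le hε.le fun x => ?_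
  rw [← sub_mul, norm_mul]
  calc _ ≤ |s * r x - s * p x| * K := by
        gcongr
        · exact norm_cexpI_sub_le _ _
        · exact hK x
    _ = |s| * |r x - p x| * K := by rw [← mul_sub, abs_mul]
    _ ≤ (|s| + 1) * (ε / ((|s| + 1) * (K + 1))) * (K + 1) := by
        gcongr
        · linarith
        · exact hrp x
        · linarith
    _ = ε := by field_simp

theorem isReachablePhase_fourier (hQ : ∀ j, SmoothOnTorus (Q j)) (hspan : ControlsSpan Q) (n : ℤ) :
    (IsReachablePhase α Q fun x => (fourier (T := 2 * Real.pi) n (x : Torus)).re) ∧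
      IsReachablePhase α Q fun x => (fourier (T := 2 * Real.pi) n (x : Torus)).im := by
  have h1 : ∀ x : ℝ, fourier (T := 2 * Real.pi) n (x : Torus) =
      Complex.exp (((n * x : ℝ) : ℂ) * Complex.I) := fun x => by
    have := congrFun (expo_eq_fourier n) x
    rw [← this, expo]
    congr 1
    push_cast
    ring
  simp only [h1, Complex.exp_ofReal_mul_I_re, Complex.exp_ofReal_mul_I_im]
  obtain ⟨hc, hs⟩ := isReachablePhase_trig (α := α) hQ hspan n.natAbs
  rcases Int.natAbs_eq n with h | h
  · rw [h]
    exact ⟨hc, hs⟩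
  · rw [h]
    refine ⟨?_, ?_⟩
    · convert hc using 2 with x
      simp [Real.cos_neg]
    · convert hs.const_mul (-1) using 2 with x
      simp [Real.sin_neg]

/-- Multiplication by `e^{ip}` is approximately reachable in arbitrarily small time for every
continuous real periodic `p`. -/
theorem isReachablePhase_of_contPer (hQ : ∀ j, SmoothOnTorus (Q j)) (hspan : ControlsSpan Q)
    {p : ℝ → ℝ} (hp : ContPer p) : IsReachablePhase α Q p := by
  have cre : ∀ f : C(Torus, ℂ), ContPer fun x : ℝ => (f (x : Torus)).re := fun f =>
    (contPer_lift f).comp Complex.continuous_re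
  have cim : ∀ f : C(Torus, ℂ), ContPer fun x : ℝ => (f (x : Torus)).im := fun f =>
    (contPer_lift f).comp Complex.continuous_im
  -- Real and imaginary parts are carried together, since multiplication by a complex scalar mixes
  -- them.
  have hW : ∀ f ∈ Submodule.span ℂ (range (fourier (T := 2 * Real.pi))),
      (IsReachablePhase α Q fun x => (f (x : Torus)).re) ∧
        IsReachablePhase α Q fun x => (f (x : Torus)).im := by
    intro f hf
    induction hf using Submodule.span_induction with
    | mem f hf =>
      obtain ⟨n, rfl⟩ := hf
      exact isReachablePhase_fourier hQ hspan n
    | zero =>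
      have h0 : IsReachablePhase α Q fun _ => (0 : ℝ) := by
        simpa using (isReachablePhase_fourier (α := α) hQ hspan 0).1.const_mul 0
      exact ⟨by simpa using h0, by simpa using h0⟩
    | add f g _ _ hf hg =>
      exact ⟨hf.1.add (cre f) (cre g) hg.1, hf.2.add (cim f) (cim g) hg.2⟩
    | smul c f _ hf =>
      refine ⟨?_, ?_⟩
      · have := (hf.1.const_mul c.re).add ((contPer_const _).mul (cre f))
          ((contPer_const _).mul (cim f)) (hf.2.const_mul (-c.im))
        convert this using 2 with x
        simp [Complex.mul_re, sub_eq_add_neg]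
      · have := (hf.2.const_mul c.re).add ((contPer_const _).mul (cim f))
          ((contPer_const _).mul (cre f)) (hf.1.const_mul c.im)
        convert this using 2 with x
        simp [Complex.mul_im]
  refine IsReachablePhase.of_approx hp fun ε hε => ?_
  have hmem : toTorus hp.ofReal ∈
      (Submodule.span ℂ (range (fourier (T := 2 * Real.pi)))).topologicalClosure := by
    rw [span_fourier_closure_eq_top]
    trivial
  obtain ⟨f, hf, hd⟩ := Metric.mem_closure_iff.1 hmem ε hε
  refine ⟨_, cre f, (hW f hf).1, fun x => ?_⟩
  have h1 : ‖f (x : Torus) - (p x : ℂ)‖ ≤ ε := by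
    have := (f - toTorus hp.ofReal).norm_coe_le_norm (x : Torus)
    rw [← dist_eq_norm, dist_comm] at this
    exact this.trans hd.le
  have h2 := Complex.abs_re_le_norm (f (x : Torus) - (p x : ℂ))
  rw [Complex.sub_re, Complex.ofReal_re] at h2
  exact h2.trans h1

/-! ### Consistent families of operators -/

/-- The first order operator `a ∂ₓ + b`. -/
def firstOrder (a b g : ℝ → ℂ) (x : ℝ) : ℂ := a x * deriv g x + b x * g x

theorem smoothPer_firstOrder {a b g : ℝ → ℂ} (ha : SmoothPer a) (hb : SmoothPer b)
    (hg : SmoothPer g) : SmoothPer (firstOrder a b g) := (ha.mul hg.deriv).add (hb.mul hg)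

theorem smoothFam_firstOrder {a b : ℝ → ℂ} {F : ℝ → ℝ → ℂ} (ha : SmoothPer a) (hb : SmoothPer b)
    (hF : SmoothFam F) : SmoothFam fun t => firstOrder a b (F t) :=
  ((SmoothFam.of_smoothPer ha).mul hF.deriv_snd).add ((SmoothFam.of_smoothPer hb).mul hF)

/-- `V h` agrees with `1 + h (a ∂ₓ + b)` up to `O(h^{3/2})`, locally uniformly along smooth families
of functions. -/
def Consistent (V : ℝ → (L2 ≃ₗᵢ[ℂ] L2)) (a b : ℝ → ℂ) : Prop :=
  ∀ F : ℝ → ℝ → ℂ, SmoothFam F → ∃ K, 0 ≤ K ∧ ∀ h ∈ Ioc (0 : ℝ) 1, ∀ t ∈ Icc (0 : ℝ) 1,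
    ‖V h (toL2 (F t)) - toL2 (F t) - h • toL2 (firstOrder a b (F t))‖ ≤ K * (h * √h)

/-- `(1 + hA₁)(1 + hA₂) = 1 + h(A₁ + A₂) + O(h²)`. The consistency of `V₁` is used twice, on `F` and
on the family `A₂F`, which is why the definition quantifies over smooth families. -/
theorem Consistent.mul {V₁ V₂ : ℝ → (L2 ≃ₗᵢ[ℂ] L2)} {a₁ b₁ a₂ b₂ : ℝ → ℂ}
    (h₁ : Consistent V₁ a₁ b₁) (h₂ : Consistent V₂ a₂ b₂) (ha₁ : SmoothPer a₁)
    (hb₁ : SmoothPer b₁) (ha₂ : SmoothPer a₂) (hb₂ : SmoothPer b₂) :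
    Consistent (fun h => V₁ h * V₂ h) (fun x => a₁ x + a₂ x) fun x => b₁ x + b₂ x := by
  intro F hF
  have hG := smoothFam_firstOrder ha₂ hb₂ hF
  have hH := smoothFam_firstOrder ha₁ hb₁ hG
  obtain ⟨K₁, hK₁0, hK₁⟩ := h₁ F hF
  obtain ⟨K₂, hK₂0, hK₂⟩ := h₂ F hF
  obtain ⟨K₃, hK₃0, hK₃⟩ := h₁ _ hG
  obtain ⟨M, hM0, hM⟩ := hH.exists_bound 0 1
  refine ⟨K₁ + K₂ + K₃ + M, by positivity, fun h hh t ht => ?_⟩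
  have hh0 := hh.1.le
  have hs1 : √h ≤ 1 := Real.sqrt_le_one.2 hh.2
  have hhs : h ≤ √h := by
    calc h = √h * √h := (Real.mul_self_sqrt hh0).symm
      _ ≤ √h * 1 := by gcongr
      _ = √h := mul_one _
  set ψ := toL2 (F t)
  set B₂ := toL2 (firstOrder a₂ b₂ (F t))
  set B₁ := toL2 (firstOrder a₁ b₁ (F t))
  set B₁₂ := toL2 (firstOrder a₁ b₁ (firstOrder a₂ b₂ (F t)))
  have e0 : toL2 (firstOrder (fun x => a₁ x + a₂ x) (fun x => b₁ x + b₂ x) (F t)) = B₁ + B₂ := by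
    rw [← toL2_add (smoothPer_firstOrder ha₁ hb₁ (hF.smoothPer t)).contPer
      (hG.smoothPer t).contPer]
    congr 1
    funext x
    simp only [firstOrder]
    ring
  have e1 : (V₁ h * V₂ h) ψ - ψ - h • (B₁ + B₂) = V₁ h (V₂ h ψ - ψ - h • B₂) +
      (V₁ h ψ - ψ - h • B₁) + (h • (V₁ h B₂ - B₂ - h • B₁₂) + (h * h) • B₁₂) := by
    change V₁ h (V₂ h ψ) - ψ - h • (B₁ + B₂) = _
    rw [map_sub, map_sub, real_smul_map, smul_add, smul_sub, smul_sub, mul_smul]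
    abel
  have n1 : ‖V₁ h (V₂ h ψ - ψ - h • B₂)‖ ≤ K₂ * (h * √h) := by
    rw [(V₁ h).norm_map]
    exact hK₂ h hh t ht
  have n2 : ‖V₁ h ψ - ψ - h • B₁‖ ≤ K₁ * (h * √h) := hK₁ h hh t ht
  have n3 : ‖h • (V₁ h B₂ - B₂ - h • B₁₂)‖ ≤ K₃ * (h * √h) := by
    rw [norm_smul, Real.norm_of_nonneg hh0]
    calc h * ‖V₁ h B₂ - B₂ - h • B₁₂‖ ≤ 1 * (K₃ * (h * √h)) := by
          gcongr
          · exact hh.2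
          · exact hK₃ h hh t ht
      _ = _ := one_mul _
  have n4 : ‖(h * h) • B₁₂‖ ≤ M * (h * √h) := by
    rw [norm_smul, Real.norm_of_nonneg (by positivity), mul_comm]
    gcongr
    exact norm_toL2_le hM0 (hM t ht)
  rw [e0, e1]
  refine (norm_add₃_le).trans ?_
  have := norm_add_le (h • (V₁ h B₂ - B₂ - h • B₁₂)) ((h * h) • B₁₂)
  linarith

/-- A unitary group whose generator extends `a ∂ₓ + b` on smooth functions is consistent with
it. -/
theorem Consistent.of_group {U : ℝ → (L2 ≃ₗᵢ[ℂ] L2)} (hU : IsUnitaryGroup U) {a b : ℝ → ℂ}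
    (ha : SmoothPer a) (hb : SmoothPer b) (c : ℝ)
    (hgen : ∀ g, SmoothPer g →
      HasDerivAt (fun t => U t (toL2 g)) (toL2 (firstOrder a b g)) 0) :
    Consistent (fun h => U (c * h)) (fun x => c * a x) fun x => c * b x := by
  intro F hF
  have hG := smoothFam_firstOrder ha hb hF
  obtain ⟨M, hM0, hM⟩ := (smoothFam_firstOrder ha hb hG).exists_bound 0 1
  refine ⟨|c| * (|c| * M), by positivity, fun h hh t ht => ?_⟩
  have hh0 := hh.1.le
  have hs1 : √h ≤ 1 := Real.sqrt_le_one.2 hh.2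
  have hhs : h ≤ √h := by
    calc h = √h * √h := (Real.mul_self_sqrt hh0).symm
      _ ≤ √h * 1 := by gcongr
      _ = √h := mul_one _
  have hFt := hF.smoothPer t
  have hGt := hG.smoothPer t
  set ψ := toL2 (F t)
  set B := toL2 (firstOrder a b (F t))
  set B₂ := toL2 (firstOrder a b (firstOrder a b (F t)))
  have e0 : toL2 (firstOrder (fun x => c * a x) (fun x => c * b x) (F t)) = c • B := by
    rw [real_smul_eq, ← toL2_const_mul _ hGt.contPer]
    congr 1
    funext x
    simp only [firstOrder]
    ring
  have hlin : ∀ s : ℝ, ψ + (c * s) • B = toL2 fun x => F t x + ((c * s : ℝ) : ℂ) *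
      firstOrder a b (F t) x := fun s => by
    rw [toL2_add hFt.contPer (hGt.const_mul _).contPer, toL2_const_mul _ hGt.contPer,
      real_smul_eq]
  have hlin2 : ∀ s : ℝ, firstOrder a b (fun x => F t x + ((c * s : ℝ) : ℂ) *
      firstOrder a b (F t) x) = fun x => firstOrder a b (F t) x + ((c * s : ℝ) : ℂ) *
      firstOrder a b (firstOrder a b (F t)) x := fun s => by
    funext x
    have hd : deriv (fun x => F t x + ((c * s : ℝ) : ℂ) * firstOrder a b (F t) x) x =
        deriv (F t) x + ((c * s : ℝ) : ℂ) * deriv (firstOrder a b (F t)) x :=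
      ((hFt.hasDerivAt x).add ((hGt.hasDerivAt x).const_mul _)).deriv
    rw [firstOrder, hd]
    simp only [firstOrder]
    ring
  -- The orbit is compared with its tangent line `ψ + csB`. The defect is `c · cs · B₂`, of size
  -- `O(h)` on `[0, h]`, so the error is `O(h²)`.
  have key := hU.norm_sub_le (c := c) (C := |c| * (|c| * (M * h))) hh0
    (η := fun s => ψ + (c * s) • B)
    (η' := fun _ => c • B) (ζ := fun s => B + (c * s) • B₂)
    (fun s _ => by
      have h1 : HasDerivAt (fun s : ℝ => c * s) c s := by
        simpa using (hasDerivAt_id s).const_mul c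
      exact (h1.smul_const B).const_add ψ)
    (fun s _ => by
      have h1 := hgen _ (hFt.add (hGt.const_mul ((c * s : ℝ) : ℂ)))
      rw [hlin2, toL2_add hGt.contPer ((smoothPer_firstOrder ha hb hGt).const_mul _).contPer,
        toL2_const_mul _ (smoothPer_firstOrder ha hb hGt).contPer, ← real_smul_eq] at h1
      simp only [hlin]
      exact h1)
    (fun s hs => by
      have e : c • B - c • (B + (c * s) • B₂) = -(c • (c * s) • B₂) := by
        rw [smul_add]
        abel
      rw [e, norm_neg, norm_smul, norm_smul, Real.norm_eq_abs, Real.norm_eq_abs, abs_mul,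
        abs_of_nonneg hs.1, mul_assoc, mul_comm s]
      gcongr
      · exact hs.1
      · exact norm_toL2_le hM0 (hM t ht)
      · exact hs.2)
  rw [e0]
  have e1 : U (c * h) ψ - ψ - h • c • B = U (c * h) (ψ + (c * 0) • B) - (ψ + (c * h) • B) := by
    rw [mul_zero, zero_smul, add_zero, smul_smul, mul_comm h c]
    abel
  rw [e1]
  refine key.trans ?_
  calc |c| * (|c| * (M * h)) * h = |c| * (|c| * M) * (h * h) := by ring
    _ ≤ _ := by gcongr

theorem isUnitaryGroup_phase {p : ℝ → ℝ} (hp : SmoothPer p) :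
    IsUnitaryGroup fun t => phase fun x => t * p x := by
  have hc : ∀ t : ℝ, ContPer fun x => t * p x := fun t => (hp.rconst_mul t).contPer
  refine IsUnitaryGroup.of_smooth (by simp [phase_zero]) (fun s t => ?_) fun g hg => ?_
  · rw [phase_mul (hc s) (hc t)]
    simp only [add_mul]
  · simp only [phase_toL2 (hc _) hg.contPer]
    have hF : SmoothFam fun (t x : ℝ) => Complex.exp (Complex.I * ((t * p x : ℝ) : ℂ)) * g x :=
      (SmoothFam.fst.mul (SmoothFam.of_smoothPer hp)).cexpI.mul (SmoothFam.of_smoothPer hg)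
    exact (hF.hasDerivAt_toL2 0).continuousAt

theorem hasDerivAt_phase {p : ℝ → ℝ} (hp : SmoothPer p) {g : ℝ → ℂ} (hg : SmoothPer g) :
    HasDerivAt (fun t : ℝ => phase (fun x => t * p x) (toL2 g))
      (toL2 (firstOrder (fun _ => 0) (fun x => Complex.I * p x) g)) 0 := by
  have hc : ∀ t : ℝ, ContPer fun x => t * p x := fun t => (hp.rconst_mul t).contPer
  have h := hasDerivAt_phase_curve (smoothPer_const (0 : ℝ)) hp hg (smoothPer_const (0 : ℂ)) 0
  simp only [phase_toL2 (hc _) hg.contPer]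
  convert h using 2
  · simp
  · funext x
    simp [firstOrder]

theorem consistent_phase {p : ℝ → ℝ} (hp : SmoothPer p) :
    Consistent (fun h => phase fun x => h * p x) (fun _ => 0) fun x => Complex.I * p x := by
  have := Consistent.of_group (isUnitaryGroup_phase hp) (smoothPer_const 0)
    (hp.ofReal.const_mul Complex.I) 1 fun g hg => hasDerivAt_phase hp hg
  simpa using this

/-! ### Transport along squares from the dispersive evolution -/

/-- The free evolution for a time `h²`, conjugated by the phase `φ / √h`, and corrected by the phase
`-√h φ'³`. -/
def transportStep (α : ℝ) (φ : ℝ → ℝ) (h : ℝ) : L2 ≃ₗᵢ[ℂ] L2 :=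
  phase (fun x => -√h * deriv φ x ^ 3) * (phase (fun x => -(√h)⁻¹ * φ x) *
    freeU α (h ^ 2) * phase fun x => (√h)⁻¹ * φ x)

theorem continuous_comp_fam {E : Type*} [NormedAddCommGroup E] [NormedSpace ℝ E] {F : ℝ → ℝ → E}
    (hF : SmoothFam F) : Continuous fun z : ℝ × ℝ × ℝ × ℝ => F z.2.2.1 z.2.2.2 :=
  hF.1.continuous.comp
    (continuous_snd.comp continuous_snd : Continuous fun z : ℝ × ℝ × ℝ × ℝ => z.2.2)

/-- Put `e = √h`. With `Θ = φ/e` and duration `e⁴`, the cubic part of the conjugated generator gives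
`i e φ'³`, the quadratic part gives `e²(3φ'²∂ₓ + 3φ'φ'' - iαφ'²)`, and the remaining parts are
`O(e³)`. The comparison curve is `e^{i(φ/e + s e φ'³)} (g + s e² k)` with `k` the first order
operator applied to `g`; the last phase of `transportStep` strips `e^{ieφ'³}` at `s = 1`. -/
theorem consistent_transportStep (α : ℝ) {φ : ℝ → ℝ} (hφ : SmoothPer φ) :
    Consistent (transportStep α φ) (fun x => 3 * ((deriv φ x : ℝ) : ℂ) ^ 2)
      fun x => 3 * ((deriv φ x : ℝ) : ℂ) * ((deriv (deriv φ) x : ℝ) : ℂ) -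
        Complex.I * α * ((deriv φ x : ℝ) : ℂ) ^ 2 := by
  have hU := isUnitaryGroup_freeU α
  set p := deriv φ
  have hp : SmoothPer p := hφ.deriv
  have hp1 := hp.deriv
  have hp2 := hp1.deriv
  set r : ℝ → ℝ := fun x => p x ^ 3 with hr
  have hr0 : SmoothPer r := hp.pow 3
  have hr1 := hr0.deriv
  have hr2 := hr1.deriv
  have hr3 := hr2.deriv
  set a : ℝ → ℂ := fun x => 3 * (p x : ℂ) ^ 2
  set b : ℝ → ℂ := fun x => 3 * (p x : ℂ) * ((deriv p x : ℝ) : ℂ) - Complex.I * α * (p x : ℂ) ^ 2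
  have hpc := hp.ofReal
  have ha : SmoothPer a := by
    have := (hpc.mul hpc).const_mul 3
    simpa only [← sq] using this
  have hb : SmoothPer b := by
    have := ((hpc.const_mul 3).mul hp1.ofReal).sub ((hpc.mul hpc).const_mul (Complex.I * α))
    simpa only [← sq] using this
  intro F hF
  have hk := smoothFam_firstOrder ha hb hF
  -- The derivatives of the family are hidden behind opaque names so that the continuity of `R` is
  -- settled with them as atoms.
  obtain ⟨g0, hg0⟩ : ∃ G : ℝ × ℝ × ℝ × ℝ → ℂ, G = fun z => F z.2.2.1 z.2.2.2 := ⟨_, rfl⟩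
  obtain ⟨g1, hg1⟩ : ∃ G : ℝ × ℝ × ℝ × ℝ → ℂ, G = fun z => deriv (F z.2.2.1) z.2.2.2 := ⟨_, rfl⟩
  obtain ⟨g2, hg2⟩ : ∃ G : ℝ × ℝ × ℝ × ℝ → ℂ, G = fun z => deriv (deriv (F z.2.2.1)) z.2.2.2 :=
    ⟨_, rfl⟩
  obtain ⟨g3, hg3⟩ : ∃ G : ℝ × ℝ × ℝ × ℝ → ℂ,
    G = fun z => deriv (deriv (deriv (F z.2.2.1))) z.2.2.2 := ⟨_, rfl⟩
  obtain ⟨k0, hk0⟩ : ∃ G : ℝ × ℝ × ℝ × ℝ → ℂ,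
    G = fun z => firstOrder a b (F z.2.2.1) z.2.2.2 := ⟨_, rfl⟩
  obtain ⟨k1, hk1⟩ : ∃ G : ℝ × ℝ × ℝ × ℝ → ℂ,
    G = fun z => deriv (firstOrder a b (F z.2.2.1)) z.2.2.2 := ⟨_, rfl⟩
  obtain ⟨k2, hk2⟩ : ∃ G : ℝ × ℝ × ℝ × ℝ → ℂ,
    G = fun z => deriv (deriv (firstOrder a b (F z.2.2.1))) z.2.2.2 := ⟨_, rfl⟩
  obtain ⟨k3, hk3⟩ : ∃ G : ℝ × ℝ × ℝ × ℝ → ℂ,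
    G = fun z => deriv (deriv (deriv (firstOrder a b (F z.2.2.1)))) z.2.2.2 := ⟨_, rfl⟩
  have cg0 : Continuous g0 := hg0 ▸ continuous_comp_fam hF
  have cg1 : Continuous g1 := hg1 ▸ continuous_comp_fam hF.deriv_snd
  have cg2 : Continuous g2 := hg2 ▸ continuous_comp_fam hF.deriv_snd.deriv_snd
  have cg3 : Continuous g3 := hg3 ▸ continuous_comp_fam hF.deriv_snd.deriv_snd.deriv_snd
  have ck0 : Continuous k0 := hk0 ▸ continuous_comp_fam hk
  have ck1 : Continuous k1 := hk1 ▸ continuous_comp_fam hk.deriv_snd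
  have ck2 : Continuous k2 := hk2 ▸ continuous_comp_fam hk.deriv_snd.deriv_snd
  have ck3 : Continuous k3 := hk3 ▸ continuous_comp_fam hk.deriv_snd.deriv_snd.deriv_snd
  -- `e³ R` is the defect with its phase factor removed; `R` is polynomial in `e` and `s`. The
  -- variables are `(e, s, t, x)`, and boundedness in `t` gives uniformity along the family.
  set R : ℝ × ℝ × ℝ × ℝ → ℂ := fun z =>
    let e : ℂ := (z.1 : ℝ);
    let s : ℂ := (z.2.1 : ℝ);
    let P : ℂ := p z.2.2.2;
    let P₁ : ℂ := (deriv p z.2.2.2 : ℝ);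
    let ρ : ℂ := (deriv r z.2.2.2 : ℝ);
    let ρ₁ : ℂ := (deriv (deriv r) z.2.2.2 : ℝ);
    let ρ₂ : ℂ := (deriv (deriv (deriv r)) z.2.2.2 : ℝ);
    let A : ℂ := P + e ^ 2 * s * ρ;
    let A₁ : ℂ := P₁ + e ^ 2 * s * ρ₁;
    let A₂ : ℂ := (deriv (deriv p) z.2.2.2 : ℝ) + e ^ 2 * s * ρ₂;
    let G : ℂ := g0 z + s * (e ^ 2 * k0 z);
    let G₁ : ℂ := g1 z + s * (e ^ 2 * k1 z);
    let G₂ : ℂ := g2 z + s * (e ^ 2 * k2 z);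
    let G₃ : ℂ := g3 z + s * (e ^ 2 * k3 z);
    Complex.I * (-(3 * P ^ 2 * s * ρ + 3 * P * e ^ 2 * s ^ 2 * ρ ^ 2 + e ^ 4 * s ^ 3 * ρ ^ 3)) * G +
      -(3 * e) * ((2 * P * s * ρ + e ^ 2 * s ^ 2 * ρ ^ 2) * G₁ + P ^ 2 * s * k1 z) +
      -(3 * e) * ((P * s * ρ₁ + s * ρ * P₁ + e ^ 2 * s ^ 2 * ρ * ρ₁) * G + P * P₁ * s * k0 z) +
      Complex.I * α * e * ((2 * P * s * ρ + e ^ 2 * s ^ 2 * ρ ^ 2) * G + P ^ 2 * s * k0 z) +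
      e * G₃ + 3 * Complex.I * A * G₂ + 3 * Complex.I * A₁ * G₁ + Complex.I * A₂ * G -
      Complex.I * α * (e * G₂ + 2 * Complex.I * A * G₁ + Complex.I * A₁ * G)
  have cR : Continuous R := by
    have := hp.contPer.1; have := hp1.contPer.1; have := hp2.contPer.1
    have := hr1.contPer.1; have := hr2.contPer.1; have := hr3.contPer.1
    fun_prop
  obtain ⟨K, hK0, hK⟩ := exists_bound_of_periodic (R := R) cR (fun e s t x => by
    simp only [R, hg0, hg1, hg2, hg3, hk0, hk1, hk2, hk3, hF.2 t x, hF.deriv_snd.2 t x,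
      hF.deriv_snd.deriv_snd.2 t x, hF.deriv_snd.deriv_snd.deriv_snd.2 t x, hk.2 t x,
      hk.deriv_snd.2 t x, hk.deriv_snd.deriv_snd.2 t x, hk.deriv_snd.deriv_snd.deriv_snd.2 t x,
      hp.2 x, hp1.2 x, hp2.2 x, hr1.2 x, hr2.2 x, hr3.2 x])
  refine ⟨K, hK0, fun h hh t ht => ?_⟩
  obtain ⟨e, he0, he1, rfl⟩ : ∃ e : ℝ, 0 < e ∧ e ≤ 1 ∧ h = e ^ 2 :=
    ⟨√h, Real.sqrt_pos.2 hh.1, Real.sqrt_le_one.2 hh.2, (Real.sq_sqrt hh.1.le).symm⟩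
  rw [transportStep, Real.sqrt_sq he0.le]
  have hFt := hF.smoothPer t
  have hkt := hk.smoothPer t
  set g := F t
  set k := firstOrder a b g
  set c : ℝ → ℝ := fun x => e⁻¹ * φ x
  set d : ℝ → ℝ := fun x => e * r x
  set K' : ℝ → ℂ := fun x => ((e ^ 2 : ℝ) : ℂ) * k x
  have hc : SmoothPer c := hφ.rconst_mul _
  have hd : SmoothPer d := hr0.rconst_mul _
  have hK' : SmoothPer K' := hkt.const_mul _
  have hnc : SmoothPer fun x => -e⁻¹ * φ x := hφ.rconst_mul _
  have hnd : SmoothPer fun x => -e * r x := hr0.rconst_mul _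
  set η : ℝ → L2 := fun s => toL2 fun x =>
    Complex.exp (Complex.I * ((c x + s * d x : ℝ) : ℂ)) * (g x + s * K' x)
  have hη := fun s => hasDerivAt_phase_curve hc hd hFt hK' s
  have hΘ : ∀ s : ℝ, SmoothPer fun x => c x + s * d x := fun s => hc.add (hd.rconst_mul s)
  have hG : ∀ s : ℝ, SmoothPer fun x => g x + s * K' x := fun s => hFt.add (hK'.const_mul s)
  have hη0 : ∀ s : ℝ, SmoothPer fun x =>
    Complex.exp (Complex.I * ((c x + s * d x : ℝ) : ℂ)) * (g x + s * K' x) := fun s =>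
    (hΘ s).cexpI.mul (hG s)
  have key := hU.norm_sub_le (c := e ^ 4) (C := K * e ^ 3) zero_le_one (η := η)
    (fun s _ => hη s) (fun s _ => hasDerivAt_freeFlow α (hη0 s)) (fun s hs => by
      have e2 := fun x => opL_phase α (hΘ s) (hG s) x
      have dΘ : deriv (fun x => c x + s * d x) = fun x => e⁻¹ * p x + s * (e * deriv r x) :=
        funext fun x => (((hφ.hasDerivAt x).const_mul _).add
          (((hr0.hasDerivAt x).const_mul _).const_mul _)).deriv
      have dΘ1 : deriv (fun x => e⁻¹ * p x + s * (e * deriv r x)) =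
          fun x => e⁻¹ * deriv p x + s * (e * deriv (deriv r) x) :=
        funext fun x => (((hp.hasDerivAt x).const_mul _).add
          (((hr1.hasDerivAt x).const_mul _).const_mul _)).deriv
      have dΘ2 : deriv (fun x => e⁻¹ * deriv p x + s * (e * deriv (deriv r) x)) =
          fun x => e⁻¹ * deriv (deriv p) x + s * (e * deriv (deriv (deriv r)) x) :=
        funext fun x => (((hp1.hasDerivAt x).const_mul _).add
          (((hr2.hasDerivAt x).const_mul _).const_mul _)).deriv
      have dG : ∀ {u v : ℝ → ℂ}, SmoothPer u → SmoothPer v →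
          deriv (fun x => u x + s * (((e ^ 2 : ℝ) : ℂ) * v x)) =
          fun x => deriv u x + s * (((e ^ 2 : ℝ) : ℂ) * deriv v x) := fun {u v} hu hv =>
        funext fun x => ((hu.hasDerivAt x).add
          (((hv.hasDerivAt x).const_mul _).const_mul _)).deriv
      simp only [K', dΘ, dΘ1, dΘ2, dG hFt hkt, dG hFt.deriv hkt.deriv,
        dG hFt.deriv.deriv hkt.deriv.deriv] at e2
      rw [real_smul_eq, ← toL2_const_mul _ (smoothPer_opL α (hη0 s)).contPer, ← toL2_sub
        ((hΘ s).cexpI.mul ((((smoothPer_const Complex.I).mul hd.ofReal).mul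
          (hG s)).add hK')).contPer ((smoothPer_const _).mul (smoothPer_opL α (hη0 s))).contPer]
      refine norm_toL2_le (by positivity) fun x => ?_
      simp only [K']
      rw [e2]
      have e3 : Complex.exp (Complex.I * ((c x + s * d x : ℝ) : ℂ)) *
          (Complex.I * d x * (g x + (s : ℂ) * (((e ^ 2 : ℝ) : ℂ) * k x)) +
            ((e ^ 2 : ℝ) : ℂ) * k x) - ((e ^ 4 : ℝ) : ℂ) *
          (Complex.exp (Complex.I * ((c x + s * d x : ℝ) : ℂ)) *
          conjL α (e⁻¹ * p x + s * (e * deriv r x)) (e⁻¹ * deriv p x + s * (e * deriv (deriv r) x))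
            (e⁻¹ * deriv (deriv p) x + s * (e * deriv (deriv (deriv r)) x))
            (g x + s * (((e ^ 2 : ℝ) : ℂ) * k x)) (deriv g x + s * (((e ^ 2 : ℝ) : ℂ) * deriv k x))
            (deriv (deriv g) x + s * (((e ^ 2 : ℝ) : ℂ) * deriv (deriv k) x))
            (deriv (deriv (deriv g)) x + s * (((e ^ 2 : ℝ) : ℂ) * deriv (deriv (deriv k)) x))) =
          Complex.exp (Complex.I * ((c x + s * d x : ℝ) : ℂ)) * ((e ^ 3 : ℝ) * R (e, s, t, x)) := by
        have hec : (e : ℂ) ≠ 0 := by exact_mod_cast he0.ne'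
        have hkx : k x = 3 * (p x : ℂ) ^ 2 * deriv g x +
          (3 * (p x : ℂ) * ((deriv p x : ℝ) : ℂ) - Complex.I * α * (p x : ℂ) ^ 2) * g x := rfl
        have hdx : d x = e * p x ^ 3 := rfl
        have i0 : g0 (e, s, t, x) = g x := by rw [hg0]
        have i1 : g1 (e, s, t, x) = deriv g x := by rw [hg1]
        have i2 : g2 (e, s, t, x) = deriv (deriv g) x := by rw [hg2]
        have i3 : g3 (e, s, t, x) = deriv (deriv (deriv g)) x := by rw [hg3]
        have j0 : k0 (e, s, t, x) = k x := by rw [hk0]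
        have j1 : k1 (e, s, t, x) = deriv k x := by rw [hk1]
        have j2 : k2 (e, s, t, x) = deriv (deriv k) x := by rw [hk2]
        have j3 : k3 (e, s, t, x) = deriv (deriv (deriv k)) x := by rw [hk3]
        rw [mul_left_comm (((e ^ 4 : ℝ) : ℂ)), ← mul_sub]
        congr 1
        simp only [conjL, R, i0, i1, i2, i3, j0, j1, j2, j3, hdx]
        generalize deriv (deriv (deriv k)) x = k3
        generalize deriv (deriv k) x = k2
        generalize deriv k x = k1
        generalize deriv (deriv (deriv r)) x = r3
        generalize deriv (deriv r) x = r2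
        generalize deriv r x = r1
        push_cast
        field_simp
        rw [hkx]
        ring
      rw [e3, norm_mul, mul_comm Complex.I, Complex.norm_exp_ofReal_mul_I, one_mul, norm_mul,
        Complex.norm_real, Real.norm_of_nonneg (by positivity), mul_comm]
      gcongr
      exact hK e ⟨he0.le, he1⟩ s hs t ht x)
  have f0 : η 0 = phase c (toL2 g) := by
    rw [phase_toL2 hc.contPer hFt.contPer]
    simp [η]
  have f1 : toL2 (fun x => g x + K' x) = toL2 g + (e ^ 2) • toL2 k := by
    rw [toL2_add hFt.contPer hK'.contPer, toL2_const_mul _ hkt.contPer, real_smul_eq]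
  have f2 : toL2 g + (e ^ 2) • toL2 k =
      phase (fun x => -e * r x) (phase (fun x => -e⁻¹ * φ x) (η 1)) := by
    have h1 : η 1 = phase (fun x => c x + 1 * d x) (toL2 fun x => g x + K' x) := by
      rw [phase_toL2 (hΘ 1).contPer (hFt.add hK').contPer]
      simp [η]
    rw [h1, phase_phase hnc.contPer (hΘ 1).contPer,
      phase_phase hnd.contPer (hnc.add (hΘ 1)).contPer, ← f1]
    have : (fun x => -e * r x + (-e⁻¹ * φ x + (c x + 1 * d x))) = fun _ => 0 := by
      funext x
      simp only [c, d]
      ring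
    rw [this, phase_zero]
    rfl
  rw [mul_one, mul_one, f0] at key
  rw [sub_sub, f2, ← pow_mul]
  change ‖phase (fun x => -e * r x) (phase (fun x => -e⁻¹ * φ x)
    (freeU α (e ^ 4) (phase c (toL2 g)))) - _‖ ≤ _
  rw [norm_map_sub, norm_map_sub]
  refine key.trans_eq ?_
  ring

/-! ### Functions of two variables with smooth partial derivatives -/

section Partials

variable {E : Type*} [NormedAddCommGroup E] [NormedSpace ℝ E]

/-- Continuous partial derivatives assemble into the Fréchet derivative, which inherits their
regularity. -/
theorem contDiff_succ_of_partials {Φ A B : ℝ → ℝ → E} (n : ℕ)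
    (hA : ∀ t x, HasDerivAt (fun s => Φ s x) (A t x) t)
    (hB : ∀ t x, HasDerivAt (fun y => Φ t y) (B t x) x)
    (cA : ContDiff ℝ n fun p : ℝ × ℝ => A p.1 p.2)
    (cB : ContDiff ℝ n fun p : ℝ × ℝ => B p.1 p.2) :
    ContDiff ℝ (n + 1) fun p : ℝ × ℝ => Φ p.1 p.2 := by
  have sA : ContDiff ℝ n fun p : ℝ × ℝ => ContinuousLinearMap.toSpanSingleton ℝ (A p.1 p.2) :=
    (ContinuousLinearMap.toSpanSingletonCLE (𝕜 := ℝ) (E := E)).contDiff.comp cA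
  have sB : ContDiff ℝ n fun p : ℝ × ℝ => ContinuousLinearMap.toSpanSingleton ℝ (B p.1 p.2) :=
    (ContinuousLinearMap.toSpanSingletonCLE (𝕜 := ℝ) (E := E)).contDiff.comp cB
  refine contDiff_succ_iff_hasFDerivAt.2 ⟨fun p =>
    (ContinuousLinearMap.toSpanSingleton ℝ (A p.1 p.2)).coprod
      (ContinuousLinearMap.toSpanSingleton ℝ (B p.1 p.2)), ?_, fun p => ?_⟩
  · have h1 : ContDiff ℝ n fun p : ℝ × ℝ =>
        (ContinuousLinearMap.toSpanSingleton ℝ (A p.1 p.2)).comp (ContinuousLinearMap.fst ℝ ℝ ℝ) +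
        (ContinuousLinearMap.toSpanSingleton ℝ (B p.1 p.2)).comp (ContinuousLinearMap.snd ℝ ℝ ℝ) :=
      (sA.clm_comp contDiff_const).add (sB.clm_comp contDiff_const)
    convert h1 using 2 with p
    ext <;> simp
  · exact (hasStrictFDerivAt_uncurry_coprod (f := Φ)
      (f₁ := fun t x => ContinuousLinearMap.toSpanSingleton ℝ (A t x))
      (f₂ := fun t x => ContinuousLinearMap.toSpanSingleton ℝ (B t x))
      (Eventually.of_forall fun v => (hA v.1 v.2).hasFDerivAt)
      (Eventually.of_forall fun v => (hB v.1 v.2).hasFDerivAt)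
      sA.continuous.continuousAt sB.continuous.continuousAt).hasFDerivAt

theorem continuous_primitive {k : ℝ → ℝ → E} (hk : Continuous fun p : ℝ × ℝ => k p.1 p.2) :
    Continuous fun p : ℝ × ℝ => ∫ s in (0 : ℝ)..p.1, k s p.2 := by
  refine intervalIntegral.continuous_parametric_intervalIntegral_of_continuous
    (f := fun (p : ℝ × ℝ) s => k s p.2) ?_ continuous_fst
  exact hk.comp (continuous_snd.prodMk (continuous_snd.comp continuous_fst))

theorem hasDerivAt_primitive_param {k k' : ℝ → ℝ → E} (hk : Continuous fun p : ℝ × ℝ => k p.1 p.2)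
    (hk' : Continuous fun p : ℝ × ℝ => k' p.1 p.2)
    (hd : ∀ s x, HasDerivAt (k s) (k' s x) x) (t x : ℝ) :
    HasDerivAt (fun y => ∫ s in (0 : ℝ)..t, k s y) (∫ s in (0 : ℝ)..t, k' s x) x := by
  obtain ⟨C, hC⟩ := ((isCompact_uIcc (a := (0 : ℝ)) (b := t)).prod
    (isCompact_Icc (a := x - 1) (b := x + 1))).exists_bound_of_continuousOn hk'.continuousOn
  have c1 : ∀ y, Continuous fun s => k s y := fun y =>
    hk.comp (continuous_id.prodMk continuous_const)
  have c2 : ∀ y, Continuous fun s => k' s y := fun y =>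
    hk'.comp (continuous_id.prodMk continuous_const)
  exact (intervalIntegral.hasDerivAt_integral_of_dominated_loc_of_deriv_le
    (F := fun y s => k s y) (F' := fun y s => k' s y) (bound := fun _ => C)
    (s := Icc (x - 1) (x + 1)) (Icc_mem_nhds (by linarith) (by linarith))
    (Eventually.of_forall fun y => (c1 y).aestronglyMeasurable)
    ((c1 x).intervalIntegrable _ _) (c2 x).aestronglyMeasurable
    (Eventually.of_forall fun s hs y hy => hC (s, y) ⟨uIoc_subset_uIcc hs, hy⟩)
    intervalIntegrable_const (Eventually.of_forall fun s _ y _ => hd s y)).2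

variable [CompleteSpace E]

/-- Induction on the order: the partial derivative in `t` is `k`, and the one in `x` is the
primitive of `∂ₓk`, which has one derivative less. -/
theorem contDiff_primitive (n : ℕ) : ∀ {k : ℝ → ℝ → E},
    ContDiff ℝ n (fun p : ℝ × ℝ => k p.1 p.2) →
    ContDiff ℝ n fun p : ℝ × ℝ => ∫ s in (0 : ℝ)..p.1, k s p.2 := by
  induction n with
  | zero =>
    intro k hk
    exact contDiff_zero.2 (continuous_primitive hk.continuous)
  | succ n ih =>
    intro k hk
    have hd : ∀ s x, HasDerivAt (k s) (fderiv ℝ (fun p : ℝ × ℝ => k p.1 p.2) (s, x) (0, 1)) x := by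
      intro s x
      have h1 : HasFDerivAt (fun p : ℝ × ℝ => k p.1 p.2)
          (fderiv ℝ (fun p : ℝ × ℝ => k p.1 p.2) (s, x)) (s, x) :=
        (hk.differentiable (by simp) _).hasFDerivAt
      exact h1.comp_hasDerivAt x ((hasDerivAt_const x s).prodMk (hasDerivAt_id x))
    have hk' : ContDiff ℝ n fun p : ℝ × ℝ =>
        fderiv ℝ (fun p : ℝ × ℝ => k p.1 p.2) (p.1, p.2) (0, 1) :=
      (hk.fderiv_right (m := n) (by simp)).clm_apply contDiff_const
    refine contDiff_succ_of_partials (Φ := fun t x => ∫ s in (0 : ℝ)..t, k s x) n (A := k)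
      (B := fun t x => ∫ s in (0 : ℝ)..t, fderiv ℝ (fun p : ℝ × ℝ => k p.1 p.2) (s, x) (0, 1))
      (fun t x => ?_) (fun t x => ?_) (hk.of_le (by simp))
      (ih (k := fun s x => fderiv ℝ (fun p : ℝ × ℝ => k p.1 p.2) (s, x) (0, 1)) hk')
    · have c1 : Continuous fun s => k s x := hk.continuous.comp
        (continuous_id.prodMk continuous_const)
      exact intervalIntegral.integral_hasDerivAt_right (c1.intervalIntegrable _ _)
        (c1.stronglyMeasurableAtFilter _ _) c1.continuousAt
    · exact hasDerivAt_primitive_param hk.continuous hk'.continuous hd t x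

end Partials

/-! ### The flow of a periodic vector field -/

/-- `X` is the global flow of the vector field `f` on the line. -/
structure IsFlow (f : ℝ → ℝ) (X : ℝ → ℝ → ℝ) : Prop where
  zero : ∀ x, X 0 x = x
  hasDerivAt : ∀ t x, HasDerivAt (fun s => X s x) (f (X t x)) t

theorem SmoothPer.exists_lipschitz {f : ℝ → ℝ} (hf : SmoothPer f) : ∃ K, LipschitzWith K f := by
  obtain ⟨K, hK0, hK⟩ := hf.deriv.contPer.exists_bound
  exact ⟨⟨K, hK0⟩, lipschitzWith_of_nnnorm_deriv_le hf.differentiable fun x => hK x⟩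

/-- A bounded, globally Lipschitz field: Picard–Lindelöf applies on each `[-(n+1), n+1]` with a ball
of radius `M(n+1)`, and uniqueness glues the pieces. -/
theorem exists_isFlow {f : ℝ → ℝ} (hf : SmoothPer f) : ∃ X, IsFlow f X := by
  obtain ⟨K, hK⟩ := hf.exists_lipschitz
  obtain ⟨M, hM0, hM⟩ := hf.contPer.exists_bound
  have h1 : ∀ (n : ℕ) (x : ℝ), ∃ γ : ℝ → ℝ, γ 0 = x ∧
      ∀ t ∈ Ioo (-((n : ℝ) + 1)) (n + 1), HasDerivAt γ (f (γ t)) t := by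
    intro n x
    have hP : IsPicardLindelof (fun _ => f) (tmin := -((n : ℝ) + 1)) (tmax := n + 1)
        ⟨0, by constructor <;> linarith [Nat.cast_nonneg (α := ℝ) n]⟩ x
        ⟨M * (n + 1), by positivity⟩ 0 ⟨M, hM0⟩ K := by
      refine IsPicardLindelof.of_time_independent (fun y _ => hM y) hK.lipschitzOnWith ?_
      change M * max ((n : ℝ) + 1 - 0) (0 - -((n : ℝ) + 1)) ≤ M * (n + 1) - 0
      simp
    obtain ⟨γ, h0, hγ⟩ := hP.exists_eq_forall_mem_Icc_hasDerivWithinAt₀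
    exact ⟨γ, h0, fun t ht => (hγ t (Ioo_subset_Icc_self ht)).hasDerivAt
      (Icc_mem_nhds ht.1 ht.2)⟩
  choose γ hγ0 hγ using h1
  have huniq : ∀ m n x, m ≤ n → EqOn (γ m x) (γ n x) (Ioo (-((m : ℝ) + 1)) (m + 1)) := by
    intro m n x hmn
    have hmn' : (m : ℝ) ≤ n := by exact_mod_cast hmn
    refine ODE_solution_unique_of_mem_Ioo (v := fun _ => f) (s := fun _ => univ) (K := K) (t₀ := 0)
      (fun t _ => hK.lipschitzOnWith) ⟨by linarith [Nat.cast_nonneg (α := ℝ) m], by positivity⟩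
      (fun t ht => ⟨hγ m x t ht, trivial⟩)
      (fun t ht => ⟨hγ n x t ⟨by linarith [ht.1], by linarith [ht.2]⟩, trivial⟩) ?_
    rw [hγ0, hγ0]
  have hmem : ∀ t : ℝ, t ∈ Ioo (-((⌈|t|⌉₊ : ℝ) + 1)) (⌈|t|⌉₊ + 1) := fun t => by
    have := Nat.le_ceil |t|
    exact ⟨by linarith [neg_abs_le t], by linarith [le_abs_self t]⟩
  refine ⟨fun t x => γ ⌈|t|⌉₊ x t, fun x => by simp [hγ0], fun t x => ?_⟩
  set N := ⌈|t|⌉₊ + 1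
  have heq : ∀ s ∈ Ioo (-((⌈|t|⌉₊ : ℝ) + 1)) (⌈|t|⌉₊ + 1), γ ⌈|s|⌉₊ x s = γ N x s := by
    intro s hs
    refine huniq _ _ x ?_ (hmem s)
    refine Nat.ceil_le.2 ?_
    push_cast [N]
    exact (abs_lt.2 hs).le
  have hN : t ∈ Ioo (-((N : ℝ) + 1)) (N + 1) := by
    have := hmem t
    push_cast [N]
    exact ⟨by linarith [this.1], by linarith [this.2]⟩
  have h2 := hγ N x t hN
  rw [← heq t (hmem t)] at h2
  exact h2.congr_of_eventuallyEq
    (eventually_of_mem (Ioo_mem_nhds (hmem t).1 (hmem t).2) heq)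

namespace IsFlow

variable {f : ℝ → ℝ} {X : ℝ → ℝ → ℝ}

theorem eq_of_hasDerivAt (hX : IsFlow f X) (hf : SmoothPer f) {γ : ℝ → ℝ} {x : ℝ} (h0 : γ 0 = x)
    (hγ : ∀ t, HasDerivAt γ (f (γ t)) t) (t : ℝ) : γ t = X t x := by
  obtain ⟨K, hK⟩ := hf.exists_lipschitz
  have := ODE_solution_unique_univ (v := fun _ => f) (s := fun _ => univ) (K := K) (t₀ := 0)
    (fun _ => hK.lipschitzOnWith) (fun t => ⟨hγ t, trivial⟩)
    (fun t => ⟨hX.hasDerivAt t x, trivial⟩) (by rw [h0, hX.zero])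
  exact congrFun this t

theorem add (hX : IsFlow f X) (hf : SmoothPer f) (s t x : ℝ) : X (s + t) x = X s (X t x) := by
  refine hX.eq_of_hasDerivAt hf (γ := fun s => X (s + t) x) (by simp) (fun r => ?_) s
  exact (hX.hasDerivAt (r + t) x).comp_add_const r t

theorem periodic (hX : IsFlow f X) (hf : SmoothPer f) (t x : ℝ) :
    X t (x + 2 * Real.pi) = X t x + 2 * Real.pi := by
  refine (hX.eq_of_hasDerivAt hf (γ := fun s => X s x + 2 * Real.pi) ?_ (fun r => ?_) t).symm
  · simp only [hX.zero]
  · simp only [hf.2 _]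
    exact (hX.hasDerivAt r x).add_const _

theorem continuous_fst (hX : IsFlow f X) (x : ℝ) : Continuous fun t => X t x :=
  continuous_iff_continuousAt.2 fun t => (hX.hasDerivAt t x).continuousAt

/-- The divided differences of `f`. -/
def dividedDiff (f : ℝ → ℝ) (u v : ℝ) : ℝ := ∫ r in (0 : ℝ)..1, deriv f (u + r * (v - u))

theorem dividedDiff_spec (hf : SmoothPer f) (u v : ℝ) :
    f v - f u = (v - u) * dividedDiff f u v := by
  have hc := hf.deriv.contPer.1
  have h1 : ∀ r : ℝ, HasDerivAt (fun r => f (u + r * (v - u)))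
      (deriv f (u + r * (v - u)) * (v - u)) r := fun r => by
    have h2 : HasDerivAt (fun r : ℝ => u + r * (v - u)) (v - u) r := by
      simpa using ((hasDerivAt_id r).mul_const (v - u)).const_add u
    exact (hf.hasDerivAt _).comp r h2
  have h3 := intervalIntegral.integral_eq_sub_of_hasDerivAt (a := 0) (b := 1)
    (fun r _ => h1 r) ((by fun_prop : Continuous fun r : ℝ =>
      deriv f (u + r * (v - u)) * (v - u)).intervalIntegrable _ _)
  rw [intervalIntegral.integral_mul_const] at h3
  simp only [one_mul, zero_mul, add_zero, add_sub_cancel] at h3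
  rw [dividedDiff, ← h3, mul_comm]

theorem dividedDiff_self (u : ℝ) : dividedDiff f u u = deriv f u := by
  simp [dividedDiff]

theorem continuous_dividedDiff (hf : SmoothPer f) :
    Continuous fun p : ℝ × ℝ => dividedDiff f p.1 p.2 := by
  have hc := hf.deriv.contPer.1
  refine intervalIntegral.continuous_parametric_intervalIntegral_of_continuous'
    (f := fun (p : ℝ × ℝ) r => deriv f (p.1 + r * (p.2 - p.1))) ?_ 0 1
  simp only [Function.uncurry_def]
  fun_prop

/-- The difference of two trajectories solves a scalar linear equation whose coefficient is a
divided difference of `f`. The explicit solution yields Lipschitz dependence on the initial point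
and, as `y → x`, the spatial derivative. -/
theorem sub_eq (hX : IsFlow f X) (hf : SmoothPer f) (t x y : ℝ) :
    X t y - X t x = (y - x) * Real.exp (∫ s in (0 : ℝ)..t, dividedDiff f (X s x) (X s y)) := by
  set k : ℝ → ℝ := fun s => dividedDiff f (X s x) (X s y)
  have ck : Continuous k := (continuous_dividedDiff hf).comp
    ((hX.continuous_fst x).prodMk (hX.continuous_fst y))
  set J : ℝ → ℝ := fun t => ∫ s in (0 : ℝ)..t, k s
  have hJ : ∀ t, HasDerivAt J (k t) t := fun t =>
    intervalIntegral.integral_hasDerivAt_right (ck.intervalIntegrable _ _)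
      (ck.stronglyMeasurableAtFilter _ _) ck.continuousAt
  have hD : ∀ t, HasDerivAt (fun t => (X t y - X t x) * Real.exp (-J t)) 0 t := fun t => by
    convert! ((hX.hasDerivAt t y).sub (hX.hasDerivAt t x)).mul (hJ t).neg.exp using 1
    rw [dividedDiff_spec hf]
    simp only [k, Pi.neg_apply, Pi.sub_apply]
    ring
  have h1 := is_const_of_deriv_eq_zero (fun t => (hD t).differentiableAt) (fun t => (hD t).deriv)
    t 0
  simp only [J, intervalIntegral.integral_same, neg_zero, Real.exp_zero, mul_one, hX.zero] at h1
  rw [← h1, mul_assoc, ← Real.exp_add, neg_add_cancel, Real.exp_zero, mul_one]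

theorem continuous (hX : IsFlow f X) (hf : SmoothPer f) :
    Continuous fun p : ℝ × ℝ => X p.1 p.2 := by
  obtain ⟨K, hK0, hK⟩ := hf.deriv.contPer.exists_bound
  have hdd : ∀ u v, |dividedDiff f u v| ≤ K := fun u v => by
    have := intervalIntegral.norm_integral_le_of_norm_le_const (a := 0) (b := 1) (C := K)
      (f := fun r => deriv f (u + r * (v - u))) fun r _ => hK _
    simpa [dividedDiff] using this
  have hlip : ∀ t x y, |X t y - X t x| ≤ |y - x| * Real.exp (K * |t|) := fun t x y => by
    rw [hX.sub_eq hf, abs_mul, Real.abs_exp]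
    gcongr
    refine (le_abs_self _).trans ?_
    have := intervalIntegral.norm_integral_le_of_norm_le_const (a := 0) (b := t) (C := K)
      (f := fun s => dividedDiff f (X s x) (X s y)) fun r _ => hdd _ _
    simpa using this
  rw [continuous_iff_continuousAt]
  rintro ⟨t, x⟩
  have h1 : Tendsto (fun p : ℝ × ℝ => |p.2 - x| * Real.exp (K * |p.1|)) (𝓝 (t, x)) (𝓝 0) := by
    have : Continuous fun p : ℝ × ℝ => |p.2 - x| * Real.exp (K * |p.1|) := by fun_prop
    simpa using this.tendsto (t, x)
  have h2 : Tendsto (fun p : ℝ × ℝ => X p.1 p.2 - X p.1 x) (𝓝 (t, x)) (𝓝 0) :=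
    squeeze_zero_norm (fun p => hlip p.1 x p.2) h1
  have h3 : Tendsto (fun p : ℝ × ℝ => X p.1 x) (𝓝 (t, x)) (𝓝 (X t x)) :=
    ((hX.continuous_fst x).comp _root_.continuous_fst).tendsto (t, x)
  have h4 := h2.add h3
  simp only [sub_add_cancel, zero_add] at h4
  exact h4

/-- The derivative of the flow in the space variable. -/
theorem hasDerivAt_snd (hX : IsFlow f X) (hf : SmoothPer f) (t x : ℝ) :
    HasDerivAt (X t) (Real.exp (∫ s in (0 : ℝ)..t, deriv f (X s x))) x := by
  have hXc := hX.continuous hf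
  have hc : Continuous fun y => Real.exp (∫ s in (0 : ℝ)..t, dividedDiff f (X s x) (X s y)) := by
    refine Real.continuous_exp.comp
      (intervalIntegral.continuous_parametric_intervalIntegral_of_continuous'
        (f := fun y s => dividedDiff f (X s x) (X s y)) ?_ 0 t)
    have c1 : Continuous fun p : ℝ × ℝ => X p.2 x := (hX.continuous_fst x).comp continuous_snd
    have c2 : Continuous fun p : ℝ × ℝ => X p.2 p.1 :=
      hXc.comp (continuous_snd.prodMk _root_.continuous_fst)
    exact (continuous_dividedDiff hf).comp (c1.prodMk c2)
  rw [hasDerivAt_iff_tendsto_slope]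
  have h1 := (hc.tendsto x).mono_left (nhdsWithin_le_nhds (s := {x}ᶜ))
  simp only [dividedDiff_self] at h1
  refine h1.congr' ?_
  filter_upwards [self_mem_nhdsWithin] with y hy
  rw [slope_def_field, hX.sub_eq hf, mul_div_cancel_left₀]
  exact sub_ne_zero.2 hy

/-- Bootstrap: the partial derivatives are `f(X)` and `exp ∫ f'(X)`, which are as regular as `X`, so
`X` gains one order. -/
theorem contDiff_nat (hX : IsFlow f X) (hf : SmoothPer f) (n : ℕ) :
    ContDiff ℝ n fun p : ℝ × ℝ => X p.1 p.2 := by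
  induction n with
  | zero => exact contDiff_zero.2 (hX.continuous hf)
  | succ n ih =>
    refine contDiff_succ_of_partials (Φ := X) n hX.hasDerivAt (hX.hasDerivAt_snd hf) ?_ ?_
    · exact (hf.1.of_le (by exact_mod_cast le_top)).comp ih
    · exact Real.contDiff_exp.comp (contDiff_primitive n (k := fun s x => deriv f (X s x))
        ((hf.deriv.1.of_le (by exact_mod_cast le_top)).comp ih))

theorem contDiff (hX : IsFlow f X) (hf : SmoothPer f) :
    ContDiff ℝ ∞ fun p : ℝ × ℝ => X p.1 p.2 :=
  contDiff_infty.2 (hX.contDiff_nat hf)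

end IsFlow

/-- The square root of the Jacobian of the flow. -/
def flowWeight (f : ℝ → ℝ) (X : ℝ → ℝ → ℝ) (t x : ℝ) : ℝ :=
  Real.exp (1 / 2 * ∫ s in (0 : ℝ)..t, deriv f (X s x))

namespace IsFlow

variable {f : ℝ → ℝ} {X : ℝ → ℝ → ℝ}

theorem flowWeight_zero (x : ℝ) : flowWeight f X 0 x = 1 := by simp [flowWeight]

theorem contDiff_flowWeight (hX : IsFlow f X) (hf : SmoothPer f) :
    ContDiff ℝ ∞ fun p : ℝ × ℝ => flowWeight f X p.1 p.2 := by
  refine Real.contDiff_exp.comp (contDiff_const.mul (contDiff_infty.2 fun n => ?_))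
  exact contDiff_primitive n (k := fun s x => deriv f (X s x))
        ((hf.deriv.1.of_le (by exact_mod_cast le_top)).comp (hX.contDiff_nat hf n))

theorem flowWeight_periodic (hX : IsFlow f X) (hf : SmoothPer f) (t : ℝ) :
    Function.Periodic (flowWeight f X t) (2 * Real.pi) := fun x => by
  simp only [flowWeight, hX.periodic hf, hf.deriv.2 _]

theorem flowWeight_add (hX : IsFlow f X) (hf : SmoothPer f) (s t x : ℝ) :
    flowWeight f X (s + t) x = flowWeight f X t x * flowWeight f X s (X t x) := by
  have hc : Continuous fun r => deriv f (X r x) :=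
    hf.deriv.contPer.1.comp (hX.continuous_fst x)
  simp only [flowWeight, ← Real.exp_add, ← mul_add]
  congr 2
  have h1 : ∫ r in (0 : ℝ)..s, deriv f (X r (X t x)) = ∫ r in t..s + t, deriv f (X r x) := by
    have := intervalIntegral.integral_comp_add_right (a := 0) (b := s)
      (fun r => deriv f (X r x)) t
    rw [zero_add] at this
    rw [← this]
    simp only [hX.add hf]
  rw [h1, intervalIntegral.integral_add_adjacent_intervals (hc.intervalIntegrable _ _)
    (hc.intervalIntegrable _ _)]

theorem hasDerivAt_flowWeight (hX : IsFlow f X) (hf : SmoothPer f) (x : ℝ) :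
    HasDerivAt (fun t => flowWeight f X t x) (1 / 2 * deriv f x) 0 := by
  have hc : Continuous fun r => deriv f (X r x) :=
    hf.deriv.contPer.1.comp (hX.continuous_fst x)
  have h1 : HasDerivAt (fun t => ∫ s in (0 : ℝ)..t, deriv f (X s x)) (deriv f (X 0 x)) 0 :=
    intervalIntegral.integral_hasDerivAt_right (hc.intervalIntegrable _ _)
      (hc.stronglyMeasurableAtFilter _ _) hc.continuousAt
  have h2 := (h1.const_mul (1 / 2)).exp
  simpa [flowWeight, hX.zero] using h2

end IsFlow

/-! ### The transport operator on smooth functions -/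

/-- The operator `f ∂ₓ + f' / 2` on functions on the line. -/
def transportOp (f : ℝ → ℝ) (g : ℝ → ℂ) : ℝ → ℂ :=
  firstOrder (fun x => (f x : ℂ)) (fun x => 1 / 2 * ((deriv f x : ℝ) : ℂ)) g

theorem smoothPer_half_deriv {f : ℝ → ℝ} (hf : SmoothPer f) :
    SmoothPer fun x => 1 / 2 * ((deriv f x : ℝ) : ℂ) := hf.deriv.ofReal.const_mul _

theorem smoothPer_transportOp {f : ℝ → ℝ} {g : ℝ → ℂ} (hf : SmoothPer f) (hg : SmoothPer g) :
    SmoothPer (transportOp f g) := smoothPer_firstOrder hf.ofReal (smoothPer_half_deriv hf) hg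

/-- The term `f'/2` is exactly what makes the sum of the two integrands the total derivative of `f ·
conj g · k`. -/
theorem inner_transportOp_left {f : ℝ → ℝ} {g k : ℝ → ℂ} (hf : SmoothPer f) (hg : SmoothPer g)
    (hk : SmoothPer k) : inner ℂ (toL2 (transportOp f g)) (toL2 k) =
      -inner ℂ (toL2 g) (toL2 (transportOp f k)) := by
  have hTg := smoothPer_transportOp hf hg
  have hTk := smoothPer_transportOp hf hk
  rw [inner_toL2 hTg.contPer hk.contPer, inner_toL2 hg.contPer hTk.contPer, ← mul_neg,
    ← sub_eq_zero, ← mul_sub, sub_neg_eq_add, ← intervalIntegral.integral_add]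
  · rw [integral_deriv_periodic (f := fun x => (f x : ℂ) * ((starRingEnd ℂ) (g x) * k x)),
      mul_zero]
    · intro x
      convert! (hf.ofReal.hasDerivAt x).mul
        ((hasDerivAt_conj (hg.hasDerivAt x)).mul (hk.hasDerivAt x)) using 1
      have : deriv (fun x => (f x : ℂ)) x = ((deriv f x : ℝ) : ℂ) :=
        (hf.hasDerivAt x).ofReal_comp.deriv
      rw [this]
      simp only [transportOp, firstOrder, map_add, map_mul, Complex.conj_ofReal, map_div₀, map_one,
        map_ofNat, Pi.mul_apply]
      ring
    · exact ((hTg.contPer.1.star.mul hk.contPer.1).add (hg.contPer.1.star.mul hTk.contPer.1))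
    · intro x
      simp only [hf.2 x, hg.2 x, hk.2 x]
  · exact (hTg.contPer.1.star.mul hk.contPer.1).intervalIntegrable _ _
  · exact (hg.contPer.1.star.mul hTk.contPer.1).intervalIntegrable _ _

/-! ### Construction of the transport group -/

/-- A norm preserving bijection of the smooth functions extends to a unitary operator. -/
theorem exists_unitary_extension (A B : (ℝ → ℂ) → ℝ → ℂ) (hA : ∀ g, SmoothPer g → SmoothPer (A g))
    (hB : ∀ g, SmoothPer g → SmoothPer (B g)) (hadd : ∀ g k, A (g + k) = A g + A k)
    (hsmul : ∀ (c : ℂ) g, A (c • g) = c • A g) (hAB : ∀ g, A (B g) = g) (hBA : ∀ g, B (A g) = g)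
    (hnorm : ∀ g, SmoothPer g → ‖toL2 (A g)‖ = ‖toL2 g‖) :
    ∃ U : L2 ≃ₗᵢ[ℂ] L2, ∀ g, SmoothPer g → U (toL2 g) = toL2 (A g) := by
  let S : Submodule ℂ (ℝ → ℂ) :=
    { carrier := {g | SmoothPer g}
      add_mem' := fun h₁ h₂ => h₁.add h₂
      zero_mem' := smoothPer_const 0
      smul_mem' := fun c _ h => h.const_mul c }
  let e : S →ₗ[ℂ] L2 :=
    { toFun := fun g => toL2 g.1
      map_add' := fun g k => toL2_add (SmoothPer.contPer g.2) (SmoothPer.contPer k.2)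
      map_smul' := fun c g => toL2_const_mul c (SmoothPer.contPer g.2) }
  let a : S ≃ₗ[ℂ] S :=
    { toFun := fun g => ⟨A g.1, hA _ g.2⟩
      invFun := fun g => ⟨B g.1, hB _ g.2⟩
      left_inv := fun g => Subtype.ext (hBA _)
      right_inv := fun g => Subtype.ext (hAB _)
      map_add' := fun g k => Subtype.ext (hadd _ _)
      map_smul' := fun c g => Subtype.ext (hsmul _ _) }
  have hd : DenseRange e := by
    refine dense_toL2.mono ?_
    rintro _ ⟨g, hg, rfl⟩
    exact ⟨⟨g, hg⟩, rfl⟩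
  refine ⟨a.extendOfIsometry e e hd hd fun g => hnorm _ g.2, fun g hg => ?_⟩
  exact LinearEquiv.extendOfIsometry_eq a e e hd hd (fun g => hnorm _ g.2) ⟨g, hg⟩

/-- `E` is the unitary group which transports smooth functions along the flow of `f`. -/
structure IsTransport (f : ℝ → ℝ) (E : ℝ → (L2 ≃ₗᵢ[ℂ] L2)) : Prop extends IsUnitaryGroup E where
  exists_fam : ∀ g, SmoothPer g → ∃ F : ℝ → ℝ → ℂ, SmoothFam F ∧ F 0 = g ∧
    (∀ t, E t (toL2 g) = toL2 (F t)) ∧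
    ∀ t, HasDerivAt (fun s => toL2 (F s)) (toL2 (transportOp f (F t))) t

/-- The transport of a function along the flow `X` of `f`. -/
def transportFun (f : ℝ → ℝ) (X : ℝ → ℝ → ℝ) (t : ℝ) (g : ℝ → ℂ) (x : ℝ) : ℂ :=
  (flowWeight f X t x : ℂ) * g (X t x)

namespace IsFlow

variable {f : ℝ → ℝ} {X : ℝ → ℝ → ℝ} {g : ℝ → ℂ}

theorem transportFun_zero (hX : IsFlow f X) (g : ℝ → ℂ) : transportFun f X 0 g = g := by
  funext x
  simp [transportFun, flowWeight_zero, hX.zero]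

theorem transportFun_add (hX : IsFlow f X) (hf : SmoothPer f) (s t : ℝ) (g : ℝ → ℂ) :
    transportFun f X (s + t) g = transportFun f X t (transportFun f X s g) := by
  funext x
  simp only [transportFun, hX.flowWeight_add hf, hX.add hf, Complex.ofReal_mul, mul_assoc]

theorem smoothFam_transportFun (hX : IsFlow f X) (hf : SmoothPer f) (hg : SmoothPer g) :
    SmoothFam fun t => transportFun f X t g := by
  refine ⟨(Complex.ofRealCLM.contDiff.comp (hX.contDiff_flowWeight hf)).mul
    (hg.1.comp (hX.contDiff hf)), fun t x => ?_⟩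
  simp only [transportFun, hX.periodic hf, hX.flowWeight_periodic hf t x, hg.2 _]

theorem deriv_transportFun_zero (hX : IsFlow f X) (hf : SmoothPer f) (hg : SmoothPer g) (x : ℝ) :
    HasDerivAt (fun t => transportFun f X t g x) (transportOp f g x) 0 := by
  have h1 : HasDerivAt (fun t => X t x) (f x) 0 := by simpa [hX.zero] using hX.hasDerivAt 0 x
  have h2 : HasDerivAt g (deriv g x) (X 0 x) := by rw [hX.zero]; exact hg.hasDerivAt x
  have h3 := (hX.hasDerivAt_flowWeight hf x).ofReal_comp.mul (h2.scomp 0 h1)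
  convert! h3 using 1
  simp only [transportOp, firstOrder, Function.comp_apply, flowWeight_zero, hX.zero,
    Complex.real_smul]
  push_cast
  ring

/-- The group law moves the derivative at time `0` to time `t`. -/
theorem deriv_transportFun (hX : IsFlow f X) (hf : SmoothPer f) (hg : SmoothPer g) (t x : ℝ) :
    deriv (fun s => transportFun f X s g x) t = transportOp f (transportFun f X t g) x := by
  have h1 := hX.deriv_transportFun_zero hf ((hX.smoothFam_transportFun hf hg).smoothPer t) x
  have h2 : HasDerivAt (fun r => transportFun f X r (transportFun f X t g) x)
      (transportOp f (transportFun f X t g) x) (t + -t) := by rwa [add_neg_cancel]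
  have h3 := h2.comp_add_const t (-t)
  simp only [← hX.transportFun_add hf, add_neg_cancel_comm_assoc] at h3
  exact h3.deriv

theorem hasDerivAt_toL2_transportFun (hX : IsFlow f X) (hf : SmoothPer f) (hg : SmoothPer g)
    (t : ℝ) : HasDerivAt (fun s => toL2 (transportFun f X s g))
      (toL2 (transportOp f (transportFun f X t g))) t := by
  have h1 := (hX.smoothFam_transportFun hf hg).hasDerivAt_toL2 t
  simp only [hX.deriv_transportFun hf hg] at h1
  exact h1

/-- Skew-symmetry makes the squared norm constant in time, so no change of variables in the integral
is needed. -/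
theorem norm_toL2_transportFun (hX : IsFlow f X) (hf : SmoothPer f) (hg : SmoothPer g) (t : ℝ) :
    ‖toL2 (transportFun f X t g)‖ = ‖toL2 g‖ := by
  have h1 : ∀ t, HasDerivAt (fun s => inner ℂ (toL2 (transportFun f X s g))
      (toL2 (transportFun f X s g))) 0 t := fun t => by
    have hs := (hX.smoothFam_transportFun hf hg).smoothPer t
    have h2 := (hX.hasDerivAt_toL2_transportFun hf hg t).inner ℂ
      (hX.hasDerivAt_toL2_transportFun hf hg t)
    rwa [inner_transportOp_left hf hs hs, add_neg_cancel] at h2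
  have h2 := is_const_of_deriv_eq_zero (fun t => (h1 t).differentiableAt)
    (fun t => (h1 t).deriv) t 0
  simp only [hX.transportFun_zero, inner_self_eq_norm_sq_to_K] at h2
  have h3 : ‖toL2 (transportFun f X t g)‖ ^ 2 = ‖toL2 g‖ ^ 2 := by exact_mod_cast h2
  exact (pow_left_inj₀ (norm_nonneg _) (norm_nonneg _) two_ne_zero).1 h3

end IsFlow

/-- Unitary operators which agree on smooth functions are equal. -/
theorem unitary_ext {A B : L2 ≃ₗᵢ[ℂ] L2} (h : ∀ g, SmoothPer g → A (toL2 g) = B (toL2 g)) :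
    A = B := by
  refine LinearIsometryEquiv.ext fun ψ => ?_
  refine congrFun (Continuous.ext_on dense_toL2 A.continuous B.continuous ?_) ψ
  rintro _ ⟨g, hg, rfl⟩
  exact h g hg

theorem exists_isTransport {f : ℝ → ℝ} (hf : SmoothPer f) : ∃ E, IsTransport f E := by
  obtain ⟨X, hX⟩ := exists_isFlow hf
  have h1 : ∀ t, ∃ U : L2 ≃ₗᵢ[ℂ] L2, ∀ g, SmoothPer g → U (toL2 g) = toL2 (transportFun f X t g) := by
    intro t
    refine exists_unitary_extension (transportFun f X t) (transportFun f X (-t))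
      (fun g hg => (hX.smoothFam_transportFun hf hg).smoothPer t)
      (fun g hg => (hX.smoothFam_transportFun hf hg).smoothPer (-t)) (fun g k => ?_)
      (fun c g => ?_) (fun g => ?_) (fun g => ?_) fun g hg => hX.norm_toL2_transportFun hf hg t
    · funext x
      simp only [transportFun, Pi.add_apply, mul_add]
    · funext x
      simp only [transportFun, Pi.smul_apply, smul_eq_mul, mul_left_comm]
    · rw [← hX.transportFun_add hf, neg_add_cancel, hX.transportFun_zero]
    · rw [← hX.transportFun_add hf, add_neg_cancel, hX.transportFun_zero]
  choose E hE using h1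
  refine ⟨E, IsUnitaryGroup.of_smooth (unitary_ext fun g hg => ?_) (fun s t => unitary_ext fun g hg => ?_)
    fun g hg => ?_, fun g hg => ?_⟩
  · rw [hE 0 g hg, hX.transportFun_zero]
    rfl
  · change _ = E s (E t (toL2 g))
    rw [hE _ g hg, hE _ g hg, hE _ _ ((hX.smoothFam_transportFun hf hg).smoothPer t), add_comm,
      hX.transportFun_add hf]
  · simp only [hE _ g hg]
    exact (hX.hasDerivAt_toL2_transportFun hf hg 0).continuousAt
  · exact ⟨fun t => transportFun f X t g, hX.smoothFam_transportFun hf hg, hX.transportFun_zero g,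
      fun t => hE t g hg, hX.hasDerivAt_toL2_transportFun hf hg⟩

/-- Uniqueness for the Cauchy problem: `U (-s) (η s)` has zero derivative. -/
theorem IsUnitaryGroup.apply_eq_of_hasDerivAt {U : ℝ → (L2 ≃ₗᵢ[ℂ] L2)} (hU : IsUnitaryGroup U)
    {η ζ : ℝ → L2} (hη : ∀ t, HasDerivAt η (ζ t) t)
    (hζ : ∀ t, HasDerivAt (fun r => U r (η t)) (ζ t) 0) (t : ℝ) : U t (η 0) = η t := by
  have h1 : ∀ t, HasDerivAt (fun s => U (-s) (η s)) 0 t := fun t => by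
    have := hU.hasDerivAt_neg_apply (hη t) (hζ t)
    rwa [sub_self, _root_.map_zero] at this
  have h2 := is_const_of_deriv_eq_zero (f := fun s => U (-s) (η s)) (fun t => (h1 t).differentiableAt)
    (fun t => (h1 t).deriv) t 0
  simp only [neg_zero, hU.apply_zero] at h2
  rw [← h2, hU.apply_neg_apply]

namespace IsTransport

variable {f : ℝ → ℝ} {E : ℝ → (L2 ≃ₗᵢ[ℂ] L2)}

theorem hasDerivAt (hE : IsTransport f E) {g : ℝ → ℂ} (hg : SmoothPer g) :
    HasDerivAt (fun t => E t (toL2 g)) (toL2 (transportOp f g)) 0 := by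
  obtain ⟨F, hF, hF0, hEF, hd⟩ := hE.exists_fam g hg
  have := hd 0
  simp only [← hEF, hF0] at this
  exact this

/-- A unitary group whose generator extends the transport operator is the transport group. -/
theorem eq_of_hasDerivAt (hE : IsTransport f E) {U : ℝ → (L2 ≃ₗᵢ[ℂ] L2)} (hU : IsUnitaryGroup U)
    (h : ∀ g, SmoothPer g → HasDerivAt (fun t => U t (toL2 g)) (toL2 (transportOp f g)) 0) :
    U = E := by
  funext t
  refine unitary_ext fun g hg => ?_
  obtain ⟨F, hF, hF0, hEF, hd⟩ := hE.exists_fam g hg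
  rw [hEF, ← hU.apply_eq_of_hasDerivAt hd (fun t => h _ (hF.smoothPer t)) t, hF0]

theorem inner_neg (hE : IsTransport f E) (t : ℝ) (ψ χ : L2) :
    inner ℂ ψ (E t χ) = inner ℂ (E (-t) ψ) χ := by
  rw [← (E (-t)).inner_map_map, hE.apply_apply_neg]

/-- The generator of the transport group is the maximal realization of the transport operator. -/
theorem hasDerivAt_iff (hE : IsTransport f E) (ψ ζ : L2) :
    HasDerivAt (fun t => E t ψ) ζ 0 ↔ ∀ g, SmoothPer g →
      inner ℂ (toL2 g) ζ = -inner ℂ (toL2 (transportOp f g)) ψ := by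
  constructor
  · intro h g hg
    have h1 := (hasDerivAt_const (0 : ℝ) (toL2 g)).inner ℂ h
    have h2 : HasDerivAt (fun t => E (-t) (toL2 g)) (-toL2 (transportOp f g)) 0 := by
      have h3 : HasDerivAt (fun t => E t (toL2 g)) (toL2 (transportOp f g)) (-0) := by
        rw [neg_zero]; exact hE.hasDerivAt hg
      have h4 := h3.scomp (0 : ℝ) (hasDerivAt_neg 0)
      rwa [neg_one_smul] at h4
    have h3 := h2.inner ℂ (hasDerivAt_const (0 : ℝ) ψ)
    simp only [← hE.inner_neg] at h3
    have h4 := h1.unique h3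
    simpa using h4
  · intro h
    -- Smooth functions remain smooth under the group, so the weak identity may be applied to `E
    -- (-t)` of a test function. It shows that `E t ψ` and `P t` have the same derivative against
    -- every smooth function, hence agree, and `P` is differentiable.
    set P : ℝ → L2 := fun t => ψ + ∫ s in (0 : ℝ)..t, E s ζ
    have hP : ∀ t, HasDerivAt P (E t ζ) t := fun t =>
      (intervalIntegral.integral_hasDerivAt_right ((hE.continuous ζ).intervalIntegrable _ _)
        ((hE.continuous ζ).stronglyMeasurableAtFilter _ _)
        (hE.continuous ζ).continuousAt).const_add ψ
    have heq : ∀ t, E t ψ = P t := by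
      intro t
      refine eq_of_inner_toL2 fun g hg => ?_
      obtain ⟨F, hF, hF0, hEF, hd⟩ := hE.exists_fam g hg
      have h1 : ∀ t, HasDerivAt (fun t => inner ℂ (toL2 g) (E t ψ)) (inner ℂ (toL2 g) (E t ζ)) t := by
        intro t
        have h2 : HasDerivAt (fun s => toL2 (F (-s))) (-toL2 (transportOp f (F (-t)))) t := by
          have h4 := (hd (-t)).scomp t (hasDerivAt_neg t)
          rwa [neg_one_smul] at h4
        have h3 := h2.inner ℂ (hasDerivAt_const t ψ)
        simp only [← hEF, ← hE.inner_neg, map_zero, inner_zero_right, zero_add, inner_neg_left] at h3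
        rwa [← h _ (hF.smoothPer _), ← hEF, ← hE.inner_neg] at h3
      have h2 : ∀ t, HasDerivAt (fun t => inner ℂ (toL2 g) (E t ψ) - inner ℂ (toL2 g) (P t)) 0 t := by
        intro t
        have h3 := (hasDerivAt_const t (toL2 g)).inner ℂ (hP t)
        have h4 := (h1 t).sub h3
        rwa [inner_zero_left, add_zero, sub_self] at h4
      have h3 := is_const_of_deriv_eq_zero (fun t => (h2 t).differentiableAt)
        (fun t => (h2 t).deriv) t 0
      simp only [hE.apply_zero, P, intervalIntegral.integral_same, add_zero, sub_self] at h3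
      exact sub_eq_zero.1 h3
    have h1 := hP 0
    rw [hE.apply_zero] at h1
    exact h1.congr_of_eventuallyEq (Eventually.of_forall heq)

end IsTransport

/-! ### The transport group on the torus -/

section Lift

variable {F : Type*} [NormedAddCommGroup F] [NormedSpace ℝ F]

theorem SmoothOnTorus.smoothPer {f : Torus → F} (hf : SmoothOnTorus f) :
    SmoothPer fun x : ℝ => f x :=
  ⟨hf, fun x => by simp⟩

theorem torusDeriv_coe (f : Torus → F) (x : ℝ) :
    torusDeriv f (x : Torus) = deriv (fun y : ℝ => f y) x := by
  have h := deriv_comp_const_add (f := fun y : ℝ => f y) x 0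
  rw [add_zero] at h
  rw [← h]
  rfl

end Lift

theorem inner_toL2_eq_integral {g : ℝ → ℂ} (hg : ContPer g) (ψ : L2) :
    inner ℂ (toL2 g) ψ = ∫ θ, ψ θ * (starRingEnd ℂ) (toTorus hg θ) ∂torusMeasure := by
  rw [toL2_eq hg, L2.inner_def]
  refine integral_congr_ae ?_
  filter_upwards [ContinuousMap.coeFn_toLp (p := 2) (𝕜 := ℂ) torusMeasure (toTorus hg)] with θ hθ
  rw [hθ, RCLike.inner_apply]

theorem coeFn_mulL2 (a : C(Torus, ℂ)) (ψ : L2) :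
    mulL2 a ψ =ᵐ[torusMeasure] fun θ => a θ * ψ θ := by
  filter_upwards [Lp.coeFn_lpSMul (r := 2) (ContinuousMap.toLp (E := ℂ) ∞ torusMeasure ℂ a) ψ,
    ContinuousMap.coeFn_toLp (p := ∞) (𝕜 := ℂ) torusMeasure a] with θ h1 h2
  rw [mulL2, h1, Pi.smul_apply', h2, smul_eq_mul]

theorem inner_mulL2 {p : ℝ → ℝ} (hp : ContPer p) {g : ℝ → ℂ} (hg : ContPer g) (ψ : L2) :
    inner ℂ (toL2 g) (mulL2 (toTorus hp.ofReal) ψ) = inner ℂ (toL2 fun x => p x * g x) ψ := by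
  rw [inner_toL2_eq_integral hg, inner_toL2_eq_integral (hp.ofReal.mul hg)]
  refine integral_congr_ae ?_
  filter_upwards [coeFn_mulL2 (toTorus hp.ofReal) ψ] with θ hθ
  rw [hθ]
  induction θ using QuotientAddGroup.induction_on with
  | H x =>
    change (p x : ℂ) * ψ _ * (starRingEnd ℂ) (g x) = ψ _ * (starRingEnd ℂ) (p x * g x)
    rw [map_mul, Complex.conj_ofReal]
    ring

/-- The inner product is conjugate linear on the left, so `g` corresponds to the test function `χ =
conj g`; conjugation commutes with `f` because `f` is real. -/
theorem isWeakDirDeriv_iff {f : Torus → ℝ} (hf : SmoothOnTorus f) (ψ η : L2) :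
    IsWeakDirDeriv f ψ η ↔ ∀ g, SmoothPer g →
      inner ℂ (toL2 g) η = -inner ℂ (toL2 (deriv fun x : ℝ => (f x : ℂ) * g x)) ψ := by
  have key : ∀ g (hg : SmoothPer g),
      inner ℂ (toL2 (deriv fun x : ℝ => (f x : ℂ) * g x)) ψ =
      ∫ θ, ψ θ * torusDeriv (fun θ' => (f θ' : ℂ) * (starRingEnd ℂ) (toTorus hg.contPer θ')) θ
        ∂torusMeasure := by
    intro g hg
    have hfg := hf.smoothPer.ofReal.mul hg
    rw [inner_toL2_eq_integral hfg.deriv.contPer]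
    congr 1
    funext θ
    induction θ using QuotientAddGroup.induction_on with
    | H x =>
      have h1 := hasDerivAt_conj (hfg.hasDerivAt x)
      simp only [map_mul, Complex.conj_ofReal] at h1
      congr 1
      exact (h1.deriv.symm).trans (torusDeriv_coe
        (fun θ' => (f θ' : ℂ) * (starRingEnd ℂ) (toTorus hg.contPer θ')) x).symm
  constructor
  · intro h g hg
    rw [key g hg, inner_toL2_eq_integral hg.contPer]
    refine h (fun θ => (starRingEnd ℂ) (toTorus hg.contPer θ)) ?_
    exact Complex.conjCLE.contDiff.comp hg.1
  · intro h χ hχ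
    have hg : SmoothPer fun x : ℝ => (starRingEnd ℂ) (χ x) :=
      SmoothPer.comp Complex.conjCLE.contDiff hχ.smoothPer
    have h1 := h _ hg
    rw [key _ hg, inner_toL2_eq_integral hg.contPer] at h1
    have h2 : (fun θ => (starRingEnd ℂ) (toTorus hg.contPer θ)) = χ := by
      funext θ
      induction θ using QuotientAddGroup.induction_on with
      | H x => exact Complex.conj_conj _
    have h3 : ∀ θ, (starRingEnd ℂ) (toTorus hg.contPer θ) = χ θ := congrFun h2
    simpa only [h3] using h1

/-- The distribution `η` must be `ζ - f'ψ/2`. Moving this term to the test side turns `(fg)'` into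
`(fg)' - f'g/2 = fg' + f'g/2`, the transport operator itself. -/
theorem transportGraph_iff {f : Torus → ℝ} (hf : SmoothOnTorus f) (ψ ζ : L2) :
    TransportGraph f ψ ζ ↔ ∀ g, SmoothPer g →
      inner ℂ (toL2 g) ζ = -inner ℂ (toL2 (transportOp (fun x : ℝ => f x) g)) ψ := by
  set p : ℝ → ℝ := fun x => 1 / 2 * deriv (fun y : ℝ => f y) x
  have hp : SmoothPer p := hf.smoothPer.deriv.rconst_mul _
  set m := mulL2 (toTorus hp.contPer.ofReal) ψ
  have h1 : ∀ η : L2, (∀ᵐ θ ∂torusMeasure,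
      ζ θ = η θ + (1 / 2 : ℂ) * ((torusDeriv f θ : ℝ) : ℂ) * ψ θ) ↔ ζ = η + m := by
    intro η
    have h2 : (η + m : L2) =ᵐ[torusMeasure] fun θ =>
        η θ + (1 / 2 : ℂ) * ((torusDeriv f θ : ℝ) : ℂ) * ψ θ := by
      filter_upwards [Lp.coeFn_add η m, coeFn_mulL2 (toTorus hp.contPer.ofReal) ψ] with θ e1 e2
      rw [e1, Pi.add_apply, e2]
      induction θ using QuotientAddGroup.induction_on with
      | H x =>
        have e3 := torusDeriv_coe f x
        change _ + ((p x : ℝ) : ℂ) * _ = _ + 1 / 2 * ((torusDeriv f (x : Torus) : ℝ) : ℂ) * _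
        rw [e3]
        simp only [p]
        push_cast
        rfl
    exact ⟨fun h => Lp.ext (EventuallyEq.trans h h2.symm), fun h => by rw [h]; exact h2⟩
  have h3 : ∀ g, SmoothPer g → inner ℂ (toL2 (transportOp (fun x : ℝ => f x) g)) ψ =
      inner ℂ (toL2 (deriv fun x : ℝ => (f x : ℂ) * g x)) ψ - inner ℂ (toL2 g) m := by
    intro g hg
    have hfg := hf.smoothPer.ofReal.mul hg
    rw [inner_mulL2 hp.contPer hg.contPer, ← inner_sub_left,
      ← toL2_sub hfg.deriv.contPer (hp.ofReal.mul hg).contPer]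
    congr 2
    funext x
    have h4 := ((hf.smoothPer.hasDerivAt x).ofReal_comp.mul (hg.hasDerivAt x)).deriv
    simp only [transportOp, firstOrder]
    refine Eq.trans ?_ (congrArg (· - (p x : ℂ) * g x) h4.symm)
    simp only [p]
    push_cast
    ring
  constructor
  · rintro ⟨η, hη, hζ⟩ g hg
    rw [(h1 η).1 hζ, h3 g hg, inner_add_right, (isWeakDirDeriv_iff hf ψ η).1 hη g hg]
    ring
  · intro h
    refine ⟨ζ - m, (isWeakDirDeriv_iff hf ψ _).2 fun g hg => ?_, (h1 _).2 (sub_add_cancel _ _).symm⟩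
    rw [inner_sub_right, h g hg, h3 g hg]
    ring

theorem IsTransport.isTransportGroup {f : Torus → ℝ} (hf : SmoothOnTorus f)
    {E : ℝ → (L2 ≃ₗᵢ[ℂ] L2)} (hE : IsTransport (fun x : ℝ => f x) E) : IsTransportGroup f E where
  map_zero := hE.map_zero
  map_add := hE.map_add
  strongly_continuous := hE.continuous
  generator ψ ζ := by rw [hE.hasDerivAt_iff, transportGraph_iff hf]

theorem IsTransportGroup.eq_of_isTransport {f : Torus → ℝ} (hf : SmoothOnTorus f)
    {E U : ℝ → (L2 ≃ₗᵢ[ℂ] L2)} (hE : IsTransport (fun x : ℝ => f x) E) (hU : IsTransportGroup f U) :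
    U = E := by
  refine hE.eq_of_hasDerivAt ⟨hU.map_zero, hU.map_add, hU.strongly_continuous⟩ fun g hg => ?_
  rw [hU.generator, ← (hE.isTransportGroup hf).generator]
  exact hE.hasDerivAt hg

theorem existsUnique_isTransportGroup {f : Torus → ℝ} (hf : SmoothOnTorus f) :
    ∃! E : ℝ → (L2 ≃ₗᵢ[ℂ] L2), IsTransportGroup f E := by
  obtain ⟨E, hE⟩ := exists_isTransport hf.smoothPer
  exact ⟨E, hE.isTransportGroup hf, fun U hU => hU.eq_of_isTransport hf hE⟩

theorem IsTransportGroup.isTransport {f : Torus → ℝ} (hf : SmoothOnTorus f)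
    {E : ℝ → (L2 ≃ₗᵢ[ℂ] L2)} (hE : IsTransportGroup f E) : IsTransport (fun x : ℝ => f x) E := by
  obtain ⟨E', hE'⟩ := exists_isTransport hf.smoothPer
  rwa [hE.eq_of_isTransport hf hE']

/-- The group generated by `-T_f` is the group generated by `T_f` run backwards. -/
theorem IsTransport.neg {f : ℝ → ℝ} {E E' : ℝ → (L2 ≃ₗᵢ[ℂ] L2)} (hf : SmoothPer f)
    (hE : IsTransport f E) (hE' : IsTransport (fun x => -f x) E') (t : ℝ) : E (-t) = E' t := by
  have hU : IsUnitaryGroup fun t => E (-t) :=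
    ⟨by rw [neg_zero, hE.map_zero], fun s t => by rw [neg_add, hE.map_add],
      fun ψ => (hE.continuous ψ).comp continuous_neg⟩
  refine congrFun (hE'.eq_of_hasDerivAt hU fun g hg => ?_) t
  have h3 : HasDerivAt (fun t => E t (toL2 g)) (toL2 (transportOp f g)) (-0) := by
    rw [neg_zero]; exact hE.hasDerivAt hg
  have h4 := h3.scomp (0 : ℝ) (hasDerivAt_neg 0)
  rw [neg_one_smul, ← toL2_neg (smoothPer_transportOp hf hg).contPer] at h4
  convert! h4 using 2
  funext x
  have : deriv (fun x => -f x) x = -deriv f x := deriv.fun_neg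
  simp only [transportOp, firstOrder, this]
  push_cast
  ring

theorem smoothOnTorus_of_mem_span {f : Torus → ℝ} (hf : f ∈ Submodule.span ℝ profiles) :
    SmoothOnTorus f := by
  induction hf using Submodule.span_induction with
  | mem f hf =>
    obtain ⟨φ, hφ, rfl⟩ := hf
    have h1 := (hφ.smoothPer.deriv.pow 2).1
    simp only [SmoothOnTorus, torusDeriv_coe]
    exact h1
  | zero => exact contDiff_const
  | add f g _ _ hf hg => exact hf.add hg
  | smul c f _ hf => exact contDiff_const.mul hf

theorem mem_span_of_mem_coneProfiles {f : Torus → ℝ} (hf : f ∈ coneProfiles) :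
    f ∈ Submodule.span ℝ profiles := by
  obtain ⟨m, -, a, g, -, hg, rfl⟩ := hf
  exact Submodule.sum_mem _ fun j _ => Submodule.smul_mem _ _ (Submodule.subset_span (hg j))

/-! ### Products of consistent families -/

theorem IsTransport.consistent {f : ℝ → ℝ} (hf : SmoothPer f) {E : ℝ → (L2 ≃ₗᵢ[ℂ] L2)}
    (hE : IsTransport f E) (c : ℝ) :
    Consistent (fun h => E (c * h)) (fun x => c * (f x : ℂ))
      fun x => c * (1 / 2 * ((deriv f x : ℝ) : ℂ)) :=
  Consistent.of_group hE.toIsUnitaryGroup hf.ofReal (smoothPer_half_deriv hf) c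
    fun _ hg => hE.hasDerivAt hg

/-- The products `V(1/n)ⁿ` of a family consistent with a transport operator converge to the
transport group at time `1`. -/
theorem IsTransport.norm_pow_sub_le {f : ℝ → ℝ} (hf : SmoothPer f) {E V : ℝ → (L2 ≃ₗᵢ[ℂ] L2)}
    (hE : IsTransport f E)
    (hV : Consistent V (fun x => (f x : ℂ)) fun x => 1 / 2 * ((deriv f x : ℝ) : ℂ))
    {g : ℝ → ℂ} (hg : SmoothPer g) :
    ∃ K, 0 ≤ K ∧ ∀ h ∈ Ioc (0 : ℝ) 1, ∀ n : ℕ, n * h ≤ 1 →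
      ‖(V h ^ n) (toL2 g) - E (n * h) (toL2 g)‖ ≤ n * (K * (h * √h)) := by
  obtain ⟨F, hF, hF0, hEF, -⟩ := hE.exists_fam g hg
  have hE1 := hE.consistent hf 1
  simp only [Complex.ofReal_one, one_mul] at hE1
  obtain ⟨K₁, hK₁0, hK₁⟩ := hV F hF
  obtain ⟨K₂, hK₂0, hK₂⟩ := hE1 F hF
  refine ⟨K₁ + K₂, by positivity, fun h hh n => ?_⟩
  induction n with
  | zero =>
    intro _
    simp [hE.apply_zero]
  | succ n ih =>
    intro hn
    push_cast at hn ⊢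
    have hh0 := hh.1
    have hn' : n * h ≤ 1 := by linarith
    have ht : n * h ∈ Icc (0 : ℝ) 1 := ⟨by positivity, hn'⟩
    -- Stability plus consistency: the accumulated error passes through the isometry `V h`
    -- unchanged, and each step adds only the local errors of `V h` and `E h` at `F (n h)`.
    have e1 : (V h ^ (n + 1)) (toL2 g) - E ((n + 1) * h) (toL2 g) =
        V h ((V h ^ n) (toL2 g) - E (n * h) (toL2 g)) +
        ((V h (toL2 (F (n * h))) - toL2 (F (n * h)) - h • toL2 (firstOrder (fun x => (f x : ℂ))
          (fun x => 1 / 2 * ((deriv f x : ℝ) : ℂ)) (F (n * h)))) -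
        (E h (toL2 (F (n * h))) - toL2 (F (n * h)) - h • toL2 (firstOrder (fun x => (f x : ℂ))
          (fun x => 1 / 2 * ((deriv f x : ℝ) : ℂ)) (F (n * h))))) := by
      have e2 : E ((n + 1) * h) (toL2 g) = E h (toL2 (F (n * h))) := by
        rw [add_mul, one_mul, add_comm, hE.apply_add, hEF]
      have e3 : (V h ^ (n + 1)) (toL2 g) = V h ((V h ^ n) (toL2 g)) := by
        rw [pow_succ']
        rfl
      rw [e2, e3, map_sub, hEF]
      abel
    rw [e1]
    refine (norm_add_le _ _).trans ?_
    rw [(V h).norm_map]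
    have := (norm_sub_le _ _).trans (add_le_add (hK₁ h hh _ ht) (hK₂ h hh _ ht))
    calc _ ≤ n * ((K₁ + K₂) * (h * √h)) + (K₁ * (h * √h) + K₂ * (h * √h)) :=
          add_le_add (ih hn') this
      _ = (n + 1) * ((K₁ + K₂) * (h * √h)) := by ring

/-- With `n + 1` steps of size `h = 1/(n+1)`, the error is `K√h` and the total duration `Ch`; both
tend to zero. -/
theorem IsTransport.approxReachable_of_consistent {f : ℝ → ℝ} (hf : SmoothPer f)
    {E V : ℝ → (L2 ≃ₗᵢ[ℂ] L2)} (hE : IsTransport f E)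
    (hV : Consistent V (fun x => (f x : ℂ)) fun x => 1 / 2 * ((deriv f x : ℝ) : ℂ)) {C : ℝ}
    (hr : ∀ h, 0 < h → ApproxReachable α Q (C * h ^ 2) (V h)) : ApproxReachable α Q 0 (E 1) := by
  refine ApproxReachable.of_approx fun g hg ε hε => ?_
  obtain ⟨K, hK0, hK⟩ := hE.norm_pow_sub_le hf hV hg
  have h1 : Tendsto (fun n : ℕ => (1 : ℝ) / ((n : ℝ) + 1)) atTop (𝓝 0) :=
    tendsto_one_div_add_atTop_nhds_zero_nat
  have h2 : Tendsto (fun n : ℕ => C * ((1 : ℝ) / ((n : ℝ) + 1))) atTop (𝓝 0) := by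
    simpa using h1.const_mul C
  have h3 : Tendsto (fun n : ℕ => K * √((1 : ℝ) / ((n : ℝ) + 1))) atTop (𝓝 0) := by
    have := ((Real.continuous_sqrt.tendsto 0).comp h1).const_mul K
    simpa using this
  obtain ⟨n, hn2, hn3⟩ := ((h2.eventually_lt_const hε).and (h3.eventually_lt_const hε)).exists
  set h : ℝ := 1 / ((n : ℝ) + 1)
  have hh0 : 0 < h := by positivity
  have hnh : ((n : ℝ) + 1) * h = 1 := mul_one_div_cancel (by positivity)
  have hh1 : h ≤ 1 := by
    have : (0 : ℝ) ≤ n * h := by positivity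
    linarith
  refine ⟨_, ?_, _, (hr h hh0).pow (n + 1), ?_⟩
  · push_cast
    calc ((n : ℝ) + 1) * (C * h ^ 2) = C * h * (((n : ℝ) + 1) * h) := by ring
      _ ≤ 0 + ε := by rw [hnh]; linarith
  · have := hK h ⟨hh0, hh1⟩ (n + 1) (by push_cast; rw [hnh])
    push_cast at this
    rw [hnh] at this
    refine this.trans ?_
    calc ((n : ℝ) + 1) * (K * (h * √h)) = (((n : ℝ) + 1) * h) * (K * √h) := by ring
      _ ≤ ε := by rw [hnh, one_mul]; exact hn3.le

/-- A family of approximately reachable operators, consistent with the transport along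
`3 (φ₁'² + φ₂'²)`. -/
def squaresStep (α : ℝ) (φ₁ φ₂ : ℝ → ℝ) (h : ℝ) : L2 ≃ₗᵢ[ℂ] L2 :=
  (phase fun x => h * (α * (deriv φ₁ x ^ 2 + deriv φ₂ x ^ 2))) *
    (transportStep α φ₁ h * transportStep α φ₂ h)

/-- The extra phase cancels `-iα(φ₁'² + φ₂'²)`, and `3φ'φ''` is half the derivative of `3φ'²`, so
exactly the transport operator of `f` remains. -/
theorem consistent_squaresStep (α : ℝ) {φ₁ φ₂ f : ℝ → ℝ} (h₁ : SmoothPer φ₁) (h₂ : SmoothPer φ₂)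
    (hf : ∀ x, f x = 3 * (deriv φ₁ x ^ 2 + deriv φ₂ x ^ 2)) :
    Consistent (squaresStep α φ₁ φ₂) (fun x => (f x : ℂ))
      fun x => 1 / 2 * ((deriv f x : ℝ) : ℂ) := by
  have hs : ∀ φ : ℝ → ℝ, SmoothPer φ →
      SmoothPer (fun x => 3 * ((deriv φ x : ℝ) : ℂ) ^ 2) ∧
      SmoothPer fun x => 3 * ((deriv φ x : ℝ) : ℂ) * ((deriv (deriv φ) x : ℝ) : ℂ) -
        Complex.I * α * ((deriv φ x : ℝ) : ℂ) ^ 2 := fun φ hφ => by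
    have a1 : SmoothPer fun x => ((deriv φ x : ℝ) : ℂ) ^ 2 := by
      simpa only [sq] using hφ.deriv.ofReal.mul hφ.deriv.ofReal
    exact ⟨a1.const_mul 3, ((hφ.deriv.ofReal.const_mul 3).mul hφ.deriv.deriv.ofReal).sub
      (a1.const_mul _)⟩
  have hp : SmoothPer fun x => α * (deriv φ₁ x ^ 2 + deriv φ₂ x ^ 2) :=
    ((h₁.deriv.pow 2).add (h₂.deriv.pow 2)).rconst_mul α
  have h := (consistent_phase hp).mul
    ((consistent_transportStep α h₁).mul (consistent_transportStep α h₂) (hs _ h₁).1 (hs _ h₁).2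
      (hs _ h₂).1 (hs _ h₂).2) (smoothPer_const 0) (hp.ofReal.const_mul _)
      ((hs _ h₁).1.add (hs _ h₂).1) ((hs _ h₁).2.add (hs _ h₂).2)
  convert! h using 1 <;> funext x
  · rw [hf]
    push_cast
    ring
  · have hd : deriv f x =
        3 * (2 * deriv φ₁ x * deriv (deriv φ₁) x + 2 * deriv φ₂ x * deriv (deriv φ₂) x) := by
      rw [funext hf]
      have := ((((h₁.deriv.hasDerivAt x).pow 2).add ((h₂.deriv.hasDerivAt x).pow 2)).const_mul
        3).deriv
      refine Eq.trans this ?_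
      push_cast
      ring
    rw [hd]
    push_cast
    ring

theorem approxReachable_transportStep (hQs : ∀ j, SmoothOnTorus (Q j)) (hQ : ControlsSpan Q)
    {φ : ℝ → ℝ} (hφ : SmoothPer φ) (h : ℝ) :
    ApproxReachable α Q (h ^ 2) (transportStep α φ h) := by
  have hr : ∀ p : ℝ → ℝ, SmoothPer p → ∀ s, ApproxReachable α Q 0 (phase fun x => s * p x) :=
    fun p hp => isReachablePhase_of_contPer hQs hQ hp.contPer
  have := (hr _ (hφ.deriv.pow 3) (-√h)).mul (((hr _ hφ (-(√h)⁻¹)).mul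
    (approxReachable_freeU (sq_nonneg h))).mul (hr _ hφ (√h)⁻¹))
  simpa only [transportStep, zero_add, add_zero] using this

theorem approxReachable_squaresStep (hQs : ∀ j, SmoothOnTorus (Q j)) (hQ : ControlsSpan Q)
    {φ₁ φ₂ : ℝ → ℝ} (h₁ : SmoothPer φ₁) (h₂ : SmoothPer φ₂) (h : ℝ) :
    ApproxReachable α Q (2 * h ^ 2) (squaresStep α φ₁ φ₂ h) := by
  have hp : SmoothPer fun x => α * (deriv φ₁ x ^ 2 + deriv φ₂ x ^ 2) :=
    ((h₁.deriv.pow 2).add (h₂.deriv.pow 2)).rconst_mul α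
  have := (isReachablePhase_of_contPer hQs hQ hp.contPer h).mul
    ((approxReachable_transportStep (α := α) hQs hQ h₁ h).mul
      (approxReachable_transportStep hQs hQ h₂ h))
  rwa [zero_add, ← two_mul] at this

/-! ### Rotations -/

theorem smoothFam_translate {g : ℝ → ℂ} (hg : SmoothPer g) : SmoothFam fun t x => g (x + t) :=
  ⟨hg.1.comp (contDiff_snd.add contDiff_fst), fun t x => by
    simp only [add_right_comm x (2 * Real.pi) t, hg.2 _]⟩

/-- The group of the constant field `1` consists of the translations, trivial after a full period.
-/
theorem IsTransport.two_pi_eq_one {R : ℝ → (L2 ≃ₗᵢ[ℂ] L2)} (hR : IsTransport (fun _ => 1) R) :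
    R (2 * Real.pi) = 1 := by
  refine unitary_ext fun g hg => ?_
  have hF := smoothFam_translate hg
  have h1 : ∀ t, HasDerivAt (fun s => toL2 fun x => g (x + s))
      (toL2 (transportOp (fun _ => 1) fun x => g (x + t))) t := fun t => by
    have h2 := hF.hasDerivAt_toL2 t
    convert! h2 using 2
    funext x
    simp only [transportOp, firstOrder, deriv_const, deriv_comp_add_const, deriv_comp_const_add]
    simp
  have h2 := hR.apply_eq_of_hasDerivAt h1 (fun t => hR.hasDerivAt (hF.smoothPer t)) (2 * Real.pi)
  simp only [add_zero, hg.2 _] at h2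
  exact h2

theorem IsTransport.scale {f : ℝ → ℝ} {E : ℝ → (L2 ≃ₗᵢ[ℂ] L2)} (hf : SmoothPer f)
    (hE : IsTransport f E) (c : ℝ) {E' : ℝ → (L2 ≃ₗᵢ[ℂ] L2)}
    (hE' : IsTransport (fun x => c * f x) E') (t : ℝ) : E (c * t) = E' t := by
  have hU : IsUnitaryGroup fun t => E (c * t) :=
    ⟨by rw [mul_zero, hE.map_zero], fun s t => by rw [mul_add, hE.map_add],
      fun ψ => (hE.continuous ψ).comp (continuous_const_mul c)⟩
  refine congrFun (hE'.eq_of_hasDerivAt hU fun g hg => ?_) t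
  have h3 : HasDerivAt (fun t => E t (toL2 g)) (toL2 (transportOp f g)) (c * 0) := by
    rw [mul_zero]; exact hE.hasDerivAt hg
  have h4 := h3.scomp (0 : ℝ) ((hasDerivAt_id (0 : ℝ)).const_mul c)
  rw [mul_one, real_smul_eq, ← toL2_const_mul _ (smoothPer_transportOp hf hg).contPer] at h4
  convert! h4 using 2
  funext x
  have : deriv (fun x => c * f x) x = c * deriv f x := deriv_const_mul_field c
  simp only [transportOp, firstOrder, this]
  push_cast
  ring

/-- A constant `c ≥ 0` is `3(φ₁'² + φ₂'²)` for `√(c/3)` times sine and cosine. A negative angle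
becomes nonnegative after adding full turns, which do not change the operator. -/
theorem IsTransport.approxReachable_rotation (hQs : ∀ j, SmoothOnTorus (Q j))
    (hQ : ControlsSpan Q) {R : ℝ → (L2 ≃ₗᵢ[ℂ] L2)} (hR : IsTransport (fun _ => 1) R) (s : ℝ) :
    ApproxReachable α Q 0 (R s) := by
  have key : ∀ c : ℝ, 0 ≤ c → ApproxReachable α Q 0 (R c) := by
    intro c hc
    obtain ⟨E, hE⟩ := exists_isTransport (smoothPer_const (c * 1 : ℝ))
    have h1 := hR.scale (smoothPer_const 1) c hE 1
    rw [mul_one] at h1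
    rw [h1]
    have hsin : SmoothPer fun x => √(c / 3) * Real.sin x :=
      SmoothPer.rconst_mul ⟨Real.contDiff_sin, Real.sin_periodic⟩ _
    have hcos : SmoothPer fun x => √(c / 3) * Real.cos x :=
      SmoothPer.rconst_mul ⟨Real.contDiff_cos, Real.cos_periodic⟩ _
    refine hE.approxReachable_of_consistent (smoothPer_const _)
      (consistent_squaresStep α hsin hcos fun x => ?_)
      fun h _ => approxReachable_squaresStep hQs hQ hsin hcos h
    have d1 : deriv (fun x => √(c / 3) * Real.sin x) x = √(c / 3) * Real.cos x :=
      ((Real.hasDerivAt_sin x).const_mul _).deriv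
    have d2 : deriv (fun x => √(c / 3) * Real.cos x) x = √(c / 3) * -Real.sin x :=
      ((Real.hasDerivAt_cos x).const_mul _).deriv
    rw [d1, d2, mul_pow, mul_pow, Real.sq_sqrt (by positivity)]
    linear_combination (-c) * Real.sin_sq_add_cos_sq x
  obtain ⟨n, hn⟩ := exists_nat_ge (-s / (2 * Real.pi))
  rw [div_le_iff₀ Real.two_pi_pos] at hn
  have h1 : ∀ n : ℕ, R (s + n * (2 * Real.pi)) = R s := by
    intro n
    induction n with
    | zero => simp
    | succ n ih =>
      push_cast
      rw [add_mul, one_mul, ← add_assoc, hR.map_add, hR.two_pi_eq_one, mul_one, ih]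
  rw [← h1 n]
  exact key _ (by linarith)

/-! ### General vector fields -/

/-- A positive periodic function is a sum of two squares of derivatives of periodic functions. -/
theorem exists_sum_sq_deriv {k : ℝ → ℝ} (hk : SmoothPer k) (hpos : ∀ x, 0 < k x) :
    ∃ φ₁ φ₂ : ℝ → ℝ, SmoothPer φ₁ ∧ SmoothPer φ₂ ∧
      ∀ x, deriv φ₁ x ^ 2 + deriv φ₂ x ^ 2 = k x := by
  set r : ℝ → ℝ := fun x => √(k x)
  have hr : SmoothPer r := ⟨hk.1.sqrt fun x => (hpos x).ne', fun x => by simp only [r, hk.2 x]⟩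
  have hrpos : ∀ x, 0 < r x := fun x => Real.sqrt_pos.2 (hpos x)
  have hi : ∀ a b, IntervalIntegrable r volume a b := fun a b =>
    hr.contPer.1.intervalIntegrable a b
  -- `κ` is the mean of `√k`, so the angle `θ` with `θ' = √k / κ` gains exactly `2π` over a period,
  -- and `κ sin θ`, `κ cos θ` are periodic with derivatives `√k cos θ`, `-√k sin θ`.
  set κ : ℝ := (2 * Real.pi)⁻¹ * ∫ x in (0 : ℝ)..2 * Real.pi, r x
  have hκ : 0 < κ := mul_pos (inv_pos.2 Real.two_pi_pos)
    (intervalIntegral.intervalIntegral_pos_of_pos (hi _ _) hrpos Real.two_pi_pos)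
  set θ : ℝ → ℝ := fun x => κ⁻¹ * ∫ y in (0 : ℝ)..x, r y
  have hθ : ∀ x, HasDerivAt θ (κ⁻¹ * r x) x := fun x =>
    (intervalIntegral.integral_hasDerivAt_right (hi _ _)
      (hr.contPer.1.stronglyMeasurableAtFilter _ _) hr.contPer.1.continuousAt).const_mul _
  have hθc : ContDiff ℝ ∞ θ := by
    refine contDiff_infty_iff_deriv.2 ⟨fun x => (hθ x).differentiableAt, ?_⟩
    rw [funext fun x => (hθ x).deriv]
    exact contDiff_const.mul hr.1
  have hθp : ∀ x, θ (x + 2 * Real.pi) = θ x + 2 * Real.pi := fun x => by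
    simp only [θ]
    rw [← intervalIntegral.integral_add_adjacent_intervals (hi 0 x) (hi _ _), mul_add,
      hr.2.intervalIntegral_add_eq x 0, zero_add]
    congr 1
    have h1 : ∫ x in (0 : ℝ)..2 * Real.pi, r x = κ * (2 * Real.pi) := by
      simp only [κ]
      field_simp
    rw [h1, inv_mul_cancel_left₀ hκ.ne']
  refine ⟨fun x => κ * Real.sin (θ x), fun x => κ * Real.cos (θ x),
    ⟨contDiff_const.mul (Real.contDiff_sin.comp hθc), fun x => ?_⟩,
    ⟨contDiff_const.mul (Real.contDiff_cos.comp hθc), fun x => ?_⟩, fun x => ?_⟩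
  · simp only [hθp, Real.sin_add_two_pi]
  · simp only [hθp, Real.cos_add_two_pi]
  · have d1 : deriv (fun x => κ * Real.sin (θ x)) x = κ * (Real.cos (θ x) * (κ⁻¹ * r x)) :=
      ((hθ x).sin.const_mul _).deriv
    have d2 : deriv (fun x => κ * Real.cos (θ x)) x = κ * (-Real.sin (θ x) * (κ⁻¹ * r x)) :=
      ((hθ x).cos.const_mul _).deriv
    have e : r x ^ 2 = k x := Real.sq_sqrt (hpos x).le
    rw [d1, d2, ← e]
    have h2 := Real.sin_sq_add_cos_sq (θ x)
    field_simp
    linear_combination r x ^ 2 * h2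

/-- Each step transports along the positive field `f + C` and then corrects by the rotation through
`-Ch`, which takes arbitrarily little time. Splitting at every step is needed because the two
transports need not commute. -/
theorem IsTransport.approxReachable (hQs : ∀ j, SmoothOnTorus (Q j)) (hQ : ControlsSpan Q)
    {f : ℝ → ℝ} (hf : SmoothPer f) {E : ℝ → (L2 ≃ₗᵢ[ℂ] L2)} (hE : IsTransport f E) :
    ApproxReachable α Q 0 (E 1) := by
  obtain ⟨M, -, hM⟩ := hf.contPer.exists_bound
  set C : ℝ := M + 1
  have hk : SmoothPer fun x => 1 / 3 * (f x + C) := (hf.add (smoothPer_const C)).rconst_mul _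
  have hpos : ∀ x, 0 < 1 / 3 * (f x + C) := fun x => by
    have := (abs_le.1 (hM x)).1
    simp only [C]
    linarith
  obtain ⟨φ₁, φ₂, h₁, h₂, hφ⟩ := exists_sum_sq_deriv hk hpos
  obtain ⟨R, hR⟩ := exists_isTransport (smoothPer_const (1 : ℝ))
  have hfC := hf.add (smoothPer_const C)
  have hc1 := consistent_squaresStep (f := fun x => f x + C) α h₁ h₂ fun x => by rw [hφ]; ring
  have hc2 := hR.consistent (smoothPer_const 1) (-C)
  have hc := hc1.mul hc2 hfC.ofReal (smoothPer_half_deriv hfC)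
    ((smoothPer_const (1 : ℝ)).ofReal.const_mul _)
    ((smoothPer_half_deriv (smoothPer_const 1)).const_mul _)
  refine hE.approxReachable_of_consistent (C := 2)
    (V := fun h => squaresStep α φ₁ φ₂ h * R (-C * h)) hf ?_ fun h _ => ?_
  · convert! hc using 1 <;> funext x
    · push_cast
      ring
    · have : deriv (fun x => f x + C) x = deriv f x := deriv_add_const C
      rw [this]
      simp
  · simpa only [add_zero] using (approxReachable_squaresStep (α := α) hQs hQ h₁ h₂ h).mul
      (hR.approxReachable_rotation hQs hQ (-C * h))

end KdVSch

end

/-- The transport groups `e^{tT_f}` are well defined for `f` in the linear span of `G`; for `f` in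
the convex cone generated by `G`, `e^{-T_f} = e^{T_{-f}}` is `L²`-STAR; and for `f` in the linear
span of `G`, `e^{T_f}` is `L²`-STAR. -/
theorem proposition4p8 (α : ℝ) (q : ℕ) (Q : Fin q → C(Torus, ℝ))
    (hQ_smooth : ∀ j, SmoothOnTorus (Q j)) (hQ : ControlsSpan Q) :
    (∀ f ∈ Submodule.span ℝ profiles, ∃! E : ℝ → (L2 ≃ₗᵢ[ℂ] L2), IsTransportGroup f E) ∧
    (∀ f ∈ coneProfiles, ∀ E E' : ℝ → (L2 ≃ₗᵢ[ℂ] L2),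
      IsTransportGroup f E → IsTransportGroup (-f) E' →
        E (-1) = E' 1 ∧ L2STAR α Q (E (-1))) ∧
    (∀ f ∈ Submodule.span ℝ profiles, ∀ E : ℝ → (L2 ≃ₗᵢ[ℂ] L2),
      IsTransportGroup f E → L2STAR α Q (E 1)) := by
  refine ⟨fun f hf => existsUnique_isTransportGroup (smoothOnTorus_of_mem_span hf),
    fun f hf E E' hE hE' => ?_, fun f hf E hE => ?_⟩
  -- The span is closed under negation, so the cone case is the general one applied to `-f` at time
  -- `1`.
  · have hs := mem_span_of_mem_coneProfiles hf
    have h1 := smoothOnTorus_of_mem_span hs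
    have h2 := smoothOnTorus_of_mem_span (neg_mem hs)
    have h3 : E (-1) = E' 1 := (hE.isTransport h1).neg h1.smoothPer (hE'.isTransport h2) 1
    refine ⟨h3, ?_⟩
    rw [h3]
    exact ((hE'.isTransport h2).approxReachable hQ_smooth hQ h2.smoothPer).l2STAR
  · have h1 := smoothOnTorus_of_mem_span hf
    exact ((hE.isTransport h1).approxReachable hQ_smooth hQ h1.smoothPer).l2STAR
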